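/- **Setting.** Fix infinite disjoint sets $\Delta_D$ (constants) and $\Delta_N$ (labelled nulls) and a set $\Sigma$ of relation symbols with infinitely many symbols of every arity $\ge 1$. An *interpretation* is a nonempty set of atoms $R(a_1,\dots,a_k)$ with $R\in\Sigma$ and $a_i\in\Delta_D\cup\Delta_N$ in which only finitely many relation symbols occur; its domain is the set of elements occurring in its atoms. An *instance* is a nonempty finite set of atoms over $\Delta_D$; a model of an instance $D$ is an interpretation containing $D$. An ontology $\mathcal O$ is a finite set of sentences. *openGF* consists of the formulas built from atoms $R(\vec x)$ and equalities $x=y$ by Boolean connectives and quantifiers $\forall\vec y(\alpha\to\varphi)$, $\exists\vec y(\alpha\wedge\varphi)$, where the guard $\alpha$ is a relational atom containing all of $\vec y$ and all free variables of $\varphi$, such that every subformula has a free variable. *uGF(=)* consists of the sentences $\forall\vec y(\alpha(\vec y)\to\varphi(\vec y))$ with $\varphi$ in openGF and $\alpha$ a relational atom, or an equality $y=y$, containing all variables $\vec y$. *uGF* is the fragment without equality except as the guard of the outermost quantifier. *uGC$_2$(=)* is defined like uGF(=), but with only two fixed variables $x,y$ and relation symbols of arity at most 2, and additionally allowing the counting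 quantifiers $\exists^{\ge n}z_1(\alpha(z_1,z_2)\wedge\varphi(z_1,z_2))$ with $\{z_1,z_2\}=\{x,y\}$ and $\alpha\in\{R(z_1,z_2),R(z_2,z_1)\}$. When uGC$_2$(=) ontologies are considered, all instances and queries use only relation symbols of arity at most 2. A set $G$ is *guarded* in $D$ if it is a singleton $\{a\}$ with $a\in\mathrm{dom}(D)$ or the set of elements of some atom of $D$. A *rooted acyclic query (rAQ)* is a conjunctive query $q(\vec x)$ whose canonical database $D_q$ (the variables as elements, the atoms of $q$ as facts) has a tree decomposition all of whose bags are guarded sets of $D_q$, each atom's elements lying in some bag, with adjacent bags intersecting, and with a root bag equal to the set of answer variables. We write $\mathcal O,D\models q(\vec a)$ (*$\vec a$ is a certain answer*) if $B\models q(\vec a)$ for all models $B$ of $D$ and $\mathcal O$; this is also used for infinite $D$. *Unravelling.* Let $T(D)$ be the set of finite nonempty sequences $G_0\cdots G_n$ of maximal guarded sets of $D$ such that $G_i\ne G_{i+1}$, $G_i\cap G_{i+1}\neq\emptyset$, and $G_{i-1}\neq G_{i+1}$ (for the *uGF-unravelling*), respectively $G_i\cap G_{i-1}\neq G_i\cap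 G_{i+1}$ (for the *uGC$_2$-unravelling*). To $t=G_0\cdots G_n$ one assigns a copy $\mathrm{bag}(t)$ of the subinstance of $D$ induced by $G_n$; for $n=0$ the copies of elements are fresh, and for $n>0$ the elements of $G_n\cap G_{n-1}$ are represented by their copies in $\mathrm{bag}(G_0\cdots G_{n-1})$ while those of $G_n\setminus G_{n-1}$ get fresh copies. The unravelling is $D^u=\bigcup_{t\in T(D)}\mathrm{bag}(t)$. A uGF(=) (resp. uGC$_2$(=)) ontology $\mathcal O$ is *unravelling tolerant* if for every instance $D$, every rAQ $q(\vec x)$ and every tuple $\vec a$ whose set $G$ of elements is maximal guarded in $D$: $\mathcal O,D\models q(\vec a)$ iff $\mathcal O,D^u\models q(\vec b)$, where $D^u$ is the uGF-unravelling (resp. uGC$_2$-unravelling) and $\vec b$ is the copy of $\vec a$ in $\mathrm{bag}(G)$. *Rewritability.* A *Datalog$^{\neq}$ program* $\Pi$ is a finite set of rules $S(\vec x)\leftarrow \beta_1\wedge\dots\wedge\beta_m$, $m\ge1$, where each $\beta_i$ is a relational atom or an inequality, each variable of the head or of an inequality occurs in a relational atom of the body, the head symbols are intensional (they do not occur in instances),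 and a selected intensional goal symbol does not occur in bodies; a *Datalog program* uses no inequalities. $D\models\Pi(\vec a)$ means that $\mathrm{goal}(\vec a)$ holds in every model of $D$ and $\Pi$. *rAQ-evaluation w.r.t. $\mathcal O$ is Datalog$^{\neq}$-rewritable* (resp. *Datalog-rewritable*) if for every rAQ $q$ and every finite set $S$ of relation symbols there is a Datalog$^{\neq}$ (resp. Datalog) program $\Pi$ such that for all instances $D$ whose relation symbols belong to $S$ and all tuples $\vec a$ in $\mathrm{dom}(D)$: $\mathcal O,D\models q(\vec a)$ iff $D\models\Pi(\vec a)$. **Theorem 4.2.** For every uGF(=) ontology and every uGC$_2$(=) ontology $\mathcal O$, if $\mathcal O$ is unravelling tolerant, then rAQ-evaluation w.r.t. $\mathcal O$ is Datalog$^{\neq}$-rewritable. If moreover $\mathcal O$ is a uGF ontology, then rAQ-evaluation w.r.t. $\mathcal O$ is Datalog-rewritable. -/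

import Mathlib

namespace OMQ

/-! ### Relational vocabularies, atoms, interpretations -/

/-- A relational vocabulary: every symbol has an arity, which is at least one. -/
class Vocab (σ : Type*) where
  arity : σ → ℕ
  arity_pos : ∀ r, 1 ≤ arity r

/-- An atom `R(a₁,…,aₖ)` over the elements (or variables) `U`. -/
structure Atom (σ : Type*) [Vocab σ] (U : Type*) where
  rel : σ
  args : Fin (Vocab.arity rel) → U

section Interpretations

variable {σ : Type*} [Vocab σ] {U W : Type*}

/-- Renaming of the elements of an atom. -/
def Atom.map (f : U → W) (α : Atom σ U) : Atom σ W := ⟨α.rel, f ∘ α.args⟩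

/-- The set of elements of an atom. -/
def Atom.elems (α : Atom σ U) : Set U := Set.range α.args

/-- The set of variables of an atomic formula. -/
def Atom.vars (α : Atom σ ℕ) : Finset ℕ := Finset.univ.image α.args

/-- The relation symbols that occur in a set of atoms. -/
def sig (A : Set (Atom σ U)) : Set σ := Atom.rel '' A

/-- The elements that occur in a set of atoms. -/
def dom (A : Set (Atom σ U)) : Set U := {a | ∃ α ∈ A, a ∈ α.elems}

/-- An interpretation: a nonempty set of atoms in which finitely many relation symbols occur.
Its domain consists of the elements that occur in its atoms. -/
def IsInterp (A : Set (Atom σ U)) : Prop := A.Nonempty ∧ (sig A).Finite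

/-- A (finite) database instance: a nonempty finite set of facts. -/
def IsInstance (D : Set (Atom σ U)) : Prop := D.Nonempty ∧ D.Finite

/-- The guarded sets of a set of atoms. -/
def IsGuarded (A : Set (Atom σ U)) (G : Set U) : Prop :=
  (∃ a ∈ dom A, G = {a}) ∨ ∃ α ∈ A, G = α.elems

/-- The maximal guarded sets, with respect to inclusion. -/
def IsMaxGuarded (A : Set (Atom σ U)) (G : Set U) : Prop := Maximal (IsGuarded A) G

end Interpretations

/-! ### Guarded formulas -/

/-- First-order formulas with guarded quantifiers and guarded counting quantifiers; the guards
of these quantifiers are relational atoms. -/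
inductive Formula (σ : Type*) [Vocab σ] where
  | atom (α : Atom σ ℕ)
  | eq (x y : ℕ)
  | neg (φ : Formula σ)
  | and (φ ψ : Formula σ)
  | or (φ ψ : Formula σ)
  /-- `∀ ys (α → φ)` -/
  | all (ys : Finset ℕ) (α : Atom σ ℕ) (φ : Formula σ)
  /-- `∃ ys (α ∧ φ)` -/
  | ex (ys : Finset ℕ) (α : Atom σ ℕ) (φ : Formula σ)
  /-- `∃^{≥ n} z (α ∧ φ)` -/
  | exGe (n : ℕ) (z : ℕ) (α : Atom σ ℕ) (φ : Formula σ)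

/-- The guard of an outermost universal quantifier: a relational atom or an equality `y = y`. -/
inductive OuterGuard (σ : Type*) [Vocab σ] where
  | atom (α : Atom σ ℕ)
  | eqSelf (y : ℕ)

/-- The sentence `∀ ys (guard → body)`, where `ys` are the variables of the guard. -/
structure Sentence (σ : Type*) [Vocab σ] where
  guard : OuterGuard σ
  body : Formula σ

section Logic

variable {σ : Type*} [Vocab σ] {U : Type*}

/-- Free variables. -/
def Formula.fv : Formula σ → Finset ℕ
  | .atom α => α.vars
  | .eq x y => {x, y}
  | .neg φ => φ.fv
  | .and φ ψ => φ.fv ∪ ψ.fv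
  | .or φ ψ => φ.fv ∪ ψ.fv
  | .all ys α φ => (α.vars ∪ φ.fv) \ ys
  | .ex ys α φ => (α.vars ∪ φ.fv) \ ys
  | .exGe _ z α φ => (α.vars ∪ φ.fv) \ {z}

/-- Truth of a formula in `A` under an assignment; quantifiers range over the domain of `A`. -/
def Formula.Sat (A : Set (Atom σ U)) : Formula σ → (ℕ → U) → Prop
  | .atom α, v => α.map v ∈ A
  | .eq x y, v => v x = v y
  | .neg φ, v => ¬ φ.Sat A v
  | .and φ ψ, v => φ.Sat A v ∧ ψ.Sat A v
  | .or φ ψ, v => φ.Sat A v ∨ ψ.Sat A v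
  | .all ys α φ, v => ∀ w : ℕ → U, (∀ x, x ∉ ys → w x = v x) → (∀ x ∈ ys, w x ∈ dom A) →
      α.map w ∈ A → φ.Sat A w
  | .ex ys α φ, v => ∃ w : ℕ → U, (∀ x, x ∉ ys → w x = v x) ∧ (∀ x ∈ ys, w x ∈ dom A) ∧
      α.map w ∈ A ∧ φ.Sat A w
  | .exGe n z α φ, v => (n : ℕ∞) ≤ Set.encard {d | d ∈ dom A ∧
      α.map (Function.update v z d) ∈ A ∧ φ.Sat A (Function.update v z d)}

/-- openGF, with equality in non-guard positions: all quantifiers are guarded by relational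
atoms and all subformulas are open. -/
def Formula.IsOpenGF : Formula σ → Prop
  | .atom _ => True
  | .eq _ _ => True
  | .neg φ => φ.IsOpenGF
  | .and φ ψ => φ.IsOpenGF ∧ ψ.IsOpenGF
  | .or φ ψ => φ.IsOpenGF ∧ ψ.IsOpenGF
  | .all ys α φ => ys ⊆ α.vars ∧ φ.fv ⊆ α.vars ∧ (α.vars \ ys).Nonempty ∧ φ.IsOpenGF
  | .ex ys α φ => ys ⊆ α.vars ∧ φ.fv ⊆ α.vars ∧ (α.vars \ ys).Nonempty ∧ φ.IsOpenGF
  | .exGe _ _ _ _ => False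

/-- openGC₂, with equality in non-guard positions. The two variables are `0` and `1`, and only
relation symbols of arity at most two occur. A counting quantifier has the form
`∃^{≥ n} z₁ (α(z₁,z₂) ∧ φ(z₁,z₂))` with `{z₁,z₂} = {0,1}` and `α` one of `R(z₁,z₂)`, `R(z₂,z₁)`. -/
def Formula.IsOpenGC2 : Formula σ → Prop
  | .atom α => Vocab.arity α.rel ≤ 2 ∧ α.vars ⊆ {0, 1}
  | .eq x y => ({x, y} : Finset ℕ) ⊆ {0, 1}
  | .neg φ => φ.IsOpenGC2
  | .and φ ψ => φ.IsOpenGC2 ∧ ψ.IsOpenGC2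
  | .or φ ψ => φ.IsOpenGC2 ∧ ψ.IsOpenGC2
  | .all ys α φ => Vocab.arity α.rel ≤ 2 ∧ α.vars ⊆ {0, 1} ∧
      ys ⊆ α.vars ∧ φ.fv ⊆ α.vars ∧ (α.vars \ ys).Nonempty ∧ φ.IsOpenGC2
  | .ex ys α φ => Vocab.arity α.rel ≤ 2 ∧ α.vars ⊆ {0, 1} ∧
      ys ⊆ α.vars ∧ φ.fv ⊆ α.vars ∧ (α.vars \ ys).Nonempty ∧ φ.IsOpenGC2
  | .exGe _ z α φ => Vocab.arity α.rel = 2 ∧ α.vars = {0, 1} ∧ z ∈ ({0, 1} : Finset ℕ) ∧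
      φ.IsOpenGC2

/-- The formula contains no equality atom. -/
def Formula.EqFree : Formula σ → Prop
  | .atom _ => True
  | .eq _ _ => False
  | .neg φ => φ.EqFree
  | .and φ ψ => φ.EqFree ∧ ψ.EqFree
  | .or φ ψ => φ.EqFree ∧ ψ.EqFree
  | .all _ _ φ => φ.EqFree
  | .ex _ _ φ => φ.EqFree
  | .exGe _ _ _ φ => φ.EqFree

def OuterGuard.vars : OuterGuard σ → Finset ℕ
  | .atom α => α.vars
  | .eqSelf y => {y}

def OuterGuard.Sat (A : Set (Atom σ U)) : OuterGuard σ → (ℕ → U) → Prop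
  | .atom α, v => α.map v ∈ A
  | .eqSelf y, v => v y = v y

/-- The guard uses only the two variables `0`, `1` and relation symbols of arity at most two. -/
def OuterGuard.IsTwoVar : OuterGuard σ → Prop
  | .atom α => Vocab.arity α.rel ≤ 2 ∧ α.vars ⊆ {0, 1}
  | .eqSelf y => y ∈ ({0, 1} : Finset ℕ)

/-- Truth of `∀ ys (guard → body)` in `A`. -/
def Sentence.Holds (s : Sentence σ) (A : Set (Atom σ U)) : Prop :=
  ∀ v : ℕ → U, (∀ x ∈ s.guard.vars, v x ∈ dom A) → s.guard.Sat A v → s.body.Sat A v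

/-- uGF(=) sentences. -/
def Sentence.IsUGFEq (s : Sentence σ) : Prop :=
  s.body.fv ⊆ s.guard.vars ∧ s.body.IsOpenGF

/-- uGF sentences: equality occurs at most as the guard of the outermost quantifier. -/
def Sentence.IsUGF (s : Sentence σ) : Prop := s.IsUGFEq ∧ s.body.EqFree

/-- uGC₂(=) sentences. -/
def Sentence.IsUGC2Eq (s : Sentence σ) : Prop :=
  s.guard.IsTwoVar ∧ s.body.fv ⊆ s.guard.vars ∧ s.body.IsOpenGC2

end Logic

/-- An ontology: a finite set of sentences. -/
abbrev Ontology (σ : Type*) [Vocab σ] := Finset (Sentence σ)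

/-! ### Conjunctive queries, rooted acyclic queries, certain answers -/

/-- A conjunctive query; its body, as a set of atoms over the variables, is also its canonical
database. -/
structure CQ (σ : Type*) [Vocab σ] where
  arity : ℕ
  ans : Fin arity → ℕ
  body : Finset (Atom σ ℕ)
  ans_mem : ∀ i, ans i ∈ dom (body : Set (Atom σ ℕ))

section Queries

variable {σ : Type*} [Vocab σ]

/-- `A ⊨ q(a)`: there is a homomorphism from the canonical database of `q` to `A` that maps the
answer variables to `a`. -/
def CQ.Answer {U : Type*} (q : CQ σ) (A : Set (Atom σ U)) (a : Fin q.arity → U) : Prop :=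
  ∃ h : ℕ → U, (∀ α ∈ q.body, α.map h ∈ A) ∧ ∀ i, h (q.ans i) = a i

/-- `bag` is (the family of domains of) a connected guarded tree decomposition of `A`, indexed by
the nodes of the graph `E`. The atoms of the bag at `t` are those of the subinterpretation of `A`
induced by `bag t`. -/
structure IsCGTreeDecomposition {U T : Type*} (A : Set (Atom σ U)) (E : SimpleGraph T)
    (bag : T → Set U) : Prop where
  isTree : E.IsTree
  cover : ∀ α ∈ A, ∃ t, α.elems ⊆ bag t
  guarded : ∀ t, IsGuarded A (bag t)
  connected : ∀ a ∈ dom A, (E.induce {t | a ∈ bag t}).Connected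
  overlap : ∀ t t', E.Adj t t' → (bag t ∩ bag t').Nonempty

/-- Rooted acyclic queries: the canonical database has a connected guarded tree decomposition
whose root bag consists of the answer variables. (It is finite, so finite trees suffice.) -/
def CQ.IsRAQ (q : CQ σ) : Prop :=
  ∃ (T : Type) (_ : Finite T) (E : SimpleGraph T) (bag : T → Set ℕ) (root : T),
    IsCGTreeDecomposition (q.body : Set (Atom σ ℕ)) E bag ∧ bag root = Set.range q.ans

/-- `O, D ⊨ q(a)`: `a` is an answer to `q` in every model of `D` and `O`. Here `C` is the set of
constants and `N` the set of labelled nulls; interpretations live on `C ⊕ N`, and every constant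
of `D` is interpreted as itself. The set `D` may be infinite. -/
def Certain {C : Type*} (N : Type*) (O : Ontology σ) (D : Set (Atom σ C)) (q : CQ σ)
    (a : Fin q.arity → C) : Prop :=
  ∀ B : Set (Atom σ (C ⊕ N)), IsInterp B → Atom.map Sum.inl '' D ⊆ B →
    (∀ s ∈ O, s.Holds B) → q.Answer B (fun i => Sum.inl (a i))

end Queries

/-! ### Unravellings -/

section Unravelling

variable {σ : Type*} [Vocab σ] {C : Type*}

/-- The sequences `G₀ G₁ ⋯ Gₙ` of maximal guarded sets of `D` that index an unravelling, stored in
reverse order (so the head of the list is `Gₙ`). Consecutive sets are distinct and intersect, and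
any three consecutive sets `G`, `G'`, `G''` satisfy `cond G G' G''`. -/
inductive IsSeq (cond : Set C → Set C → Set C → Prop) (D : Set (Atom σ C)) :
    List (Set C) → Prop
  | single (G : Set C) : IsMaxGuarded D G → IsSeq cond D [G]
  | cons (G' G : Set C) (t : List (Set C)) : IsSeq cond D (G :: t) → IsMaxGuarded D G' →
      G ≠ G' → (G ∩ G').Nonempty → (∀ F ∈ t.head?, cond F G G') → IsSeq cond D (G' :: G :: t)

/-- The condition of the uGF-unravelling: `G_{i-1} ≠ G_{i+1}`. -/
def condUGF (F _G G' : Set C) : Prop := F ≠ G'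

/-- The condition of the uGC₂-unravelling: `G_i ∩ G_{i-1} ≠ G_i ∩ G_{i+1}`. -/
def condUGC2 (F G G' : Set C) : Prop := G ∩ F ≠ G ∩ G'

/-- The copies of constants. The copy of `d` that is created at the sequence `t` is `(t, d)`. -/
abbrev Copy (C : Type*) := List (Set C) × C

open Classical in
/-- The copy of `d` in `bag(t)`, for `d ∈ tail(t)`: the copy of the preceding bag if `d` belongs to
the preceding guarded set, and a fresh copy otherwise. -/
noncomputable def copyAt : List (Set C) → C → Copy C
  | G' :: G :: t, d => if d ∈ G then copyAt (G :: t) d else (G' :: G :: t, d)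
  | t, d => (t, d)

/-- `bag(t)`: the copy of the subinstance of `D` induced by `tail(t)`. -/
def bagAtoms (D : Set (Atom σ C)) (t : List (Set C)) : Set (Atom σ (Copy C)) :=
  {β | ∃ G ∈ t.head?, ∃ α ∈ D, α.elems ⊆ G ∧ β = α.map (copyAt t)}

/-- The unravelling of `D`: the union of all bags. -/
def unravelling (cond : Set C → Set C → Set C → Prop) (D : Set (Atom σ C)) :
    Set (Atom σ (Copy C)) :=
  {β | ∃ t, IsSeq cond D t ∧ β ∈ bagAtoms D t}

/-- Unravelling tolerance with respect to the unravelling given by `cond`, where instances and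
queries use the relation symbols in `V`. -/
def Tolerant (C N : Type*) (cond : Set C → Set C → Set C → Prop) (V : Set σ) (O : Ontology σ) :
    Prop :=
  ∀ D : Set (Atom σ C), IsInstance D → sig D ⊆ V →
    ∀ q : CQ σ, q.IsRAQ → sig (q.body : Set (Atom σ ℕ)) ⊆ V →
      ∀ a : Fin q.arity → C, IsMaxGuarded D (Set.range a) →
        (Certain N O D q a ↔
          Certain N O (unravelling cond D) q (fun i => copyAt [Set.range a] (a i)))

/-- The relation symbols of arity at most two. -/
def binarySymbols (σ : Type*) [Vocab σ] : Set σ := {r | Vocab.arity r ≤ 2}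

/-- Unravelling tolerance of uGF(=) ontologies. -/
def UGFTolerant (C N : Type*) (O : Ontology σ) : Prop :=
  Tolerant C N condUGF Set.univ O

/-- Unravelling tolerance of uGC₂(=) ontologies; here one works over relation symbols of arity at
most two. -/
def UGC2Tolerant (C N : Type*) (O : Ontology σ) : Prop :=
  Tolerant C N condUGC2 (binarySymbols σ) O

end Unravelling

/-! ### Datalog -/

/-- Intensional relation symbols, infinitely many of every positive arity. They are disjoint from
the symbols of instances. -/
structure IDB where
  name : ℕ
  pred_arity : ℕ

instance : Vocab IDB where
  arity p := p.pred_arity + 1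
  arity_pos _ := Nat.succ_le_succ (Nat.zero_le _)

/-- The vocabulary of a program: extensional and intensional symbols. -/
instance {σ : Type*} [Vocab σ] : Vocab (σ ⊕ IDB) where
  arity r := match r with
    | .inl r => Vocab.arity r
    | .inr p => Vocab.arity p
  arity_pos r := by cases r <;> exact Vocab.arity_pos _

/-- Body literals: relational atoms and inequalities. -/
inductive Literal (σ : Type*) [Vocab σ] where
  | atom (α : Atom (σ ⊕ IDB) ℕ)
  | neq (x y : ℕ)

section Datalog

variable {σ : Type*} [Vocab σ]

/-- An atom over the extensional symbols. -/
def Atom.edb {U : Type*} (α : Atom σ U) : Atom (σ ⊕ IDB) U := ⟨Sum.inl α.rel, α.args⟩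

/-- An atom over the intensional symbols. -/
def Atom.idb {U : Type*} (α : Atom IDB U) : Atom (σ ⊕ IDB) U := ⟨Sum.inr α.rel, α.args⟩

def Literal.Sat {U : Type*} (A : Set (Atom (σ ⊕ IDB) U)) : Literal σ → (ℕ → U) → Prop
  | .atom α, v => α.map v ∈ A
  | .neq x y, v => v x ≠ v y

/-- Datalog≠ rules: the body is nonempty, and every variable of the head or of an inequality occurs
in a relational atom of the body. -/
structure Rule (σ : Type*) [Vocab σ] where
  head : Atom IDB ℕ
  body : List (Literal σ)
  body_ne : body ≠ []
  safe_head : ∀ x ∈ head.vars, ∃ α, Literal.atom α ∈ body ∧ x ∈ α.vars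
  safe_neq : ∀ x y, Literal.neq x y ∈ body →
    (∃ α, Literal.atom α ∈ body ∧ x ∈ α.vars) ∧ (∃ α, Literal.atom α ∈ body ∧ y ∈ α.vars)

/-- Datalog≠ programs: finite sets of rules with a goal symbol that does not occur in bodies. -/
structure Program (σ : Type*) [Vocab σ] where
  rules : Finset (Rule σ)
  goal : IDB
  goal_not_body : ∀ ρ ∈ rules, ∀ α, Literal.atom α ∈ ρ.body → α.rel ≠ Sum.inr goal

/-- Datalog programs: no inequalities. -/
def Program.NeqFree (P : Program σ) : Prop :=
  ∀ ρ ∈ P.rules, ∀ x y, Literal.neq x y ∉ ρ.body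

/-- `A` is a model of all rules of the program. -/
def Program.IsModel {U : Type*} (P : Program σ) (A : Set (Atom (σ ⊕ IDB) U)) : Prop :=
  ∀ ρ ∈ P.rules, ∀ v : ℕ → U, (∀ x, v x ∈ dom A) → (∀ l ∈ ρ.body, l.Sat A v) →
    (ρ.head.map v).idb ∈ A

/-- `D ⊨ P(a)`: `goal(a)` belongs to all models of `D` and `P`. -/
def Program.Derives {C : Type*} (N : Type*) (P : Program σ) (D : Set (Atom σ C))
    (a : Fin (Vocab.arity P.goal) → C) : Prop :=
  ∀ A : Set (Atom (σ ⊕ IDB) (C ⊕ N)), IsInterp A → (fun α => (Atom.map Sum.inl α).edb) '' D ⊆ A →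
    P.IsModel A → (Atom.mk P.goal fun i => Sum.inl (a i) : Atom IDB (C ⊕ N)).idb ∈ A

/-- On all instances over the relation symbols in `S`, the program `P` computes the certain
answers to `q` given `O`. -/
def Program.Rewrites (C N : Type*) (P : Program σ) (S : Set σ) (O : Ontology σ) (q : CQ σ) : Prop :=
  ∃ h : Vocab.arity P.goal = q.arity,
    ∀ D : Set (Atom σ C), IsInstance D → sig D ⊆ S →
      ∀ a : Fin q.arity → C, (∀ i, a i ∈ dom D) →
        (Certain N O D q a ↔ P.Derives N D (fun i => a (Fin.cast h i)))

/-- rAQ-evaluation w.r.t. `O` is Datalog≠-rewritable: for every rAQ `q` and every finite signature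
`S` (over the ambient symbols `V`) some Datalog≠ program computes the certain answers to `q` on all
instances over `S`. -/
def RAQDatalogNeqRewritable (C N : Type*) (V : Set σ) (O : Ontology σ) : Prop :=
  ∀ q : CQ σ, q.IsRAQ → sig (q.body : Set (Atom σ ℕ)) ⊆ V →
    ∀ S : Set σ, S.Finite → S ⊆ V → ∃ P : Program σ, P.Rewrites C N S O q

/-- rAQ-evaluation w.r.t. `O` is Datalog-rewritable. -/
def RAQDatalogRewritable (C N : Type*) (V : Set σ) (O : Ontology σ) : Prop :=
  ∀ q : CQ σ, q.IsRAQ → sig (q.body : Set (Atom σ ℕ)) ⊆ V →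
    ∀ S : Set σ, S.Finite → S ⊆ V → ∃ P : Program σ, P.NeqFree ∧ P.Rewrites C N S O q

end Datalog

end OMQ

open OMQ

/-!
The rewriting consists of all sound rules of bounded size. Fix a finite set `Φ` of formulas containing
the ontology and a guarded formula equivalent to the query, and a bound `K`. The intensional
predicates stand for sets of `Φ`-types of tuples ("the type of this tuple belongs to `Θ`"), and the
program `Frame.program` consists of all rules with at most `K` variables that are sound, in the sense
that they hold in every model of the ontology under this reading. Soundness of the program is then
immediate (`Frame.certain_of_derives`).

For completeness, let `A` be a model of an instance `D` and the program that does not contain the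
goal fact at `a`. As every sound rule is available, anything about a small set of constants that
follows from what `A` contains belongs to `A`. Contrapositively (`Frame.IsClosed.exists_realizes`), a
type that is not excluded by `A` on a guarded set `G` is realized in some model of the ontology that
at the same time realizes a given small superset of `G`, compatibly with `A`; and some realization of
the guarded set around `a` refutes the query. These realizations are assembled to a model of the
ontology that contains the unravelling of `D` and in which the root bag looks like a realization
refuting the query. So `a` is not a certain answer over the unravelling, and unravelling tolerance
gives that it is not one over `D` (`Frame.rewrites`). Tolerance speaks of maximal guarded tuples only;
the other tuples are dealt with by enlarging the root bag of the query
(`CQ.IsRAQ.exists_extension`), and, for tuples that are not guarded at all, by models in which they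
are not guarded either (`Frame.HasUnguardedModels`), so that they are certain answers only over
inconsistent instances.

For uGF(=), a realization is chosen for every bag, so that neighbouring bags agree on their common
elements; since every copy is created in one bag and handed on from there, any two bags agree on
shared tuples, and the disjoint models can be glued along the bags (`sat_glue_iff`,
`Frame.hasModels_of_isOpenGF`). Without equality, injectivity of the realizations is irrelevant, and
no inequalities are needed in rules.

For uGC₂(=), counting requires that all neighbours of an element are represented in one model. A
star, consisting of a constant and all its neighbours in `D`, may be arbitrarily large, but by
Dickson's lemma a star that cannot be realized contains one of bounded size that cannot be realized
(`exists_bound_of_subset_pi`, `Frame.IsClosed.exists_isStar`). In the uGC₂-unravelling each copy of a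
constant has precisely one copy of each of its neighbours as a neighbour, so one realization of the
star can be chosen per copy, with adjacent stars agreeing on the edge between them
(`Frame.exists_stars`). The models in which these stars live are cut at the distinguished edges and
reconnected, using infinitely many further copies of each to take up the loose ends (`sheetMap`), and
truth of formulas is preserved as it depends on the stars of the elements only
(`IsLocalCover.sat_iff`).
-/

namespace OMQ

/-! ### Atoms, guarded formulas and their subformulas -/

section Basics

variable {σ : Type*} [Vocab σ] {U W X : Type*}

theorem Atom.map_map (f : U → W) (g : W → X) (α : Atom σ U) :
    (α.map f).map g = α.map (g ∘ f) := rfl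

theorem Atom.args_mem (α : Atom σ U) (i) : α.args i ∈ α.elems := ⟨i, rfl⟩

theorem Atom.elems_map (f : U → W) (α : Atom σ U) : (α.map f).elems = f '' α.elems :=
  Set.range_comp f α.args

theorem Atom.elems_nonempty (α : Atom σ U) : α.elems.Nonempty :=
  ⟨_, α.args_mem ⟨0, Vocab.arity_pos α.rel⟩⟩

theorem Atom.elems_finite (α : Atom σ U) : α.elems.Finite := Set.finite_range _

theorem Atom.mem_vars {α : Atom σ ℕ} {x : ℕ} : x ∈ α.vars ↔ x ∈ α.elems := by
  simp [Atom.vars, Atom.elems]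

theorem Atom.vars_nonempty (α : Atom σ ℕ) : α.vars.Nonempty := by
  obtain ⟨x, hx⟩ := α.elems_nonempty
  exact ⟨x, Atom.mem_vars.2 hx⟩

theorem Atom.map_congr {f g : U → W} {α : Atom σ U} (h : ∀ a ∈ α.elems, f a = g a) :
    α.map f = α.map g := by
  unfold Atom.map
  congr 1
  funext i
  exact h _ (α.args_mem i)

theorem Atom.map_injOn {f : U → W} {S : Set U} (hf : Set.InjOn f S) {α β : Atom σ U}
    (hα : α.elems ⊆ S) (hβ : β.elems ⊆ S) (h : α.map f = β.map f) : α = β := by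
  obtain ⟨r, a⟩ := α
  obtain ⟨s, b⟩ := β
  simp only [Atom.map, Atom.mk.injEq] at h
  obtain ⟨rfl, h⟩ := h
  congr
  funext i
  exact hf (hα ⟨i, rfl⟩) (hβ ⟨i, rfl⟩) (congrFun (eq_of_heq h) i)

theorem mem_dom_of_map_mem {A : Set (Atom σ U)} {α : Atom σ ℕ} {u : ℕ → U} (h : α.map u ∈ A)
    {x : ℕ} (hx : x ∈ α.vars) : u x ∈ dom A :=
  ⟨_, h, by rw [Atom.elems_map]; exact ⟨x, Atom.mem_vars.1 hx, rfl⟩⟩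

theorem dom_mono {A B : Set (Atom σ U)} (h : A ⊆ B) : dom A ⊆ dom B :=
  fun _ ⟨α, hα, ha⟩ => ⟨α, h hα, ha⟩

theorem dom_map_image (j : U → W) (A : Set (Atom σ U)) :
    dom (Atom.map j '' A) = j '' dom A := by
  ext a
  constructor
  · rintro ⟨_, ⟨α, hα, rfl⟩, ha⟩
    rw [Atom.elems_map] at ha
    obtain ⟨b, hb, rfl⟩ := ha
    exact ⟨b, ⟨α, hα, hb⟩, rfl⟩
  · rintro ⟨b, ⟨α, hα, hb⟩, rfl⟩
    exact ⟨_, ⟨α, hα, rfl⟩, by rw [Atom.elems_map]; exact ⟨b, hb, rfl⟩⟩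

/-- Truth of a formula depends only on the values of its free variables. -/
theorem Formula.Sat.congr_fv {A : Set (Atom σ U)} {φ : Formula σ} {v w : ℕ → U}
    (h : ∀ x ∈ φ.fv, v x = w x) : φ.Sat A v ↔ φ.Sat A w := by
  have quant : ∀ (ys : Finset ℕ) (α : Atom σ ℕ) (φ : Formula σ),
      (∀ {v w : ℕ → U}, (∀ x ∈ φ.fv, v x = w x) → (φ.Sat A v ↔ φ.Sat A w)) →
      ∀ v w : ℕ → U, (∀ x ∈ (α.vars ∪ φ.fv) \ ys, v x = w x) →
      ∀ u : ℕ → U, (∀ x, x ∉ ys → u x = v x) → ∃ u' : ℕ → U, (∀ x, x ∉ ys → u' x = w x) ∧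
        (∀ x ∈ ys, u' x = u x) ∧ α.map u = α.map u' ∧ (φ.Sat A u ↔ φ.Sat A u') := by
    intro ys α φ ih v w h u hu
    classical
    have key : ∀ x ∈ α.vars ∪ φ.fv, u x = if x ∈ ys then u x else w x := by
      intro x hx
      split_ifs with hy
      · rfl
      · rw [hu x hy]; exact h x (by simp only [Finset.mem_sdiff]; exact ⟨hx, hy⟩)
    refine ⟨fun x => if x ∈ ys then u x else w x, fun x hx => by simp [hx],
      fun x hx => by simp [hx], ?_, ?_⟩
    · exact Atom.map_congr fun x hx => key x (by simp [Atom.mem_vars, hx])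
    · exact ih fun x hx => key x (by simp [hx])
  induction φ generalizing v w with
  | atom α =>
    simp only [Formula.Sat]
    rw [Atom.map_congr fun x hx => h x (Atom.mem_vars.2 hx)]
  | eq x y => simp only [Formula.Sat]; rw [h x (by simp [fv]), h y (by simp [fv])]
  | neg φ ih => exact not_congr (ih h)
  | and φ ψ ih ih' =>
    exact and_congr (ih fun x hx => h x (by simp [fv, hx])) (ih' fun x hx => h x (by simp [fv, hx]))
  | or φ ψ ih ih' =>
    exact or_congr (ih fun x hx => h x (by simp [fv, hx])) (ih' fun x hx => h x (by simp [fv, hx]))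
  | all ys α φ ih =>
    have imp : ∀ v w : ℕ → U, (∀ x ∈ (α.vars ∪ φ.fv) \ ys, v x = w x) →
        (Formula.all ys α φ).Sat A v → (Formula.all ys α φ).Sat A w := by
      intro v w h hs u hu hd hα
      obtain ⟨u', h1, h2, h3, h4⟩ := quant ys α φ ih w v (fun x hx => (h x hx).symm) u hu
      exact h4.2 (hs u' h1 (fun x hx => h2 x hx ▸ hd x hx) (h3 ▸ hα))
    exact ⟨imp v w h, imp w v fun x hx => (h x hx).symm⟩
  | ex ys α φ ih =>
    have imp : ∀ v w : ℕ → U, (∀ x ∈ (α.vars ∪ φ.fv) \ ys, v x = w x) →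
        (Formula.ex ys α φ).Sat A v → (Formula.ex ys α φ).Sat A w := by
      rintro v w h ⟨u, hu, hd, hα, hs⟩
      obtain ⟨u', h1, h2, h3, h4⟩ := quant ys α φ ih v w h u hu
      exact ⟨u', h1, fun x hx => (h2 x hx).symm ▸ hd x hx, h3 ▸ hα, h4.1 hs⟩
    exact ⟨imp v w h, imp w v fun x hx => (h x hx).symm⟩
  | exGe n z α φ ih =>
    simp only [Formula.Sat]
    have : ∀ d, ∀ x ∈ α.vars ∪ φ.fv, Function.update v z d x = Function.update w z d x := by
      intro d x hx
      by_cases hz : x = z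
      · subst hz; simp
      · simp only [Function.update_of_ne hz]
        exact h x (by simp only [fv, Finset.mem_sdiff, Finset.mem_singleton]; exact ⟨hx, hz⟩)
    have e : {d | d ∈ dom A ∧ α.map (Function.update v z d) ∈ A ∧ φ.Sat A (Function.update v z d)}
        = {d | d ∈ dom A ∧ α.map (Function.update w z d) ∈ A ∧
          φ.Sat A (Function.update w z d)} := by
      ext d
      refine and_congr_right fun _ => and_congr ?_ (ih fun x hx => this d x (by simp [hx]))
      rw [Atom.map_congr fun x hx => this d x (by simp [Atom.mem_vars, hx])]
    rw [e]

theorem Formula.sat_all_iff {A : Set (Atom σ U)} {ys : Finset ℕ} {α : Atom σ ℕ} {φ : Formula σ}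
    {v : ℕ → U} : (Formula.all ys α φ).Sat A v ↔ ¬ (Formula.ex ys α (.neg φ)).Sat A v := by
  simp only [Formula.Sat]
  push Not
  rfl

/-- Formulas all of whose quantifiers, counting or not, are guarded by a relational atom with a
free variable. Both openGF and openGC₂ are fragments of this class. -/
def Formula.Guarded : Formula σ → Prop
  | .atom _ => True
  | .eq _ _ => True
  | .neg φ => φ.Guarded
  | .and φ ψ => φ.Guarded ∧ ψ.Guarded
  | .or φ ψ => φ.Guarded ∧ ψ.Guarded
  | .all ys α φ => ys ⊆ α.vars ∧ φ.fv ⊆ α.vars ∧ (α.vars \ ys).Nonempty ∧ φ.Guarded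
  | .ex ys α φ => ys ⊆ α.vars ∧ φ.fv ⊆ α.vars ∧ (α.vars \ ys).Nonempty ∧ φ.Guarded
  | .exGe _ z α φ => z ∈ α.vars ∧ φ.fv ⊆ α.vars ∧ (α.vars \ {z}).Nonempty ∧ φ.Guarded

/-- The relation symbols that occur in a formula. -/
def Formula.rels : Formula σ → Set σ
  | .atom α => {α.rel}
  | .eq _ _ => ∅
  | .neg φ => φ.rels
  | .and φ ψ => φ.rels ∪ ψ.rels
  | .or φ ψ => φ.rels ∪ ψ.rels
  | .all _ α φ => {α.rel} ∪ φ.rels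
  | .ex _ α φ => {α.rel} ∪ φ.rels
  | .exGe _ _ α φ => {α.rel} ∪ φ.rels

/-- The subformulas of a formula; the guards of quantifiers count as subformulas. -/
def Formula.sub : Formula σ → Set (Formula σ)
  | .atom α => {.atom α}
  | .eq x y => {.eq x y}
  | .neg φ => insert (.neg φ) φ.sub
  | .and φ ψ => insert (.and φ ψ) (φ.sub ∪ ψ.sub)
  | .or φ ψ => insert (.or φ ψ) (φ.sub ∪ ψ.sub)
  | .all ys α φ => insert (.all ys α φ) (insert (.atom α) φ.sub)
  | .ex ys α φ => insert (.ex ys α φ) (insert (.atom α) φ.sub)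
  | .exGe n z α φ => insert (.exGe n z α φ) (insert (.atom α) φ.sub)

theorem Formula.rels_finite (φ : Formula σ) : φ.rels.Finite := by
  induction φ with
  | atom α => exact Set.finite_singleton _
  | eq x y => exact Set.finite_empty
  | neg φ ih => exact ih
  | and φ ψ ih ih' => exact ih.union ih'
  | or φ ψ ih ih' => exact ih.union ih'
  | all ys α φ ih => exact (Set.finite_singleton _).union ih
  | ex ys α φ ih => exact (Set.finite_singleton _).union ih
  | exGe n z α φ ih => exact (Set.finite_singleton _).union ih

theorem Formula.sub_finite (φ : Formula σ) : φ.sub.Finite := by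
  induction φ with
  | atom α => exact Set.finite_singleton _
  | eq x y => exact Set.finite_singleton _
  | neg φ ih => exact ih.insert _
  | and φ ψ ih ih' => exact (ih.union ih').insert _
  | or φ ψ ih ih' => exact (ih.union ih').insert _
  | all ys α φ ih => exact (ih.insert _).insert _
  | ex ys α φ ih => exact (ih.insert _).insert _
  | exGe n z α φ ih => exact (ih.insert _).insert _

theorem Formula.mem_sub_self (φ : Formula σ) : φ ∈ φ.sub := by
  cases φ <;> simp [Formula.sub]

/-- A property of formulas that passes to immediate subformulas and holds of atoms passes to all
subformulas. -/
theorem Formula.sub_induction {p : Formula σ → Prop} (hatom : ∀ α, p (.atom α))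
    (hneg : ∀ φ, p (.neg φ) → p φ) (hand : ∀ φ ψ, p (.and φ ψ) → p φ ∧ p ψ)
    (hor : ∀ φ ψ, p (.or φ ψ) → p φ ∧ p ψ) (hall : ∀ ys α φ, p (.all ys α φ) → p φ)
    (hex : ∀ ys α φ, p (.ex ys α φ) → p φ) (hexGe : ∀ n z α φ, p (.exGe n z α φ) → p φ)
    {φ : Formula σ} (h : p φ) : ∀ ψ ∈ φ.sub, p ψ := by
  induction φ with
  | atom α => simpa [Formula.sub] using h
  | eq x y => simpa [Formula.sub] using h
  | neg φ ih =>
    rintro ψ (rfl | hψ)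
    exacts [h, ih (hneg _ h) ψ hψ]
  | and φ ψ ih ih' =>
    rintro χ (rfl | hχ | hχ)
    exacts [h, ih (hand _ _ h).1 χ hχ, ih' (hand _ _ h).2 χ hχ]
  | or φ ψ ih ih' =>
    rintro χ (rfl | hχ | hχ)
    exacts [h, ih (hor _ _ h).1 χ hχ, ih' (hor _ _ h).2 χ hχ]
  | all ys α φ ih =>
    rintro χ (rfl | rfl | hχ)
    exacts [h, hatom _, ih (hall _ _ _ h) χ hχ]
  | ex ys α φ ih =>
    rintro χ (rfl | rfl | hχ)
    exacts [h, hatom _, ih (hex _ _ _ h) χ hχ]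
  | exGe n z α φ ih =>
    rintro χ (rfl | rfl | hχ)
    exacts [h, hatom _, ih (hexGe _ _ _ _ h) χ hχ]

theorem Formula.sub_trans {φ : Formula σ} : ∀ ψ ∈ φ.sub, ψ.sub ⊆ φ.sub := by
  induction φ with
  | atom α => rintro ψ rfl; exact subset_rfl
  | eq x y => rintro ψ rfl; exact subset_rfl
  | neg φ ih =>
    rintro ψ (rfl | hψ)
    exacts [subset_rfl, (ih ψ hψ).trans (Set.subset_insert _ _)]
  | and φ ψ ih ih' =>
    rintro χ (rfl | hχ | hχ)
    exacts [subset_rfl, ((ih χ hχ).trans Set.subset_union_left).trans (Set.subset_insert _ _),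
      ((ih' χ hχ).trans Set.subset_union_right).trans (Set.subset_insert _ _)]
  | or φ ψ ih ih' =>
    rintro χ (rfl | hχ | hχ)
    exacts [subset_rfl, ((ih χ hχ).trans Set.subset_union_left).trans (Set.subset_insert _ _),
      ((ih' χ hχ).trans Set.subset_union_right).trans (Set.subset_insert _ _)]
  | all ys α φ ih =>
    rintro χ (rfl | rfl | hχ)
    · exact subset_rfl
    · rintro _ rfl; simp [Formula.sub]
    · exact ((ih χ hχ).trans (Set.subset_insert _ _)).trans (Set.subset_insert _ _)
  | ex ys α φ ih =>
    rintro χ (rfl | rfl | hχ)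
    · exact subset_rfl
    · rintro _ rfl; simp [Formula.sub]
    · exact ((ih χ hχ).trans (Set.subset_insert _ _)).trans (Set.subset_insert _ _)
  | exGe n z α φ ih =>
    rintro χ (rfl | rfl | hχ)
    · exact subset_rfl
    · rintro _ rfl; simp [Formula.sub]
    · exact ((ih χ hχ).trans (Set.subset_insert _ _)).trans (Set.subset_insert _ _)

/-- Closure under subformulas, guards included. -/
def SubClosed (Φ : Set (Formula σ)) : Prop := ∀ φ ∈ Φ, φ.sub ⊆ Φ

theorem Formula.IsOpenGF.guarded {φ : Formula σ} (h : φ.IsOpenGF) : φ.Guarded := by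
  induction φ with
  | atom α => trivial
  | eq x y => trivial
  | neg φ ih => exact ih h
  | and φ ψ ih ih' => exact ⟨ih h.1, ih' h.2⟩
  | or φ ψ ih ih' => exact ⟨ih h.1, ih' h.2⟩
  | all ys α φ ih => exact ⟨h.1, h.2.1, h.2.2.1, ih h.2.2.2⟩
  | ex ys α φ ih => exact ⟨h.1, h.2.1, h.2.2.1, ih h.2.2.2⟩
  | exGe n z α φ ih => exact h.elim

theorem Formula.IsOpenGC2.fv_subset {φ : Formula σ} (h : φ.IsOpenGC2) : φ.fv ⊆ {0, 1} := by
  induction φ with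
  | atom α => exact h.2
  | eq x y => exact h
  | neg φ ih => exact ih h
  | and φ ψ ih ih' => exact Finset.union_subset (ih h.1) (ih' h.2)
  | or φ ψ ih ih' => exact Finset.union_subset (ih h.1) (ih' h.2)
  | all ys α φ ih =>
    exact Finset.sdiff_subset.trans (Finset.union_subset h.2.1 (ih h.2.2.2.2.2))
  | ex ys α φ ih =>
    exact Finset.sdiff_subset.trans (Finset.union_subset h.2.1 (ih h.2.2.2.2.2))
  | exGe n z α φ ih =>
    exact Finset.sdiff_subset.trans (Finset.union_subset h.2.1.subset (ih h.2.2.2))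

theorem Formula.IsOpenGC2.guarded {φ : Formula σ} (h : φ.IsOpenGC2) : φ.Guarded := by
  induction φ with
  | atom α => trivial
  | eq x y => trivial
  | neg φ ih => exact ih h
  | and φ ψ ih ih' => exact ⟨ih h.1, ih' h.2⟩
  | or φ ψ ih ih' => exact ⟨ih h.1, ih' h.2⟩
  | all ys α φ ih => exact ⟨h.2.2.1, h.2.2.2.1, h.2.2.2.2.1, ih h.2.2.2.2.2⟩
  | ex ys α φ ih => exact ⟨h.2.2.1, h.2.2.2.1, h.2.2.2.2.1, ih h.2.2.2.2.2⟩
  | exGe n z α φ ih =>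
    obtain ⟨h1, h2, h3, h4⟩ := h
    refine ⟨h2 ▸ h3, h2 ▸ h4.fv_subset, ?_, ih h4⟩
    rw [h2]
    rcases Finset.mem_insert.1 h3 with rfl | h3
    · exact ⟨1, by simp⟩
    · rw [Finset.mem_singleton] at h3
      subst h3
      exact ⟨0, by simp⟩

theorem Formula.IsOpenGC2.rels_subset {φ : Formula σ} (h : φ.IsOpenGC2) :
    φ.rels ⊆ binarySymbols σ := by
  induction φ with
  | atom α => rintro _ rfl; exact h.1
  | eq x y => exact Set.empty_subset _
  | neg φ ih => exact ih h
  | and φ ψ ih ih' => exact Set.union_subset (ih h.1) (ih' h.2)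
  | or φ ψ ih ih' => exact Set.union_subset (ih h.1) (ih' h.2)
  | all ys α φ ih =>
    refine Set.union_subset ?_ (ih h.2.2.2.2.2)
    rintro _ rfl; exact h.1
  | ex ys α φ ih =>
    refine Set.union_subset ?_ (ih h.2.2.2.2.2)
    rintro _ rfl; exact h.1
  | exGe n z α φ ih =>
    refine Set.union_subset ?_ (ih h.2.2.2)
    rintro _ rfl; exact h.1.le

theorem Formula.Guarded.fv_nonempty {φ : Formula σ} (h : φ.Guarded) : φ.fv.Nonempty := by
  induction φ with
  | atom α => exact α.vars_nonempty
  | eq x y => exact ⟨x, by simp [fv]⟩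
  | neg φ ih => exact ih h
  | and φ ψ ih ih' => exact (ih h.1).mono Finset.subset_union_left
  | or φ ψ ih ih' => exact (ih h.1).mono Finset.subset_union_left
  | all ys α φ ih =>
    exact h.2.2.1.mono (Finset.sdiff_subset_sdiff Finset.subset_union_left subset_rfl)
  | ex ys α φ ih =>
    exact h.2.2.1.mono (Finset.sdiff_subset_sdiff Finset.subset_union_left subset_rfl)
  | exGe n z α φ ih =>
    exact h.2.2.1.mono (Finset.sdiff_subset_sdiff Finset.subset_union_left subset_rfl)

theorem Formula.IsOpenGF.of_mem_sub {φ : Formula σ} (h : φ.IsOpenGF) : ∀ ψ ∈ φ.sub, ψ.IsOpenGF :=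
  Formula.sub_induction (p := Formula.IsOpenGF) (fun _ => trivial) (fun _ h => h) (fun _ _ h => h)
    (fun _ _ h => h) (fun _ _ _ h => h.2.2.2) (fun _ _ _ h => h.2.2.2) (fun _ _ _ _ h => h.elim) h

theorem Formula.EqFree.of_mem_sub {φ : Formula σ} (h : φ.EqFree) : ∀ ψ ∈ φ.sub, ψ.EqFree :=
  Formula.sub_induction (p := Formula.EqFree) (fun _ => trivial) (fun _ h => h) (fun _ _ h => h)
    (fun _ _ h => h) (fun _ _ _ h => h) (fun _ _ _ h => h) (fun _ _ _ _ h => h) h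

theorem Formula.Guarded.of_mem_sub {φ : Formula σ} (h : φ.Guarded) : ∀ ψ ∈ φ.sub, ψ.Guarded :=
  Formula.sub_induction (p := Formula.Guarded) (fun _ => trivial) (fun _ h => h) (fun _ _ h => h)
    (fun _ _ h => h) (fun _ _ _ h => h.2.2.2) (fun _ _ _ h => h.2.2.2)
    (fun _ _ _ _ h => h.2.2.2) h

theorem Formula.rels_of_mem_sub {φ : Formula σ} : ∀ ψ ∈ φ.sub, ψ.rels ⊆ φ.rels := by
  induction φ with
  | atom α => rintro ψ rfl; exact subset_rfl
  | eq x y => rintro ψ rfl; exact subset_rfl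
  | neg φ ih =>
    rintro ψ (rfl | hψ)
    exacts [subset_rfl, ih ψ hψ]
  | and φ ψ ih ih' =>
    rintro χ (rfl | hχ | hχ)
    exacts [subset_rfl, (ih χ hχ).trans Set.subset_union_left,
      (ih' χ hχ).trans Set.subset_union_right]
  | or φ ψ ih ih' =>
    rintro χ (rfl | hχ | hχ)
    exacts [subset_rfl, (ih χ hχ).trans Set.subset_union_left,
      (ih' χ hχ).trans Set.subset_union_right]
  | all ys α φ ih =>
    rintro χ (rfl | rfl | hχ)
    exacts [subset_rfl, Set.subset_union_left, (ih χ hχ).trans Set.subset_union_right]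
  | ex ys α φ ih =>
    rintro χ (rfl | rfl | hχ)
    exacts [subset_rfl, Set.subset_union_left, (ih χ hχ).trans Set.subset_union_right]
  | exGe n z α φ ih =>
    rintro χ (rfl | rfl | hχ)
    exacts [subset_rfl, Set.subset_union_left, (ih χ hχ).trans Set.subset_union_right]

/-! ### Reducts and isomorphic copies -/

/-- Guarded formulas do not distinguish an interpretation from its reduct to a signature that
contains their symbols, although the reduct may have a smaller domain. -/
theorem Formula.sat_reduct {A : Set (Atom σ U)} {S : Set σ} {φ : Formula σ} (hφ : φ.Guarded)
    (hr : φ.rels ⊆ S) (v : ℕ → U) : φ.Sat {α ∈ A | α.rel ∈ S} v ↔ φ.Sat A v := by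
  have hdom : dom {α ∈ A | α.rel ∈ S} ⊆ dom A := dom_mono (Set.sep_subset _ _)
  have hmem : ∀ (α : Atom σ ℕ), α.rel ∈ S → ∀ v : ℕ → U, α.map v ∈ A → ∀ x ∈ α.vars,
      v x ∈ dom {α ∈ A | α.rel ∈ S} := fun α hα v hv x hx =>
    ⟨α.map v, ⟨hv, hα⟩, by rw [Atom.elems_map]; exact ⟨x, Atom.mem_vars.1 hx, rfl⟩⟩
  induction φ generalizing v with
  | atom α => exact ⟨fun h => h.1, fun h => ⟨h, hr rfl⟩⟩
  | eq x y => exact Iff.rfl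
  | neg φ ih => exact not_congr (ih hφ hr v)
  | and φ ψ ih ih' =>
    exact and_congr (ih hφ.1 (Set.union_subset_iff.1 hr).1 v)
      (ih' hφ.2 (Set.union_subset_iff.1 hr).2 v)
  | or φ ψ ih ih' =>
    exact or_congr (ih hφ.1 (Set.union_subset_iff.1 hr).1 v)
      (ih' hφ.2 (Set.union_subset_iff.1 hr).2 v)
  | all ys α φ ih =>
    have hα : α.rel ∈ S := hr (Or.inl rfl)
    have hφ' := ih hφ.2.2.2 (Set.subset_union_right.trans hr)
    constructor
    · intro h w h1 h2 h3
      exact (hφ' w).1 (h w h1 (fun x hx => hmem α hα w h3 x (hφ.1 hx)) ⟨h3, hα⟩)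
    · intro h w h1 h2 h3
      exact (hφ' w).2 (h w h1 (fun x hx => hdom (h2 x hx)) h3.1)
  | ex ys α φ ih =>
    have hα : α.rel ∈ S := hr (Or.inl rfl)
    have hφ' := ih hφ.2.2.2 (Set.subset_union_right.trans hr)
    constructor
    · rintro ⟨w, h1, h2, h3, h4⟩
      exact ⟨w, h1, fun x hx => hdom (h2 x hx), h3.1, (hφ' w).1 h4⟩
    · rintro ⟨w, h1, h2, h3, h4⟩
      exact ⟨w, h1, fun x hx => hmem α hα w h3 x (hφ.1 hx), ⟨h3, hα⟩, (hφ' w).2 h4⟩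
  | exGe n z α φ ih =>
    have hα : α.rel ∈ S := hr (Or.inl rfl)
    have hφ' := ih hφ.2.2.2 (Set.subset_union_right.trans hr)
    simp only [Formula.Sat]
    have e : {d | d ∈ dom {α ∈ A | α.rel ∈ S} ∧
          α.map (Function.update v z d) ∈ {α ∈ A | α.rel ∈ S} ∧
          φ.Sat {α ∈ A | α.rel ∈ S} (Function.update v z d)}
        = {d | d ∈ dom A ∧ α.map (Function.update v z d) ∈ A ∧
          φ.Sat A (Function.update v z d)} := by
      ext d
      constructor
      · rintro ⟨h1, h2, h3⟩
        exact ⟨hdom h1, h2.1, (hφ' _).1 h3⟩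
      · rintro ⟨h1, h2, h3⟩
        refine ⟨?_, ⟨h2, hα⟩, (hφ' _).2 h3⟩
        simpa using hmem α hα _ h2 z hφ.1
    rw [e]

theorem mem_of_map_mem_image {A : Set (Atom σ U)} {j : U → W} (hj : Set.InjOn j (dom A))
    {α : Atom σ U} (hα : α.elems ⊆ dom A) (h : α.map j ∈ Atom.map j '' A) : α ∈ A := by
  obtain ⟨β, hβ, e⟩ := h
  rwa [← Atom.map_injOn hj (fun a ha => ⟨β, hβ, ha⟩) hα e]

/-- Truth in an isomorphic copy. -/
theorem Formula.sat_map_image {A : Set (Atom σ U)} {j : U → W} (hj : Set.InjOn j (dom A))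
    {φ : Formula σ} (hφ : φ.Guarded) {v : ℕ → U} (hv : ∀ x ∈ φ.fv, v x ∈ dom A) :
    φ.Sat (Atom.map j '' A) (j ∘ v) ↔ φ.Sat A v := by
  have atm : ∀ (α : Atom σ ℕ) (v : ℕ → U), (∀ x ∈ α.vars, v x ∈ dom A) →
      (α.map (j ∘ v) ∈ Atom.map j '' A ↔ α.map v ∈ A) := by
    intro α v hv
    constructor
    · intro h
      refine mem_of_map_mem_image hj ?_ h
      rw [Atom.elems_map]
      rintro _ ⟨x, hx, rfl⟩
      exact hv x (Atom.mem_vars.2 hx)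
    · exact fun h => ⟨_, h, rfl⟩
  have ex : ∀ (ys : Finset ℕ) (α : Atom σ ℕ) (φ : Formula σ), φ.fv ⊆ α.vars →
      (∀ {v : ℕ → U}, (∀ x ∈ φ.fv, v x ∈ dom A) →
        (φ.Sat (Atom.map j '' A) (j ∘ v) ↔ φ.Sat A v)) →
      ∀ {v : ℕ → U}, (∀ x ∈ (α.vars ∪ φ.fv) \ ys, v x ∈ dom A) →
      ((Formula.ex ys α φ).Sat (Atom.map j '' A) (j ∘ v) ↔ (Formula.ex ys α φ).Sat A v) := by
    intro ys α φ hφ ih v hv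
    constructor
    · rintro ⟨w, h1, h2, h3, h4⟩
      rw [dom_map_image] at h2
      have : Nonempty U := ⟨v 0⟩
      choose! f hf using h2
      classical
      set u : ℕ → U := fun x => if x ∈ ys then f x else v x with hu
      have hw : w = j ∘ u := by
        funext x
        by_cases hx : x ∈ ys
        · simp [hu, hx, (hf x hx).2]
        · simp [hu, hx, h1 x hx]
      have hud : ∀ x ∈ α.vars, u x ∈ dom A := by
        intro x hx
        by_cases hy : x ∈ ys
        · simpa [hu, hy] using (hf x hy).1
        · simpa [hu, hy] using hv x (by simp [hx, hy])
      subst hw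
      exact ⟨u, fun x hx => by simp [hu, hx], fun x hx => by simpa [hu, hx] using (hf x hx).1,
        (atm α u hud).1 h3, (ih fun x hx => hud x (hφ hx)).1 h4⟩
    · rintro ⟨u, h1, h2, h3, h4⟩
      have hud : ∀ x ∈ α.vars, u x ∈ dom A := fun x hx =>
        ⟨_, h3, by rw [Atom.elems_map]; exact ⟨x, Atom.mem_vars.1 hx, rfl⟩⟩
      exact ⟨j ∘ u, fun x hx => by simp [h1 x hx],
        fun x hx => by rw [dom_map_image]; exact ⟨_, h2 x hx, rfl⟩,
        (atm α u hud).2 h3, (ih fun x hx => hud x (hφ hx)).2 h4⟩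
  induction φ generalizing v with
  | atom α => exact atm α v hv
  | eq x y => exact hj.eq_iff (hv x (by simp [fv])) (hv y (by simp [fv]))
  | neg φ ih => exact not_congr (ih hφ hv)
  | and φ ψ ih ih' =>
    exact and_congr (ih hφ.1 fun x hx => hv x (by simp [fv, hx]))
      (ih' hφ.2 fun x hx => hv x (by simp [fv, hx]))
  | or φ ψ ih ih' =>
    exact or_congr (ih hφ.1 fun x hx => hv x (by simp [fv, hx]))
      (ih' hφ.2 fun x hx => hv x (by simp [fv, hx]))
  | all ys α φ ih =>
    rw [Formula.sat_all_iff, Formula.sat_all_iff]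
    exact not_congr (ex ys α (.neg φ) hφ.2.1 (fun h => not_congr (ih hφ.2.2.2 h)) hv)
  | ex ys α φ ih => exact ex ys α φ hφ.2.1 (fun h => ih hφ.2.2.2 h) hv
  | exGe n z α φ ih =>
    simp only [Formula.Sat]
    have upd : ∀ d, Function.update (j ∘ v) z (j d) = j ∘ Function.update v z d := by
      intro d
      funext x
      by_cases hx : x = z
      · subst hx; simp
      · simp [hx]
    have hud : ∀ d ∈ dom A, ∀ x ∈ α.vars, Function.update v z d x ∈ dom A := by
      intro d hd x hx
      by_cases hz : x = z
      · subst hz; simpa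
      · rw [Function.update_of_ne hz]
        exact hv x (by simp [fv, hx, hz])
    have e : {d | d ∈ dom (Atom.map j '' A) ∧
          α.map (Function.update (j ∘ v) z d) ∈ Atom.map j '' A ∧
          φ.Sat (Atom.map j '' A) (Function.update (j ∘ v) z d)}
        = j '' {d | d ∈ dom A ∧ α.map (Function.update v z d) ∈ A ∧
          φ.Sat A (Function.update v z d)} := by
      ext d
      rw [dom_map_image]
      constructor
      · rintro ⟨⟨d, hd, rfl⟩, h2, h3⟩
        rw [upd] at h2 h3
        exact ⟨d, ⟨hd, (atm _ _ (hud d hd)).1 h2,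
          (ih hφ.2.2.2 fun x hx => hud d hd x (hφ.2.1 hx)).1 h3⟩, rfl⟩
      · rintro ⟨d, ⟨hd, h2, h3⟩, rfl⟩
        refine ⟨⟨d, hd, rfl⟩, ?_⟩
        rw [upd]
        exact ⟨(atm _ _ (hud d hd)).2 h2,
          (ih hφ.2.2.2 fun x hx => hud d hd x (hφ.2.1 hx)).2 h3⟩
    rw [e, Set.InjOn.encard_image (hj.mono fun d hd => hd.1)]

end Basics

/-! ### Rooted acyclic queries as openGF formulas -/

universe w

section TreeFormula

variable {σ : Type*} [Vocab σ]

theorem exists_ne_existsUnique_adj {T : Type*} [Finite T] [Nontrivial T] {E : SimpleGraph T}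
    (hE : E.IsTree) (r : T) :
    ∃ l, l ≠ r ∧ (∃! p, E.Adj l p) ∧ (E.induce {l}ᶜ).IsTree := by
  classical
  have := Fintype.ofFinite T
  obtain ⟨u, v, huv, hu, hv⟩ := hE.exists_ne_and_degree_eq_one
  obtain ⟨l, hl, hd⟩ : ∃ l, l ≠ r ∧ E.degree l = 1 := by
    by_cases h : u = r
    · exact ⟨v, fun h' => huv (h.trans h'.symm), hv⟩
    · exact ⟨u, h, hu⟩
  exact ⟨l, hl, SimpleGraph.degree_eq_one_iff_existsUnique_adj.1 hd,
    ⟨hE.connected.induce_compl_singleton_of_degree_eq_one hd, hE.isAcyclic.induce _⟩⟩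

/-- A tree of formulas whose variables satisfy the running intersection property, each node being
guarded, is equivalent, with all variables outside the root bag quantified existentially, to one
openGF formula. The leaves are absorbed one by one into their neighbours. Running intersection is
stated as reachability along edges on which the variable persists. -/
theorem exists_formula_of_tree {R : Set σ} (n : ℕ) :
    ∀ (T : Type) [Finite T], Nat.card T = n → ∀ (E : SimpleGraph T) (bag : T → Finset ℕ)
      (χ : T → Formula σ) (root : T), E.IsTree →
      (∀ x s t, x ∈ bag s → x ∈ bag t →
        Relation.ReflTransGen (fun s t => E.Adj s t ∧ x ∈ bag s ∧ x ∈ bag t) s t) →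
      (∀ s t, E.Adj s t → (bag s ∩ bag t).Nonempty) →
      (∀ t, (χ t).IsOpenGF ∧ (χ t).EqFree ∧ (χ t).fv ⊆ bag t ∧ (χ t).rels ⊆ R) →
      (∀ t, (∃ x, bag t = {x}) ∨ ∃ α : Atom σ ℕ, α.vars = bag t ∧ α.rel ∈ R ∧
        ∀ {U : Type w} (A : Set (Atom σ U)) v, (χ t).Sat A v → α.map v ∈ A) →
      ∃ ψ : Formula σ, (ψ.IsOpenGF ∧ ψ.EqFree ∧ ψ.fv ⊆ bag root ∧ ψ.rels ⊆ R) ∧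
        ∀ {U : Type w} (A : Set (Atom σ U)) v, ψ.Sat A v ↔
          ∃ h : ℕ → U, (∀ x ∈ bag root, h x = v x) ∧ ∀ t, (χ t).Sat A h := by
  induction n with
  | zero =>
    intro T _ hn E bag χ root
    exact absurd hn (Nat.card_pos_iff.2 ⟨⟨root⟩, inferInstance⟩).ne'
  | succ n ih =>
    intro T _ hn E bag χ root hE hrun hover hχ hguard
    rcases subsingleton_or_nontrivial T with hT | hT
    · refine ⟨χ root, hχ root, fun {U} A v => ⟨fun h => ⟨v, fun _ _ => rfl, fun t => ?_⟩, ?_⟩⟩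
      · rwa [Subsingleton.elim t root]
      · rintro ⟨h, h1, h2⟩
        exact (Formula.Sat.congr_fv fun x hx => h1 x ((hχ root).2.2.1 hx)).1 (h2 root)
    · obtain ⟨l, hl, ⟨p, hlp, hp⟩, hE'⟩ := exists_ne_existsUnique_adj hE root
      have hpl : p ≠ l := hlp.ne'
      -- the leaf shares variables with the other bags only through its neighbour
      have hshare : ∀ x t, t ≠ l → x ∈ bag l → x ∈ bag t → x ∈ bag p := by
        intro x t htl hxl hxt
        rcases (hrun x l t hxl hxt).cases_head with h | ⟨s, ⟨hs, -, hxs⟩, -⟩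
        · exact absurd h.symm htl
        · rwa [← hp s hs]
      obtain ⟨x₀, hx₀⟩ := hover l p hlp
      rw [Finset.mem_inter] at hx₀
      obtain ⟨ξ, hξ, hξs, hξw⟩ : ∃ ξ : Formula σ,
          (ξ.IsOpenGF ∧ ξ.EqFree ∧ ξ.fv ⊆ bag p ∧ ξ.rels ⊆ R) ∧
          (∀ {U : Type w} (A : Set (Atom σ U)) h, (χ l).Sat A h → ξ.Sat A h) ∧
          (∀ {U : Type w} (A : Set (Atom σ U)) h, ξ.Sat A h →
            ∃ h', (∀ x, x ∉ bag l \ bag p → h' x = h x) ∧ (χ l).Sat A h') := by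
        by_cases hys : bag l ⊆ bag p
        · exact ⟨χ l, ⟨(hχ l).1, (hχ l).2.1, (hχ l).2.2.1.trans hys, (hχ l).2.2.2⟩,
            fun {U} A h hs => hs, fun {U} A h hs => ⟨h, fun _ _ => rfl, hs⟩⟩
        · rcases hguard l with ⟨x, hx⟩ | ⟨α, hα, hαR, hαs⟩
          · exfalso
            apply hys
            rw [hx] at hx₀ ⊢
            rw [Finset.mem_singleton.1 hx₀.1] at hx₀
            simpa using hx₀.2
          · refine ⟨.ex (bag l \ bag p) α (χ l), ⟨⟨?_, ?_, ?_, (hχ l).1⟩, (hχ l).2.1, ?_, ?_⟩,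
              ?_, ?_⟩
            · rw [hα]; exact Finset.sdiff_subset
            · rw [hα]; exact (hχ l).2.2.1
            · exact ⟨x₀, by simp [hα, hx₀.1, hx₀.2]⟩
            · intro x hx
              simp only [Formula.fv, hα, Finset.mem_sdiff, Finset.mem_union] at hx
              have : x ∈ bag l := hx.1.elim id fun h => (hχ l).2.2.1 h
              tauto
            · exact Set.union_subset (by simpa using hαR) (hχ l).2.2.2
            · intro U A h hs
              refine ⟨h, fun _ _ => rfl, fun x hx => ⟨_, hαs A h hs, ?_⟩, hαs A h hs, hs⟩
              rw [Atom.elems_map]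
              exact ⟨x, Atom.mem_vars.1 (by rw [hα]; exact Finset.sdiff_subset hx), rfl⟩
            · rintro U A h ⟨w, h1, -, -, h4⟩
              exact ⟨w, h1, h4⟩
      classical
      let χ' : ({l}ᶜ : Set T) → Formula σ := fun t => if t.1 = p then .and (χ t.1) ξ else χ t.1
      have hχ'p : ∀ t : ({l}ᶜ : Set T), t.1 = p → χ' t = .and (χ t.1) ξ := fun t ht => by
        simp [χ', ht]
      have hχ'n : ∀ t : ({l}ᶜ : Set T), t.1 ≠ p → χ' t = χ t.1 := fun t ht => by
        simp [χ', ht]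
      have hχ's : ∀ (t : ({l}ᶜ : Set T)) {U : Type w} (A : Set (Atom σ U)) h, (χ' t).Sat A h →
          (χ t.1).Sat A h := by
        intro t U A h hs
        by_cases ht : t.1 = p
        · rw [hχ'p t ht] at hs; exact hs.1
        · rwa [hχ'n t ht] at hs
      have hcard : Nat.card ({l}ᶜ : Set T) = n := by
        have h1 := Set.ncard_add_ncard_compl ({l} : Set T)
        rw [Set.ncard_singleton, hn] at h1
        rw [← Nat.card_coe_set_eq] at h1
        omega
      refine (ih ({l}ᶜ : Set T) hcard (E.induce {l}ᶜ) (fun t => bag t.1) χ'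
        ⟨root, fun h => hl h.symm⟩ hE' ?_ (fun s t h => hover s.1 t.1 h) ?_ ?_).elim ?_
      · rintro x ⟨s, hs⟩ ⟨t, ht⟩ hxs hxt
        have key : ∀ u, Relation.ReflTransGen (fun s t => E.Adj s t ∧ x ∈ bag s ∧ x ∈ bag t) s u →
            (∀ hu : u ≠ l, Relation.ReflTransGen (fun s t : ({l}ᶜ : Set T) =>
              (E.induce {l}ᶜ).Adj s t ∧ x ∈ bag s.1 ∧ x ∈ bag t.1) ⟨s, hs⟩ ⟨u, hu⟩) ∧
            (u = l → Relation.ReflTransGen (fun s t : ({l}ᶜ : Set T) =>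
              (E.induce {l}ᶜ).Adj s t ∧ x ∈ bag s.1 ∧ x ∈ bag t.1) ⟨s, hs⟩ ⟨p, hpl⟩) := by
          intro u hu
          induction hu with
          | refl => exact ⟨fun _ => .refl, fun h => absurd h hs⟩
          | @tail b c _ hbc ihb =>
            obtain ⟨hadj, hxb, hxc⟩ := hbc
            by_cases hb : b = l
            · subst hb
              have hc := hp c hadj
              subst hc
              exact ⟨fun _ => ihb.2 rfl, fun h => absurd h hpl⟩
            · refine ⟨fun hc => (ihb.1 hb).tail ⟨hadj, hxb, hxc⟩, fun hc => ?_⟩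
              subst hc
              have hb' := hp b hadj.symm
              subst hb'
              exact ihb.1 hb
        exact (key t (hrun x s t hxs hxt)).1 ht
      · intro t
        by_cases ht : t.1 = p
        · rw [hχ'p t ht]
          refine ⟨⟨(hχ _).1, hξ.1⟩, ⟨(hχ _).2.1, hξ.2.1⟩,
            Finset.union_subset (hχ _).2.2.1 (ht ▸ hξ.2.2.1),
            Set.union_subset (hχ _).2.2.2 hξ.2.2.2⟩
        · rw [hχ'n t ht]; exact hχ _
      · intro t
        rcases hguard t.1 with h | ⟨α, h1, h2, h3⟩
        · exact Or.inl h
        · exact Or.inr ⟨α, h1, h2, fun {U} A v hs => h3 A v (hχ's t A v hs)⟩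
      · rintro ψ ⟨hψ, hψs⟩
        refine ⟨ψ, hψ, fun {U} A v => (hψs A v).trans ⟨?_, ?_⟩⟩
        · rintro ⟨h, h1, h2⟩
          have h2p := h2 ⟨p, hpl⟩
          rw [hχ'p _ rfl] at h2p
          obtain ⟨h', h3, h4⟩ := hξw A h h2p.2
          have hagree : ∀ t, t ≠ l → ∀ x ∈ bag t, h' x = h x := fun t ht x hx =>
            h3 x fun hx' => (Finset.mem_sdiff.1 hx').2
              (hshare x t ht (Finset.mem_sdiff.1 hx').1 hx)
          refine ⟨h', fun x hx => (hagree root (Ne.symm hl) x hx).trans (h1 x hx), fun t => ?_⟩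
          by_cases ht : t = l
          · rwa [ht]
          · exact (Formula.Sat.congr_fv fun x hx => hagree t ht x ((hχ t).2.2.1 hx)).2
              (hχ's ⟨t, ht⟩ A h (h2 ⟨t, ht⟩))
        · rintro ⟨h, h1, h2⟩
          refine ⟨h, h1, fun t => ?_⟩
          by_cases ht : t.1 = p
          · rw [hχ'p t ht]; exact ⟨h2 _, hξs A h (h2 l)⟩
          · rw [hχ'n t ht]; exact h2 _

/-- A finite conjunction of atoms. The tautology on the variable `a` makes the empty conjunction an
open formula. -/
theorem exists_formula_of_atoms {b : Finset ℕ} {a : ℕ} (ha : a ∈ b) {R : Set σ}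
    {r : σ} (hr : r ∈ R) (s : Finset (Atom σ ℕ)) (hs : ∀ α ∈ s, α.vars ⊆ b ∧ α.rel ∈ R) :
    ∃ χ : Formula σ, (χ.IsOpenGF ∧ χ.EqFree ∧ χ.fv ⊆ b ∧ χ.rels ⊆ R) ∧
      ∀ {U : Type w} (A : Set (Atom σ U)) v, χ.Sat A v ↔ ∀ α ∈ s, α.map v ∈ A := by
  classical
  induction s using Finset.induction_on with
  | empty =>
    have hv : (⟨r, fun _ => a⟩ : Atom σ ℕ).vars ⊆ b := by
      intro x hx
      obtain ⟨_, rfl⟩ := Atom.mem_vars.1 hx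
      exact ha
    refine ⟨.or (.atom ⟨r, fun _ => a⟩) (.neg (.atom ⟨r, fun _ => a⟩)),
      ⟨⟨trivial, trivial⟩, ⟨trivial, trivial⟩, Finset.union_subset hv hv, ?_⟩, fun {U} A v => ?_⟩
    · simpa [Formula.rels] using hr
    · simpa [Formula.Sat] using em _
  | insert α s hα ih =>
    obtain ⟨χ, h1, h2⟩ := ih fun β hβ => hs β (Finset.mem_insert_of_mem hβ)
    have := hs α (Finset.mem_insert_self _ _)
    refine ⟨.and (.atom α) χ, ⟨⟨trivial, h1.1⟩, ⟨trivial, h1.2.1⟩,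
      Finset.union_subset this.1 h1.2.2.1, Set.union_subset (by simpa [Formula.rels] using this.2)
        h1.2.2.2⟩, fun {U} A v => ?_⟩
    simp only [Formula.Sat, h2, Finset.mem_insert, forall_eq_or_imp]

theorem IsGuarded.finite {U : Type*} {A : Set (Atom σ U)} {G : Set U} (h : IsGuarded A G) :
    G.Finite := by
  rcases h with ⟨a, -, rfl⟩ | ⟨α, -, rfl⟩
  exacts [Set.finite_singleton a, α.elems_finite]

theorem IsGuarded.nonempty {U : Type*} {A : Set (Atom σ U)} {G : Set U} (h : IsGuarded A G) :
    G.Nonempty := by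
  rcases h with ⟨a, -, rfl⟩ | ⟨α, -, rfl⟩
  exacts [Set.singleton_nonempty a, α.elems_nonempty]

theorem IsGuarded.subset_dom {U : Type*} {A : Set (Atom σ U)} {G : Set U} (h : IsGuarded A G) :
    G ⊆ dom A := by
  rcases h with ⟨a, ha, rfl⟩ | ⟨α, hα, rfl⟩
  exacts [Set.singleton_subset_iff.2 ha, fun a ha => ⟨α, hα, ha⟩]

/-- Every rooted acyclic query is equivalent to an equality-free openGF formula. -/
theorem CQ.IsRAQ.exists_formula {q : CQ σ} (hq : q.IsRAQ) :
    ∃ ψ : Formula σ, (ψ.IsOpenGF ∧ ψ.EqFree ∧ (∀ x ∈ ψ.fv, ∃ i, q.ans i = x) ∧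
        ψ.rels ⊆ sig (q.body : Set (Atom σ ℕ))) ∧
      ∀ {U : Type w} (A : Set (Atom σ U)) v, ψ.Sat A v ↔ q.Answer A (fun i => v (q.ans i)) := by
  classical
  obtain ⟨T, hT, E, bag, root, hdec, hroot⟩ := hq
  have hfin : ∀ t, (bag t).Finite := fun t => (hdec.guarded t).finite
  have hconj : ∀ t, ∃ χ : Formula σ, (χ.IsOpenGF ∧ χ.EqFree ∧ χ.fv ⊆ (hfin t).toFinset ∧
      χ.rels ⊆ sig (q.body : Set (Atom σ ℕ))) ∧
      ∀ {U : Type w} (A : Set (Atom σ U)) v, χ.Sat A v ↔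
        ∀ α ∈ q.body.filter (fun α => α.elems ⊆ bag t), α.map v ∈ A := by
    intro t
    obtain ⟨a, ha⟩ := (hdec.guarded t).nonempty
    obtain ⟨β, hβ, -⟩ := (hdec.guarded t).subset_dom ha
    have hβ' : β.rel ∈ sig (q.body : Set (Atom σ ℕ)) := ⟨β, hβ, rfl⟩
    refine exists_formula_of_atoms (a := a) (by simpa) hβ' _ ?_
    intro α hα
    rw [Finset.mem_filter] at hα
    refine ⟨fun x hx => ?_, ⟨α, hα.1, rfl⟩⟩
    simpa using hα.2 (Atom.mem_vars.1 hx)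
  choose χ hχ hχs using hconj
  refine (exists_formula_of_tree.{w} (R := sig (q.body : Set (Atom σ ℕ))) _ T
    rfl E (fun t => (hfin t).toFinset) χ root hdec.isTree ?_ ?_ hχ ?_).elim ?_
  · intro x s t hs ht
    simp only [Set.Finite.mem_toFinset] at hs ht ⊢
    have hreach := (hdec.connected x ((hdec.guarded s).subset_dom hs)).preconnected ⟨s, hs⟩ ⟨t, ht⟩
    rw [SimpleGraph.reachable_iff_reflTransGen] at hreach
    exact hreach.lift (fun u : {t | x ∈ bag t} => u.1) fun a b hab => ⟨hab, a.2, b.2⟩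
  · intro s t hst
    obtain ⟨x, hx⟩ := hdec.overlap s t hst
    exact ⟨x, by simpa using hx⟩
  · intro t
    rcases hdec.guarded t with ⟨a, -, ha⟩ | ⟨α, hα, hα'⟩
    · left
      exact ⟨a, by ext; simp [ha]⟩
    · right
      refine ⟨α, ?_, ⟨α, hα, rfl⟩, fun {U} A v hs => (hχs t A v).1 hs α ?_⟩
      · ext x; simp [hα', Atom.mem_vars]
      · exact Finset.mem_filter.2 ⟨hα, hα'.ge⟩
  · rintro ψ ⟨hψ, hψs⟩
    refine ⟨ψ, ⟨hψ.1, hψ.2.1, fun x hx => ?_, hψ.2.2.2⟩, fun {U} A v => (hψs A v).trans ⟨?_, ?_⟩⟩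
    · have := hψ.2.2.1 hx
      rw [Set.Finite.mem_toFinset, hroot] at this
      exact this
    · rintro ⟨h, h1, h2⟩
      refine ⟨h, fun α hα => ?_, fun i => h1 _ (by simp [hroot])⟩
      obtain ⟨t, ht⟩ := hdec.cover α hα
      exact (hχs t A h).1 (h2 t) α (Finset.mem_filter.2 ⟨hα, ht⟩)
    · rintro ⟨h, h1, h2⟩
      refine ⟨h, fun x hx => ?_, fun t => (hχs t A h).2 fun α hα =>
        h1 α (Finset.mem_filter.1 hα).1⟩
      rw [Set.Finite.mem_toFinset, hroot] at hx
      obtain ⟨i, rfl⟩ := hx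
      exact h2 i

theorem CQ.IsRAQ.arity_pos {q : CQ σ} (hq : q.IsRAQ) : 0 < q.arity := by
  obtain ⟨T, hT, E, bag, root, hdec, hroot⟩ := hq
  obtain ⟨x, hx⟩ := (hdec.guarded root).nonempty
  rw [hroot] at hx
  obtain ⟨i, -⟩ := hx
  exact i.pos

end TreeFormula

/-! ### Extending the root bag of a rooted acyclic query -/

section Extension

variable {σ : Type*} [Vocab σ]

/-- Given a rooted acyclic query, a tuple `a` that is compatible with the repetitions among the
answer variables, and an atom `α₀` that contains all of `a`, some rooted acyclic query whose answer
variables represent the arguments of `α₀` is equivalent to the given query at `a` whenever the atom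
`α₀` is present. The answer variables are renamed along an injection of the elements of `α₀`, and
the renamed atom becomes the root bag. -/
theorem CQ.IsRAQ.exists_extension {q : CQ σ} (hq : q.IsRAQ) {C : Type*} (a : Fin q.arity → C)
    (ha : ∀ i j, q.ans i = q.ans j → a i = a j) (α₀ : Atom σ C) (hα₀ : ∀ i, a i ∈ α₀.elems) :
    ∃ (ans : Fin (Vocab.arity α₀.rel) → ℕ) (body : Finset (Atom σ ℕ))
      (hmem : ∀ i, ans i ∈ dom (body : Set (Atom σ ℕ))),
      (CQ.mk _ ans body hmem).IsRAQ ∧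
      (sig (body : Set (Atom σ ℕ)) ⊆ insert α₀.rel (sig (q.body : Set (Atom σ ℕ)))) ∧
      ∀ {U : Type _} (B : Set (Atom σ U)) (f : C → U),
        (α₀.map f ∈ B → q.Answer B (fun i => f (a i)) →
          (CQ.mk _ ans body hmem).Answer B (fun i => f (α₀.args i))) ∧
        ((CQ.mk _ ans body hmem).Answer B (fun i => f (α₀.args i)) →
          q.Answer B (fun i => f (a i))) := by
  classical
  obtain ⟨e, k, heinj, hek⟩ : ∃ (e : C → ℕ) (k : ℕ), Set.InjOn e α₀.elems ∧
      ∀ c ∈ α₀.elems, e c < k := by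
    obtain ⟨e, he⟩ := Set.countable_iff_exists_injOn.1 α₀.elems_finite.countable
    obtain ⟨k, hk⟩ := (α₀.elems_finite.image e).bddAbove
    exact ⟨e, k + 1, he, fun c hc => Nat.lt_succ_of_le (hk ⟨c, hc, rfl⟩)⟩
  let ρ : ℕ → ℕ := fun x => if h : ∃ i, q.ans i = x then e (a h.choose) else x + k
  have hρa : ∀ i, ρ (q.ans i) = e (a i) := by
    intro i
    have h : ∃ j, q.ans j = q.ans i := ⟨i, rfl⟩
    simp only [ρ, dif_pos h]
    rw [ha _ _ h.choose_spec]
  have hρn : ∀ x, (¬ ∃ i, q.ans i = x) → ρ x = x + k := fun x hx => by simp only [ρ, dif_neg hx]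
  obtain ⟨T, hT, E, bag, root, hdec, hroot⟩ := hq
  let body : Finset (Atom σ ℕ) := insert (α₀.map e) (q.body.image (Atom.map ρ))
  have hb₀ : α₀.map e ∈ (body : Set (Atom σ ℕ)) := by simp [body]
  have hbρ : ∀ α ∈ q.body, α.map ρ ∈ (body : Set (Atom σ ℕ)) := fun α hα => by
    simp only [body, Finset.coe_insert, Finset.coe_image]
    exact Or.inr ⟨α, hα, rfl⟩
  have hbody : ∀ β ∈ (body : Set (Atom σ ℕ)), β = α₀.map e ∨ ∃ α ∈ q.body, β = α.map ρ := by
    intro β hβ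
    simp only [body, Finset.coe_insert, Finset.coe_image] at hβ
    rcases hβ with h | ⟨α, hα, rfl⟩
    exacts [Or.inl h, Or.inr ⟨α, hα, rfl⟩]
  let bag' : T → Set ℕ := fun t => if t = root then e '' α₀.elems else ρ '' bag t
  have hbr : bag' root = e '' α₀.elems := by simp [bag']
  have hbn : ∀ t, t ≠ root → bag' t = ρ '' bag t := fun t ht => by simp [bag', ht]
  have hbs : ∀ t, ρ '' bag t ⊆ bag' t := by
    intro t
    by_cases ht : t = root
    · subst ht
      rw [hbr, hroot]
      rintro _ ⟨_, ⟨i, rfl⟩, rfl⟩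
      exact ⟨a i, hα₀ i, (hρa i).symm⟩
    · rw [hbn t ht]
  refine ⟨fun i => e (α₀.args i), body, fun i => ⟨_, hb₀, i, rfl⟩,
    ⟨T, hT, E, bag', root, ⟨hdec.isTree, ?_, ?_, ?_, ?_⟩, ?_⟩, ?_, ?_⟩
  · intro β hβ
    rcases hbody β hβ with rfl | ⟨α, hα, rfl⟩
    · exact ⟨root, by rw [hbr, Atom.elems_map]⟩
    · obtain ⟨t, ht⟩ := hdec.cover α hα
      exact ⟨t, by rw [Atom.elems_map]; exact (Set.image_mono ht).trans (hbs t)⟩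
  · intro t
    by_cases ht : t = root
    · subst ht
      exact Or.inr ⟨_, hb₀, by rw [hbr, Atom.elems_map]⟩
    · rw [hbn t ht]
      rcases hdec.guarded t with ⟨x, ⟨α, hα, hx⟩, h⟩ | ⟨α, hα, h⟩
      · refine Or.inl ⟨ρ x, ⟨_, hbρ α hα, ?_⟩, by rw [h, Set.image_singleton]⟩
        rw [Atom.elems_map]; exact ⟨x, hx, rfl⟩
      · exact Or.inr ⟨_, hbρ α hα, by rw [h, Atom.elems_map]⟩
  · intro y hy
    by_cases hyr : y ∈ e '' α₀.elems
    · refine SimpleGraph.induce_connected_of_patches root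
        (by simp only [Set.mem_ofPred_eq, hbr]; exact hyr) ?_
      intro t ht
      by_cases htr : t = root
      · subst htr
        exact ⟨{t | y ∈ bag' t}, subset_rfl, ht, ht, .refl _⟩
      · have ht' : y ∈ bag' t := ht
        rw [hbn t htr] at ht'
        obtain ⟨x, hx, rfl⟩ := ht'
        have hxa : ∃ i, q.ans i = x := by
          by_contra hxa
          obtain ⟨c, hc, hcx⟩ := hyr
          rw [hρn x hxa] at hcx
          have := hek c hc
          omega
        have hxr : x ∈ bag root := by rw [hroot]; exact hxa
        exact ⟨{s | x ∈ bag s}, fun s hs => hbs s ⟨x, hs, rfl⟩, hxr, hx,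
          (hdec.connected x ((hdec.guarded t).subset_dom hx)).preconnected _ _⟩
    · obtain ⟨β, hβ, hyβ⟩ := hy
      rcases hbody β hβ with rfl | ⟨α, hα, rfl⟩
      · rw [Atom.elems_map] at hyβ; exact absurd hyβ hyr
      · rw [Atom.elems_map] at hyβ
        obtain ⟨x, hx, rfl⟩ := hyβ
        have hxa : ¬ ∃ i, q.ans i = x := by
          rintro ⟨i, rfl⟩
          exact hyr ⟨a i, hα₀ i, (hρa i).symm⟩
        have hset : {t | ρ x ∈ bag' t} = {t | x ∈ bag t} := by
          ext t
          constructor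
          · intro ht
            have ht' : ρ x ∈ bag' t := ht
            by_cases htr : t = root
            · subst htr; rw [hbr] at ht'; exact absurd ht' hyr
            · rw [hbn t htr] at ht'
              obtain ⟨x', hx', hxx⟩ := ht'
              by_cases hxa' : ∃ i, q.ans i = x'
              · obtain ⟨i, rfl⟩ := hxa'
                exact absurd ⟨a i, hα₀ i, (hρa i).symm.trans hxx⟩ hyr
              · rw [hρn x hxa, hρn x' hxa'] at hxx
                have : x' = x := by omega
                exact this ▸ hx'
          · exact fun ht => hbs t ⟨x, ht, rfl⟩
        rw [hset]
        exact hdec.connected x ⟨α, hα, hx⟩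
  · intro s t hst
    obtain ⟨x, hxs, hxt⟩ := hdec.overlap s t hst
    exact ⟨ρ x, hbs s ⟨x, hxs, rfl⟩, hbs t ⟨x, hxt, rfl⟩⟩
  · rw [hbr]
    exact (Set.range_comp e α₀.args).symm
  · rintro _ ⟨β, hβ, rfl⟩
    rcases hbody β hβ with rfl | ⟨α, hα, rfl⟩
    exacts [Or.inl rfl, Or.inr ⟨α, hα, rfl⟩]
  · intro U B f
    constructor
    · rintro hα ⟨h, h1, h2⟩
      let h' : ℕ → U := fun n =>
        if hn : ∃ c ∈ α₀.elems, e c = n then f hn.choose else h (n - k)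
      have hh' : ∀ c ∈ α₀.elems, h' (e c) = f c := by
        intro c hc
        have hn : ∃ c' ∈ α₀.elems, e c' = e c := ⟨c, hc, rfl⟩
        simp only [h', dif_pos hn]
        rw [heinj hn.choose_spec.1 hc hn.choose_spec.2]
      have hh'ρ : h' ∘ ρ = h := by
        funext x
        by_cases hx : ∃ i, q.ans i = x
        · obtain ⟨i, rfl⟩ := hx
          simp only [Function.comp_apply, hρa]
          rw [hh' _ (hα₀ i), h2]
        · have hn : ¬ ∃ c ∈ α₀.elems, e c = x + k := by
            rintro ⟨c, hc, hcx⟩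
            have := hek c hc
            omega
          simp only [Function.comp_apply, hρn x hx]
          simp only [h', dif_neg hn, Nat.add_sub_cancel]
      refine ⟨h', fun β hβ => ?_, fun i => hh' _ (α₀.args_mem i)⟩
      rcases hbody β hβ with rfl | ⟨α, hα', rfl⟩
      · rw [Atom.map_map, Atom.map_congr (f := h' ∘ e) (g := f) fun c hc => hh' c hc]
        exact hα
      · rw [Atom.map_map, hh'ρ]
        exact h1 α hα'
    · rintro ⟨h, h1, h2⟩
      refine ⟨h ∘ ρ, fun α hα => ?_, fun i => ?_⟩
      · rw [← Atom.map_map]; exact h1 _ (hbρ α hα)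
      · obtain ⟨j, hj⟩ := hα₀ i
        have := h2 j
        simp only at this
        rw [hj] at this
        simpa [hρa i] using this

/-- The query that consists of a single atom with distinct answer variables. -/
def CQ.ofSymbol (r : σ) : CQ σ where
  arity := Vocab.arity r
  ans i := i
  body := {⟨r, fun i => i⟩}
  ans_mem i := ⟨⟨r, fun i => i⟩, by simp, i, rfl⟩

theorem CQ.ofSymbol_isRAQ (r : σ) : (CQ.ofSymbol r).IsRAQ := by
  refine ⟨Unit, inferInstance, ⊥, fun _ => Set.range fun i : Fin (Vocab.arity r) => (i : ℕ), (),
    ⟨.of_subsingleton, ?_, ?_, ?_, ?_⟩, rfl⟩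
  · intro α hα
    simp only [CQ.ofSymbol, Finset.coe_singleton, Set.mem_singleton_iff] at hα
    subst hα
    exact ⟨(), subset_rfl⟩
  · exact fun _ => Or.inr ⟨⟨r, fun i => i⟩, by simp [CQ.ofSymbol], rfl⟩
  · rintro a ⟨α, hα, ha⟩
    simp only [CQ.ofSymbol, Finset.coe_singleton, Set.mem_singleton_iff] at hα
    subst hα
    have : Nonempty {t : Unit | a ∈ Set.range fun i : Fin (Vocab.arity r) => (i : ℕ)} :=
      ⟨⟨(), ha⟩⟩
    exact (SimpleGraph.IsTree.of_subsingleton).connected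
  · intro t t' h
    exact h.elim

theorem CQ.ofSymbol_sig (r : σ) : sig ((CQ.ofSymbol r).body : Set (Atom σ ℕ)) = {r} := by
  simp [CQ.ofSymbol, sig]

theorem CQ.Answer.rel_mem_sig {r : σ} {U : Type*} {A : Set (Atom σ U)} {a}
    (h : (CQ.ofSymbol r).Answer A a) : r ∈ sig A := by
  obtain ⟨h, h1, -⟩ := h
  exact ⟨_, h1 ⟨r, fun i => i⟩ (by simp [CQ.ofSymbol]), rfl⟩

end Extension

/-! ### Gluing interpretations along guarded sets -/

section Glue

variable {σ : Type*} [Vocab σ] {I W X : Type*}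

/-- The union of copies of the interpretations `B i`. The copy of `B i` lives on `P i`, where the
element `x` represents the element `π i x`; distinct elements may represent the same element. -/
def glue (P : I → Set X) (π : I → X → W) (B : I → Set (Atom σ W)) : Set (Atom σ X) :=
  {α | ∃ i, α.elems ⊆ P i ∧ α.map (π i) ∈ B i}

variable {P : I → Set X} {π : I → X → W} {B : I → Set (Atom σ W)} {Φ : Set (Formula σ)}

/-- If any two pieces agree on the formulas in `Φ` at the tuples that they share, then truth in the
union is truth in the pieces. A quantified formula is moved to the piece that contains the atom
matching its guard; this is possible since the guard has a free variable. -/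
theorem sat_glue_iff (hΦ : SubClosed Φ) (hGF : ∀ φ ∈ Φ, φ.IsOpenGF)
    (hsurj : ∀ i, ∀ w ∈ dom (B i), ∃ x ∈ P i, π i x = w)
    (hagree : ∀ i j, ∀ φ ∈ Φ, ∀ v : ℕ → X, (∀ x ∈ φ.fv, v x ∈ P i ∧ v x ∈ P j) →
      (φ.Sat (B i) (π i ∘ v) ↔ φ.Sat (B j) (π j ∘ v)))
    (hinj : (∀ i, Set.InjOn (π i) (P i)) ∨ ∀ φ ∈ Φ, φ.EqFree)
    {φ : Formula σ} (hφ : φ ∈ Φ) (i : I) (v : ℕ → X) (hv : ∀ x ∈ φ.fv, v x ∈ P i) :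
    φ.Sat (glue P π B) v ↔ φ.Sat (B i) (π i ∘ v) := by
  have ex : ∀ (ys : Finset ℕ) (α : Atom σ ℕ) (φ : Formula σ), ys ⊆ α.vars → φ.fv ⊆ α.vars →
      (∀ i (v : ℕ → X), (∀ x ∈ φ.fv, v x ∈ P i) →
        (φ.Sat (glue P π B) v ↔ φ.Sat (B i) (π i ∘ v))) →
      ∀ v : ℕ → X, (∀ i j, (∀ x ∈ (α.vars ∪ φ.fv) \ ys, v x ∈ P i ∧ v x ∈ P j) →
        ((Formula.ex ys α φ).Sat (B i) (π i ∘ v) ↔ (Formula.ex ys α φ).Sat (B j) (π j ∘ v))) →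
      ∀ i, (∀ x ∈ (α.vars ∪ φ.fv) \ ys, v x ∈ P i) →
      ((Formula.ex ys α φ).Sat (glue P π B) v ↔ (Formula.ex ys α φ).Sat (B i) (π i ∘ v)) := by
    intro ys α φ hys hfv ih v hag i hv
    constructor
    · rintro ⟨w, h1, -, ⟨j, h3, h4⟩, h5⟩
      rw [Atom.elems_map] at h3
      have hw : ∀ x ∈ α.vars, w x ∈ P j := fun x hx => h3 ⟨x, Atom.mem_vars.1 hx, rfl⟩
      refine (hag i j fun x hx => ⟨hv x hx, ?_⟩).2 ⟨π j ∘ w, fun x hx => by simp [h1 x hx],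
        fun x hx => ⟨_, h4, ?_⟩, h4, (ih j w fun x hx => hw x (hfv hx)).1 h5⟩
      · rw [Finset.mem_sdiff, Finset.union_eq_left.2 hfv] at hx
        rw [← h1 x hx.2]
        exact hw x hx.1
      · rw [Atom.map_map, Atom.elems_map]
        exact ⟨x, Atom.mem_vars.1 (hys hx), rfl⟩
    · rintro ⟨u, h1, h2, h3, h4⟩
      have : ∀ x ∈ ys, ∃ y ∈ P i, π i y = u x := fun x hx => hsurj i _ (h2 x hx)
      have hne : Nonempty X := ⟨v 0⟩
      choose! f hf using this
      classical
      set w : ℕ → X := fun x => if x ∈ ys then f x else v x with hw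
      have hu : u = π i ∘ w := by
        funext x
        by_cases hx : x ∈ ys
        · simp [hw, hx, (hf x hx).2]
        · simp [hw, hx, h1 x hx]
      have hwP : ∀ x ∈ α.vars, w x ∈ P i := by
        intro x hx
        by_cases hy : x ∈ ys
        · simpa [hw, hy] using (hf x hy).1
        · simpa [hw, hy] using hv x (by simp [hx, hy])
      rw [hu] at h3 h4
      have hα : α.map w ∈ glue P π B := by
        refine ⟨i, ?_, h3⟩
        rw [Atom.elems_map]
        rintro _ ⟨x, hx, rfl⟩
        exact hwP x (Atom.mem_vars.2 hx)
      refine ⟨w, fun x hx => by simp [hw, hx], fun x hx => ⟨_, hα, ?_⟩, hα,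
        (ih i w fun x hx => hwP x (hfv hx)).2 h4⟩
      rw [Atom.elems_map]
      exact ⟨x, Atom.mem_vars.1 (hys hx), rfl⟩
  induction φ generalizing i v with
  | atom α =>
    constructor
    · rintro ⟨j, h1, h2⟩
      rw [Atom.elems_map] at h1
      exact (hagree i j _ hφ v fun x hx => ⟨hv x hx, h1 ⟨x, Atom.mem_vars.1 hx, rfl⟩⟩).2 h2
    · intro h
      refine ⟨i, ?_, h⟩
      rw [Atom.elems_map]
      rintro _ ⟨x, hx, rfl⟩
      exact hv x (Atom.mem_vars.2 hx)
  | eq x y =>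
    rcases hinj with hinj | hinj
    · exact ((hinj i).eq_iff (hv x (by simp [Formula.fv])) (hv y (by simp [Formula.fv]))).symm
    · exact (hinj _ hφ).elim
  | neg φ ih =>
    exact not_congr (ih (hΦ _ hφ (Or.inr φ.mem_sub_self)) i v hv)
  | and φ ψ ih ih' =>
    exact and_congr (ih (hΦ _ hφ (Or.inr (Or.inl φ.mem_sub_self))) i v
        fun x hx => hv x (by simp [Formula.fv, hx]))
      (ih' (hΦ _ hφ (Or.inr (Or.inr ψ.mem_sub_self))) i v
        fun x hx => hv x (by simp [Formula.fv, hx]))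
  | or φ ψ ih ih' =>
    exact or_congr (ih (hΦ _ hφ (Or.inr (Or.inl φ.mem_sub_self))) i v
        fun x hx => hv x (by simp [Formula.fv, hx]))
      (ih' (hΦ _ hφ (Or.inr (Or.inr ψ.mem_sub_self))) i v
        fun x hx => hv x (by simp [Formula.fv, hx]))
  | all ys α φ ih =>
    have hGF' := hGF _ hφ
    have hφ' := hΦ _ hφ (Or.inr (Or.inr φ.mem_sub_self))
    have hag := fun i j => hagree i j _ hφ v
    simp only [Formula.sat_all_iff, not_iff_not] at hag ⊢
    exact ex ys α (.neg φ) hGF'.1 hGF'.2.1 (fun i v hv => not_congr (ih hφ' i v hv)) v hag i hv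
  | ex ys α φ ih =>
    have hGF' := hGF _ hφ
    have hφ' := hΦ _ hφ (Or.inr (Or.inr φ.mem_sub_self))
    exact ex ys α φ hGF'.1 hGF'.2.1 (ih hφ') v (fun i j => hagree i j _ hφ v) i hv
  | exGe n z α φ ih => exact (hGF _ hφ).elim

theorem holds_glue
    (hsat : ∀ φ ∈ Φ, ∀ (i : I) (v : ℕ → X), (∀ x ∈ φ.fv, v x ∈ P i) →
      (φ.Sat (glue P π B) v ↔ φ.Sat (B i) (π i ∘ v)))
    {s : Sentence σ} (hs : s.body ∈ Φ) (hfv : s.body.fv ⊆ s.guard.vars)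
    (hB : ∀ i, s.Holds (B i)) : s.Holds (glue P π B) := by
  intro v hd hg
  obtain ⟨g, φ⟩ := s
  cases g with
  | atom α =>
    obtain ⟨i, h1, h2⟩ := hg
    rw [Atom.elems_map] at h1
    refine (hsat φ hs i v fun x hx => h1 ⟨x, Atom.mem_vars.1 (hfv hx), rfl⟩).2
      (hB i (π i ∘ v) (fun x hx => ⟨_, h2, ?_⟩) h2)
    rw [Atom.map_map, Atom.elems_map]
    exact ⟨x, Atom.mem_vars.1 hx, rfl⟩
  | eqSelf y =>
    obtain ⟨α, ⟨i, h1, h2⟩, hy⟩ := hd y (Finset.mem_singleton_self y)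
    have hfv' : ∀ x ∈ φ.fv, x = y := fun x hx => Finset.mem_singleton.1 (hfv hx)
    refine (hsat φ hs i v fun x hx => hfv' x hx ▸ h1 hy).2 (hB i (π i ∘ v) (fun x hx => ?_) rfl)
    rw [Finset.mem_singleton.1 hx]
    exact ⟨_, h2, by rw [Atom.elems_map]; exact ⟨_, hy, rfl⟩⟩

end Glue

/-! ### Interpretations assembled from stars -/

section LocalCover

variable {σ : Type*} [Vocab σ] {W X : Type*}

theorem Atom.exists_elems_subset_pair {α : Atom σ X} (h : Vocab.arity α.rel ≤ 2) {a : X}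
    (ha : a ∈ α.elems) : ∃ b ∈ α.elems, ∀ x ∈ α.elems, x = a ∨ x = b := by
  by_contra hcon
  push Not at hcon
  obtain ⟨b, hb, hba, -⟩ := hcon a ha
  obtain ⟨c, hc, hca, hcb⟩ := hcon b hb
  have h3 : ({a, b, c} : Set X).encard ≤ α.elems.encard := by
    apply Set.encard_le_encard
    rintro x (rfl | rfl | rfl) <;> assumption
  have h4 : α.elems.encard ≤ 2 := by
    have : α.elems.encard ≤ (Set.univ : Set (Fin (Vocab.arity α.rel))).encard := by
      rw [Atom.elems, ← Set.image_univ]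
      exact Set.encard_image_le _ _
    refine this.trans ?_
    rw [Set.encard_univ, ENat.card_eq_coe_fintype_card, Fintype.card_fin]
    exact_mod_cast h
  rw [Set.encard_eq_three.2 ⟨a, b, c, hba.symm, hca.symm, hcb.symm, rfl⟩] at h3
  exact absurd (h3.trans h4) (by norm_num)

/-- The closed neighbourhood of `c z` in `B z`. -/
def nbhd (B : X → Set (Atom σ W)) (c : X → W) (z : X) : Set W :=
  {y | ∃ β ∈ B z, c z ∈ β.elems ∧ y ∈ β.elems}

/-- The interpretation whose atoms at the element `z` are those at `c z` in `B z`; the map `s z`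
sends the neighbourhood of `c z` to the neighbourhood of `z`. -/
def starUnion (B : X → Set (Atom σ W)) (c : X → W) (s : X → W → X) : Set (Atom σ X) :=
  {α | ∃ z, ∃ β ∈ B z, c z ∈ β.elems ∧ α = β.map (s z)}

/-- The stars fit together: each is embedded with its centre at the right place, and the two stars
at the ends of an edge agree on the formulas in `Φ` at that edge. -/
structure IsLocalCover (Φ : Set (Formula σ)) (B : X → Set (Atom σ W)) (c : X → W)
    (s : X → W → X) : Prop where
  center : ∀ z, s z (c z) = z
  inj : ∀ z, Set.InjOn (s z) (nbhd B c z)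
  switch : ∀ z, ∀ y ∈ nbhd B c z, ∃ y' ∈ nbhd B c (s z y), s (s z y) y' = z ∧
    ∀ φ ∈ Φ, ∀ w w' : ℕ → W, (∀ x ∈ φ.fv, (w x = c z ∧ w' x = y') ∨ (w x = y ∧ w' x = c (s z y))) →
      (φ.Sat (B z) w ↔ φ.Sat (B (s z y)) w')

variable {Φ : Set (Formula σ)} {B : X → Set (Atom σ W)} {c : X → W} {s : X → W → X}

theorem center_mem_nbhd {z : X} {y : W} (hy : y ∈ nbhd B c z) : c z ∈ nbhd B c z := by
  obtain ⟨β, h1, h2, -⟩ := hy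
  exact ⟨β, h1, h2, h2⟩

namespace IsLocalCover

theorem switch_assignment (h : IsLocalCover Φ B c s) {z : X} {y : W} (hy : y ∈ nbhd B c z)
    {φ : Formula σ} (hφ : φ ∈ Φ) {w : ℕ → W} (hw : ∀ x ∈ φ.fv, w x = c z ∨ w x = y) :
    ∃ y' ∈ nbhd B c (s z y), ∃ w' : ℕ → W,
      (∀ x ∈ φ.fv, (w' x = c (s z y) ∨ w' x = y') ∧ s (s z y) (w' x) = s z (w x)) ∧
      (∀ x, w x = y → w' x = c (s z y)) ∧
      (φ.Sat (B z) w ↔ φ.Sat (B (s z y)) w') := by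
  obtain ⟨y', hy', e, hs⟩ := h.switch z y hy
  classical
  refine ⟨y', hy', fun x => if w x = y then c (s z y) else y', fun x hx => ?_,
    fun x hx => by simp [hx], hs φ hφ _ _ fun x hx => ?_⟩
  · by_cases hxy : w x = y
    · simp [hxy, h.center]
    · have := (hw x hx).resolve_right hxy
      simp only [hxy, if_false, or_true, true_and]
      rw [this, e, h.center]
  · by_cases hxy : w x = y
    · simp [hxy]
    · exact Or.inl ⟨(hw x hx).resolve_right hxy, by simp [hxy]⟩

theorem exists_nbhd_of_mem (h : IsLocalCover Φ B c s) {α : Atom σ X}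
    (hα : α ∈ starUnion B c s) (hbin : Vocab.arity α.rel ≤ 2) {z : X} (hz : z ∈ α.elems) :
    ∃ y ∈ nbhd B c z, ∀ a ∈ α.elems, a = z ∨ a = s z y := by
  obtain ⟨z₀, β, hβ, hc, rfl⟩ := hα
  obtain ⟨y₀, hy₀, hsub⟩ := Atom.exists_elems_subset_pair (α := β) hbin hc
  have hyN : y₀ ∈ nbhd B c z₀ := ⟨β, hβ, hc, hy₀⟩
  rw [Atom.elems_map] at hz ⊢
  have hmem : ∀ a ∈ s z₀ '' β.elems, a = z₀ ∨ a = s z₀ y₀ := by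
    rintro _ ⟨b, hb, rfl⟩
    rcases hsub b hb with rfl | rfl
    exacts [Or.inl (h.center z₀), Or.inr rfl]
  rcases hmem z hz with rfl | rfl
  · exact ⟨y₀, hyN, hmem⟩
  · obtain ⟨y', hy', e, -⟩ := h.switch z₀ y₀ hyN
    exact ⟨y', hy', fun a ha => by rw [e]; exact (hmem a ha).symm⟩

theorem atom_mem_iff (h : IsLocalCover Φ B c s) {α : Atom σ ℕ} (hα : Formula.atom α ∈ Φ)
    {z : X} {y : W} (hy : y ∈ nbhd B c z) {w : ℕ → W}
    (hw : ∀ x ∈ α.vars, w x = c z ∨ w x = y) :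
    α.map (s z ∘ w) ∈ starUnion B c s ↔ α.map w ∈ B z := by
  -- an atom over the star of `z` that stems from the star of `z₀ = z`
  have key : ∀ {z : X} {y : W} {w : ℕ → W} {v : ℕ → X} {β : Atom σ W}, y ∈ nbhd B c z →
      (∀ x ∈ α.vars, w x = c z ∨ w x = y) → (∀ x ∈ α.vars, s z (w x) = v x) → β ∈ B z →
      c z ∈ β.elems → α.map v = β.map (s z) → α.map w ∈ B z := by
    intro z y w v β hy hw hv hβ hc e
    have e' : (α.map w).map (s z) = β.map (s z) := by
      rw [Atom.map_map, ← e]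
      exact Atom.map_congr fun x hx => hv x (Atom.mem_vars.2 hx)
    rwa [Atom.map_injOn (h.inj z) ?_ (fun b hb => ⟨β, hβ, hc, hb⟩) e']
    rw [Atom.elems_map]
    rintro _ ⟨x, hx, rfl⟩
    rcases hw x (Atom.mem_vars.2 hx) with hx | hx <;> rw [hx]
    exacts [center_mem_nbhd hy, hy]
  constructor
  · rintro ⟨z₀, β, hβ, hc, e⟩
    have hz₀ : z₀ ∈ (α.map (s z ∘ w)).elems := by
      rw [e, Atom.elems_map]; exact ⟨_, hc, h.center z₀⟩
    rw [Atom.elems_map] at hz₀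
    obtain ⟨x, hx, hxz⟩ := hz₀
    rw [Function.comp_apply] at hxz
    rcases hw x (Atom.mem_vars.2 hx) with hx' | hx'
    · rw [hx', h.center] at hxz
      subst hxz
      exact key hy hw (fun _ _ => rfl) hβ hc e
    · rw [hx'] at hxz
      subst hxz
      obtain ⟨y', hy', w', h1, -, h3⟩ := h.switch_assignment hy hα hw
      exact h3.2 (key hy' (fun x hx => (h1 x hx).1) (fun x hx => (h1 x hx).2) hβ hc e)
  · intro hm
    obtain ⟨x, hx⟩ := α.vars_nonempty
    have hx' : w x ∈ (α.map w).elems := by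
      rw [Atom.elems_map]; exact ⟨x, Atom.mem_vars.1 hx, rfl⟩
    rcases hw x hx with hxz | hxz
    · exact ⟨z, _, hm, hxz ▸ hx', rfl⟩
    · obtain ⟨y', hy', w', h1, h2, h3⟩ := h.switch_assignment hy hα hw
      refine ⟨s z y, _, h3.1 hm, ?_, ?_⟩
      · rw [Atom.elems_map]
        exact ⟨x, Atom.mem_vars.1 hx, h2 x hxz⟩
      · exact (Atom.map_congr fun x hx => (h1 x (Atom.mem_vars.2 hx)).2).symm

/-- Truth at an edge of the assembled interpretation is truth in the star at an end of the edge. A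
quantifier is evaluated in the star of a free element of its guard; since that star contains all
neighbours of the element exactly once, also counting quantifiers are respected. -/
theorem sat_iff (h : IsLocalCover Φ B c s) (hΦ : SubClosed Φ) (hG : ∀ φ ∈ Φ, φ.Guarded)
    (hbin : ∀ φ ∈ Φ, φ.rels ⊆ binarySymbols σ) {φ : Formula σ} (hφ : φ ∈ Φ) {z : X} {y : W}
    (hy : y ∈ nbhd B c z) {w : ℕ → W} (hw : ∀ x ∈ φ.fv, w x = c z ∨ w x = y) :
    φ.Sat (starUnion B c s) (s z ∘ w) ↔ φ.Sat (B z) w := by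
  -- the two directions of the transfer of a guard to the star of one of its free elements
  have toStar : ∀ {α : Atom σ ℕ}, Formula.atom α ∈ Φ → ∀ {z : X} {y : W}, y ∈ nbhd B c z →
      ∀ {ys : Finset ℕ} {w : ℕ → W} {v : ℕ → X},
      (∀ x ∈ α.vars \ ys, w x = c z ∨ w x = y) → (∀ x, x ∉ ys → v x = s z (w x)) →
      α.map v ∈ starUnion B c s → (∃ x ∈ α.vars \ ys, w x = c z) →
      ∃ y' ∈ nbhd B c z, ∃ u : ℕ → W, (∀ x, x ∉ ys → u x = w x) ∧
        (∀ x ∈ α.vars, (u x = c z ∨ u x = y') ∧ s z (u x) = v x) ∧ α.map u ∈ B z := by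
    intro α hα z y hy ys w v hw hv hm ⟨x₀, hx₀, hx₀z⟩
    have hb : Vocab.arity α.rel ≤ 2 := hbin _ hα rfl
    have hx₀' := Finset.mem_sdiff.1 hx₀
    have hz : z ∈ (α.map v).elems := by
      rw [Atom.elems_map]
      exact ⟨x₀, Atom.mem_vars.1 hx₀'.1, by rw [hv x₀ hx₀'.2, hx₀z, h.center]⟩
    obtain ⟨y', hy', hsub⟩ := h.exists_nbhd_of_mem hm hb hz
    rw [Atom.elems_map] at hsub
    have hsub' : ∀ x ∈ α.vars, v x = z ∨ v x = s z y' := fun x hx =>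
      hsub _ ⟨x, Atom.mem_vars.1 hx, rfl⟩
    classical
    set u : ℕ → W := fun x => if x ∈ ys then (if v x = z then c z else y') else w x with hu
    have hu' : ∀ x ∈ α.vars, (u x = c z ∨ u x = y') ∧ s z (u x) = v x := by
      intro x hx
      by_cases hxy : x ∈ ys
      · by_cases hvz : v x = z
        · simp [hu, hxy, hvz, h.center]
        · simp only [hu, hxy, hvz, if_true, if_false, or_true, true_and]
          exact ((hsub' x hx).resolve_left hvz).symm
      · have hxw := hw x (Finset.mem_sdiff.2 ⟨hx, hxy⟩)
        have hwN : w x ∈ nbhd B c z := by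
          rcases hxw with e | e <;> rw [e]
          exacts [center_mem_nbhd hy, hy]
        simp only [hu, hxy, if_false]
        refine ⟨?_, (hv x hxy).symm⟩
        rcases hsub' x hx with e | e <;> rw [hv x hxy] at e
        · left
          exact h.inj z hwN (center_mem_nbhd hy) (e.trans (h.center z).symm)
        · right
          exact h.inj z hwN hy' e
    refine ⟨y', hy', u, fun x hx => by simp [hu, hx], hu', ?_⟩
    rw [← h.atom_mem_iff hα hy' fun x hx => (hu' x hx).1]
    rwa [Atom.map_congr (f := s z ∘ u) (g := v) fun x hx => (hu' x (Atom.mem_vars.2 hx)).2]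
  have ofStar : ∀ {α : Atom σ ℕ}, Formula.atom α ∈ Φ → ∀ {z : X} {u : ℕ → W}, α.map u ∈ B z →
      (∃ x ∈ α.vars, u x = c z) → α.map (s z ∘ u) ∈ starUnion B c s ∧
        ∃ y' ∈ nbhd B c z, ∀ x ∈ α.vars, u x = c z ∨ u x = y' := by
    rintro α hα z u hm ⟨x₀, hx₀, hx₀z⟩
    have hc : c z ∈ (α.map u).elems := by
      rw [Atom.elems_map]; exact ⟨x₀, Atom.mem_vars.1 hx₀, hx₀z⟩
    obtain ⟨y', hy', hsub⟩ := Atom.exists_elems_subset_pair (α := α.map u) (hbin _ hα rfl) hc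
    rw [Atom.elems_map] at hsub
    exact ⟨⟨z, _, hm, hc, rfl⟩, y', ⟨_, hm, hc, hy'⟩,
      fun x hx => hsub _ ⟨x, Atom.mem_vars.1 hx, rfl⟩⟩
  have ex : ∀ (ys : Finset ℕ) (α : Atom σ ℕ) (φ : Formula σ), ys ⊆ α.vars → φ.fv ⊆ α.vars →
      Formula.atom α ∈ Φ →
      (∀ {z : X} {y : W}, y ∈ nbhd B c z → ∀ {w : ℕ → W}, (∀ x ∈ φ.fv, w x = c z ∨ w x = y) →
        (φ.Sat (starUnion B c s) (s z ∘ w) ↔ φ.Sat (B z) w)) →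
      ∀ {z : X} {y : W}, y ∈ nbhd B c z → ∀ {w : ℕ → W},
        (∀ x ∈ (α.vars ∪ φ.fv) \ ys, w x = c z ∨ w x = y) → (∃ x ∈ α.vars \ ys, w x = c z) →
        ((Formula.ex ys α φ).Sat (starUnion B c s) (s z ∘ w) ↔
          (Formula.ex ys α φ).Sat (B z) w) := by
    intro ys α φ hys hfv hα ih z y hy w hw hx₀
    rw [Finset.union_eq_left.2 hfv] at hw
    constructor
    · rintro ⟨v, h1, -, h3, h4⟩
      obtain ⟨y', hy', u, h5, h6, h7⟩ := toStar hα hy hw h1 h3 hx₀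
      refine ⟨u, h5, fun x hx => mem_dom_of_map_mem h7 (hys hx), h7,
        (ih hy' fun x hx => (h6 x (hfv hx)).1).1 ?_⟩
      exact (Formula.Sat.congr_fv fun x hx => (h6 x (hfv hx)).2).2 h4
    · rintro ⟨u, h1, -, h3, h4⟩
      obtain ⟨x₀, hx₀, hx₀z⟩ := hx₀
      have hx₀' := Finset.mem_sdiff.1 hx₀
      obtain ⟨h5, y', hy', h6⟩ := ofStar hα h3 ⟨x₀, hx₀'.1, (h1 x₀ hx₀'.2).trans hx₀z⟩
      exact ⟨s z ∘ u, fun x hx => by simp [h1 x hx], fun x hx => mem_dom_of_map_mem h5 (hys hx), h5,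
        (ih hy' fun x hx => h6 x (hfv hx)).2 h4⟩
  -- if no free variable of the guard denotes the centre, pass to the star at the other end
  have wlog_center : ∀ {χ : Formula σ} {fs : Finset ℕ}, χ ∈ Φ → fs.Nonempty → fs ⊆ χ.fv →
      (∀ {z : X} {y : W}, y ∈ nbhd B c z → ∀ {w : ℕ → W}, (∀ x ∈ χ.fv, w x = c z ∨ w x = y) →
        (∃ x ∈ fs, w x = c z) → (χ.Sat (starUnion B c s) (s z ∘ w) ↔ χ.Sat (B z) w)) →
      ∀ {z : X} {y : W}, y ∈ nbhd B c z → ∀ {w : ℕ → W}, (∀ x ∈ χ.fv, w x = c z ∨ w x = y) →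
        (χ.Sat (starUnion B c s) (s z ∘ w) ↔ χ.Sat (B z) w) := by
    rintro χ fs hχ ⟨x₀, hx₀⟩ hfs hmain z y hy w hw
    rcases hw x₀ (hfs hx₀) with e | e
    · exact hmain hy hw ⟨x₀, hx₀, e⟩
    · obtain ⟨y', hy', w', h1, h2, h3⟩ := h.switch_assignment hy hχ hw
      rw [h3, ← hmain hy' (fun x hx => (h1 x hx).1) ⟨x₀, hx₀, h2 x₀ e⟩]
      exact Formula.Sat.congr_fv fun x hx => (h1 x hx).2.symm
  induction φ generalizing z y w with
  | atom α => exact h.atom_mem_iff hφ hy hw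
  | eq x x' =>
    have hN : ∀ x'' ∈ (Formula.eq x x' : Formula σ).fv, w x'' ∈ nbhd B c z := by
      intro x'' hx
      rcases hw x'' hx with e | e <;> rw [e]
      exacts [center_mem_nbhd hy, hy]
    exact (h.inj z).eq_iff (hN x (by simp [Formula.fv])) (hN x' (by simp [Formula.fv]))
  | neg φ ih =>
    exact not_congr (ih (hΦ _ hφ (Or.inr φ.mem_sub_self)) hy hw)
  | and φ ψ ih ih' =>
    exact and_congr (ih (hΦ _ hφ (Or.inr (Or.inl φ.mem_sub_self))) hy
        fun x hx => hw x (by simp [Formula.fv, hx]))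
      (ih' (hΦ _ hφ (Or.inr (Or.inr ψ.mem_sub_self))) hy
        fun x hx => hw x (by simp [Formula.fv, hx]))
  | or φ ψ ih ih' =>
    exact or_congr (ih (hΦ _ hφ (Or.inr (Or.inl φ.mem_sub_self))) hy
        fun x hx => hw x (by simp [Formula.fv, hx]))
      (ih' (hΦ _ hφ (Or.inr (Or.inr ψ.mem_sub_self))) hy
        fun x hx => hw x (by simp [Formula.fv, hx]))
  | all ys α φ ih =>
    obtain ⟨hys, hfv, hne, -⟩ := hG _ hφ
    have hφ' := hΦ _ hφ (Or.inr (Or.inr φ.mem_sub_self))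
    have hα' := hΦ _ hφ (Or.inr (Or.inl rfl))
    refine wlog_center hφ hne (Finset.sdiff_subset_sdiff Finset.subset_union_left subset_rfl)
      (fun hy w hw hx₀ => ?_) hy hw
    rw [Formula.sat_all_iff, Formula.sat_all_iff, not_iff_not]
    exact ex ys α (.neg φ) hys hfv hα' (fun hy w hw => not_congr (ih hφ' hy hw)) hy hw hx₀
  | ex ys α φ ih =>
    obtain ⟨hys, hfv, hne, -⟩ := hG _ hφ
    have hφ' := hΦ _ hφ (Or.inr (Or.inr φ.mem_sub_self))
    have hα' := hΦ _ hφ (Or.inr (Or.inl rfl))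
    refine wlog_center hφ hne (Finset.sdiff_subset_sdiff Finset.subset_union_left subset_rfl)
      (fun hy w hw hx₀ => ?_) hy hw
    exact ex ys α φ hys hfv hα' (fun hy w hw => ih hφ' hy hw) hy hw hx₀
  | exGe n ζ α φ ih =>
    obtain ⟨hζ, hfv, hne, -⟩ := hG _ hφ
    have hφ' := hΦ _ hφ (Or.inr (Or.inr φ.mem_sub_self))
    have hα' := hΦ _ hφ (Or.inr (Or.inl rfl))
    refine wlog_center hφ hne (Finset.sdiff_subset_sdiff Finset.subset_union_left subset_rfl)
      (fun {z y} hy {w} hw hx₀ => ?_) hy hw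
    simp only [Formula.fv] at hw
    rw [Finset.union_eq_left.2 hfv] at hw
    have upd : ∀ e, Function.update (s z ∘ w) ζ (s z e) = s z ∘ Function.update w ζ e := by
      intro e
      funext x
      by_cases hx : x = ζ
      · subst hx; simp
      · simp [hx]
    have hset : {d | d ∈ dom (starUnion B c s) ∧
          α.map (Function.update (s z ∘ w) ζ d) ∈ starUnion B c s ∧
          φ.Sat (starUnion B c s) (Function.update (s z ∘ w) ζ d)}
        = s z '' {e | e ∈ dom (B z) ∧ α.map (Function.update w ζ e) ∈ B z ∧
          φ.Sat (B z) (Function.update w ζ e)} := by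
      ext d
      constructor
      · rintro ⟨-, h2, h3⟩
        obtain ⟨y', hy', u, h5, h6, h7⟩ := toStar hα' hy (ys := {ζ}) hw
          (fun x hx => by rw [Finset.mem_singleton] at hx; simp [hx]) h2 hx₀
        have hu : u = Function.update w ζ (u ζ) := by
          funext x
          by_cases hx : x = ζ
          · subst hx; simp
          · rw [h5 x (by simpa using hx)]; simp [hx]
        have hd : s z (u ζ) = d := by simpa using (h6 ζ hζ).2
        refine ⟨u ζ, ⟨mem_dom_of_map_mem h7 hζ, hu ▸ h7, ?_⟩, hd⟩
        rw [← hu]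
        refine (ih hφ' hy' fun x hx => (h6 x (hfv hx)).1).1 ?_
        exact (Formula.Sat.congr_fv fun x hx => (h6 x (hfv hx)).2).2 h3
      · rintro ⟨e, ⟨-, h2, h3⟩, rfl⟩
        obtain ⟨x₀, hx₀, hx₀z⟩ := hx₀
        have hx₀' := Finset.mem_sdiff.1 hx₀
        have hne : x₀ ≠ ζ := by simpa using hx₀'.2
        obtain ⟨h5, y', hy', h6⟩ := ofStar hα' h2 ⟨x₀, hx₀'.1, by simp [hne, hx₀z]⟩
        rw [Set.mem_ofPred_eq, upd]
        refine ⟨?_, h5, (ih hφ' hy' fun x hx => h6 x (hfv hx)).2 h3⟩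
        have := mem_dom_of_map_mem h5 hζ
        simpa using this
    simp only [Formula.Sat]
    rw [hset, Set.InjOn.encard_image]
    refine (h.inj z).mono ?_
    rintro e ⟨-, h2, -⟩
    obtain ⟨x₀, hx₀, hx₀z⟩ := hx₀
    have hx₀' := Finset.mem_sdiff.1 hx₀
    have hne : x₀ ≠ ζ := by simpa using hx₀'.2
    refine ⟨_, h2, ?_, ?_⟩ <;> rw [Atom.elems_map]
    · exact ⟨x₀, Atom.mem_vars.1 hx₀'.1, by simp [hne, hx₀z]⟩
    · exact ⟨ζ, Atom.mem_vars.1 hζ, by simp⟩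

theorem holds (h : IsLocalCover Φ B c s) (hΦ : SubClosed Φ) (hG : ∀ φ ∈ Φ, φ.Guarded)
    (hbin : ∀ φ ∈ Φ, φ.rels ⊆ binarySymbols σ) {t : Sentence σ} (ht : t.body ∈ Φ)
    (hg : ∀ α, t.guard = .atom α → Formula.atom α ∈ Φ) (hfv : t.body.fv ⊆ t.guard.vars)
    (hB : ∀ z, t.Holds (B z)) : t.Holds (starUnion B c s) := by
  intro v hd hgv
  obtain ⟨g, φ⟩ := t
  cases g with
  | atom α =>
    have hα := hg α rfl
    obtain ⟨x₀, hx₀⟩ := α.vars_nonempty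
    obtain ⟨y, hy, hsub⟩ := h.exists_nbhd_of_mem (z := v x₀) hgv (hbin _ hα rfl)
      (by rw [Atom.elems_map]; exact ⟨x₀, Atom.mem_vars.1 hx₀, rfl⟩)
    rw [Atom.elems_map] at hsub
    classical
    set w : ℕ → W := fun x => if v x = v x₀ then c (v x₀) else y with hw
    have hw' : ∀ x ∈ α.vars, (w x = c (v x₀) ∨ w x = y) ∧ s (v x₀) (w x) = v x := by
      intro x hx
      by_cases e : v x = v x₀
      · simp [hw, e, h.center]
      · simp only [hw, e, if_false, or_true, true_and]
        exact ((hsub _ ⟨x, Atom.mem_vars.1 hx, rfl⟩).resolve_left e).symm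
    have hm : α.map w ∈ B (v x₀) := by
      rw [← h.atom_mem_iff hα hy fun x hx => (hw' x hx).1]
      rw [Atom.map_congr (f := s (v x₀) ∘ w) (g := v) fun x hx => (hw' x (Atom.mem_vars.2 hx)).2]
      exact hgv
    have hs := hB (v x₀) w
      (fun x hx => ⟨_, hm, by rw [Atom.elems_map]; exact ⟨x, Atom.mem_vars.1 hx, rfl⟩⟩) hm
    rw [← h.sat_iff hΦ hG hbin ht hy fun x hx => (hw' x (hfv hx)).1] at hs
    exact (Formula.Sat.congr_fv fun x hx => (hw' x (hfv hx)).2).1 hs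
  | eqSelf x₀ =>
    obtain ⟨α, hα, hx₀⟩ := hd x₀ (Finset.mem_singleton_self x₀)
    have hfv' : ∀ x ∈ φ.fv, x = x₀ := fun x hx => Finset.mem_singleton.1 (hfv hx)
    obtain ⟨y, hy⟩ : ∃ y, y ∈ nbhd B c (v x₀) := by
      obtain ⟨z, β, hβ, hc, rfl⟩ := hα
      rw [Atom.elems_map] at hx₀
      obtain ⟨b, hb, e⟩ := hx₀
      obtain ⟨y', hy', -⟩ := h.switch z b ⟨β, hβ, hc, hb⟩
      exact ⟨y', e ▸ hy'⟩
    have hc := center_mem_nbhd hy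
    obtain ⟨β, hβ, hcβ, -⟩ := hc
    have hs := hB (v x₀) (fun _ => c (v x₀)) (fun x _ => ⟨β, hβ, hcβ⟩) rfl
    rw [← h.sat_iff hΦ hG hbin ht hy fun x hx => Or.inl rfl] at hs
    refine (Formula.Sat.congr_fv fun x hx => ?_).1 hs
    rw [hfv' x hx]
    exact h.center _

end IsLocalCover

end LocalCover

/-! ### Types and the program of all sound rules -/

section Program

theorem finite_atoms {τ : Type*} [Vocab τ] {R : Set τ} (hR : R.Finite) (K : ℕ) :
    {α : Atom τ ℕ | α.rel ∈ R ∧ ∀ x ∈ α.elems, x < K}.Finite := by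
  have := hR.to_subtype
  refine (Set.finite_range fun p : Σ r : R, (Fin (Vocab.arity r.1) → Fin K) =>
    (⟨p.1.1, fun i => p.2 i⟩ : Atom τ ℕ)).subset ?_
  rintro ⟨r, a⟩ ⟨hr, ha⟩
  exact ⟨⟨⟨r, hr⟩, fun i => ⟨a i, ha _ ⟨i, rfl⟩⟩⟩, rfl⟩

theorem finite_nodup_lists {α : Type*} {L : Set α} (hL : L.Finite) :
    {l : List α | l.Nodup ∧ ∀ x ∈ l, x ∈ L}.Finite := by
  classical
  have h := (hL.toFinset.powerset.finite_toSet)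
  refine (h.biUnion (t := fun s => {l : List α | l.toFinset = s ∧ l.Nodup}) ?_).subset ?_
  · intro s _
    refine (s.val.lists.finite_toSet).subset ?_
    rintro l ⟨rfl, hl⟩
    simp only [Multiset.mem_lists_iff]
    rw [List.toFinset_val, List.dedup_eq_self.2 hl]
    rfl
  · rintro l ⟨hl, hx⟩
    simp only [Set.mem_iUnion]
    refine ⟨l.toFinset, ?_, rfl, hl⟩
    simp only [Finset.coe_powerset, Set.mem_preimage, Set.mem_powerset_iff]
    intro x hx'
    simp only [List.coe_toFinset] at hx'
    exact by simpa using hx x hx'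

variable {σ : Type*} [Vocab σ]

/-- The data that determine the predicates of the program: types are taken with respect to the
finite set `Φ` of formulas, whose free variables are less than `M`, and are assigned to tuples of
length `m + 1`, so that guarded sets of instances are covered by such tuples; the instances are over
the symbols in `S`, and the query `q` has arity `n + 1`. -/
structure Frame (σ : Type*) [Vocab σ] where
  O : Ontology σ
  Φ : Set (Formula σ)
  Φ_finite : Φ.Finite
  M : ℕ
  fv_lt : ∀ φ ∈ Φ, ∀ x ∈ φ.fv, x < M
  m : ℕ
  S : Set σ
  S_finite : S.Finite
  q : CQ σ
  n : ℕ
  arity_eq : q.arity = n + 1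

namespace Frame

variable (F : Frame σ) {W : Type*}

/-- A type prescribes, for tuples of length `m + 1`, which formulas of `Φ` are true under which
assignments of entries of the tuple to the variables. -/
abbrev Ty : Type _ := Set (F.Φ × (Fin F.M → Fin (F.m + 1)))

instance : Finite F.Φ := F.Φ_finite.to_subtype

/-- The type of the tuple `c` in `B`. -/
def typeOf (B : Set (Atom σ W)) (c : Fin (F.m + 1) → W) : F.Ty :=
  {p | p.1.1.Sat B fun x => c (if h : x < F.M then p.2 ⟨x, h⟩ else 0)}

variable {F}

theorem agree_of_typeOf_eq {C : Type*} {W' : Type*} {B : Set (Atom σ W)} {B' : Set (Atom σ W')}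
    {g : C → W} {g' : C → W'} {c : Fin (F.m + 1) → C}
    (h : F.typeOf B (g ∘ c) = F.typeOf B' (g' ∘ c)) {φ : Formula σ} (hφ : φ ∈ F.Φ) {v : ℕ → C}
    (hv : ∀ x ∈ φ.fv, v x ∈ Set.range c) : φ.Sat B (g ∘ v) ↔ φ.Sat B' (g' ∘ v) := by
  choose! u hu using hv
  have hp := Set.ext_iff.1 h (⟨φ, hφ⟩, fun i => u i)
  have hW : ∀ x ∈ φ.fv, (g ∘ c) (if h : x < F.M then u x else 0) = g (v x) := fun x hx => by
    simp [F.fv_lt φ hφ x hx, hu x hx]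
  have hW' : ∀ x ∈ φ.fv, (g' ∘ c) (if h : x < F.M then u x else 0) = g' (v x) := fun x hx => by
    simp [F.fv_lt φ hφ x hx, hu x hx]
  exact (Formula.Sat.congr_fv hW).symm.trans (hp.trans (Formula.Sat.congr_fv hW'))

theorem typeOf_eq_of_agree {C : Type*} {W' : Type*} {B : Set (Atom σ W)} {B' : Set (Atom σ W')}
    {g : C → W} {g' : C → W'} {c : Fin (F.m + 1) → C}
    (h : ∀ φ ∈ F.Φ, ∀ v : ℕ → C, (∀ x ∈ φ.fv, v x ∈ Set.range c) →
      (φ.Sat B (g ∘ v) ↔ φ.Sat B' (g' ∘ v))) :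
    F.typeOf B (g ∘ c) = F.typeOf B' (g' ∘ c) := by
  ext ⟨⟨φ, hφ⟩, u⟩
  exact h φ hφ (fun x => c (if h : x < F.M then u ⟨x, h⟩ else 0)) fun x hx => ⟨_, rfl⟩

variable (F)

theorem exists_encoding : ∃ e : Set F.Ty → ℕ, Function.Injective e :=
  Countable.exists_injective_nat _

/-- The intensional predicate for a set `Θ` of types: it holds of tuples whose type is known to
belong to `Θ`. -/
noncomputable def pred (Θ : Set F.Ty) : IDB := ⟨F.exists_encoding.choose Θ + 1, F.m⟩

/-- The goal predicate. -/
def goal : IDB := ⟨0, F.n⟩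

/-- The fact that the type of the tuple `c` belongs to `Θ`. -/
noncomputable def predAtom {U : Type*} (Θ : Set F.Ty) (c : Fin (F.m + 1) → U) : Atom IDB U :=
  ⟨F.pred Θ, c⟩

/-- The fact that `a` is an answer. -/
def goalAtom {U : Type*} (a : Fin (F.n + 1) → U) : Atom IDB U := ⟨F.goal, a⟩

/-- The intended meaning of the intensional predicates in `B`. -/
def expansion (B : Set (Atom σ W)) : Set (Atom (σ ⊕ IDB) W) :=
  {γ | (∃ β ∈ B, γ = β.edb) ∨
    (∃ Θ c, Set.range c ⊆ dom B ∧ F.typeOf B c ∈ Θ ∧ γ = (F.predAtom Θ c).idb) ∨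
    ∃ a, Set.range a ⊆ dom B ∧ F.q.Answer B (fun i => a (Fin.cast F.arity_eq i)) ∧
      γ = (F.goalAtom a).idb}

theorem _root_.OMQ.Atom.edb_injective {U : Type*} :
    Function.Injective (Atom.edb : Atom σ U → Atom (σ ⊕ IDB) U) := by
  rintro ⟨r, a⟩ ⟨s, b⟩ h
  simp only [Atom.edb, Atom.mk.injEq, Sum.inl.injEq] at h
  obtain ⟨rfl, h⟩ := h
  rw [eq_of_heq h]

theorem _root_.OMQ.Atom.idb_injective {U : Type*} :
    Function.Injective (Atom.idb : Atom IDB U → Atom (σ ⊕ IDB) U) := by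
  rintro ⟨r, a⟩ ⟨s, b⟩ h
  simp only [Atom.idb, Atom.mk.injEq, Sum.inr.injEq] at h
  obtain ⟨rfl, h⟩ := h
  rw [eq_of_heq h]

theorem _root_.OMQ.Atom.edb_ne_idb {U : Type*} (α : Atom σ U) (β : Atom IDB U) :
    α.edb ≠ β.idb := fun h => by
  have := congrArg Atom.rel h
  simp [Atom.edb, Atom.idb] at this

theorem pred_injective : Function.Injective F.pred := fun Θ Θ' h => by
  simp only [pred, IDB.mk.injEq, add_left_inj, and_true] at h
  exact F.exists_encoding.choose_spec h

theorem pred_ne_goal (Θ : Set F.Ty) : F.pred Θ ≠ F.goal := fun h => by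
  simp [pred, goal] at h

variable {F}

theorem edb_mem_expansion {B : Set (Atom σ W)} {β : Atom σ W} :
    β.edb ∈ F.expansion B ↔ β ∈ B := by
  constructor
  · rintro (⟨β', h, e⟩ | ⟨Θ, c, -, -, e⟩ | ⟨a, -, -, e⟩)
    · rwa [Atom.edb_injective e]
    · exact (Atom.edb_ne_idb _ _ e).elim
    · exact (Atom.edb_ne_idb _ _ e).elim
  · exact fun h => Or.inl ⟨β, h, rfl⟩

theorem predAtom_mem_expansion {B : Set (Atom σ W)} {Θ : Set F.Ty} {c : Fin (F.m + 1) → W} :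
    (F.predAtom Θ c).idb ∈ F.expansion B ↔ Set.range c ⊆ dom B ∧ F.typeOf B c ∈ Θ := by
  constructor
  · rintro (⟨β', h, e⟩ | ⟨Θ', c', h1, h2, e⟩ | ⟨a, -, -, e⟩)
    · exact (Atom.edb_ne_idb _ _ e.symm).elim
    · have e' := Atom.idb_injective e
      have hr : F.pred Θ = F.pred Θ' := congrArg Atom.rel e'
      obtain rfl := F.pred_injective hr
      obtain rfl : c = c' := eq_of_heq (Atom.mk.inj e').2
      exact ⟨h1, h2⟩
    · exact (F.pred_ne_goal Θ (congrArg Atom.rel (Atom.idb_injective e))).elim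
  · exact fun h => Or.inr (Or.inl ⟨Θ, c, h.1, h.2, rfl⟩)

theorem goalAtom_mem_expansion {B : Set (Atom σ W)} {a : Fin (F.n + 1) → W} :
    (F.goalAtom a).idb ∈ F.expansion B ↔
      Set.range a ⊆ dom B ∧ F.q.Answer B (fun i => a (Fin.cast F.arity_eq i)) := by
  constructor
  · rintro (⟨β', h, e⟩ | ⟨Θ', c', h1, h2, e⟩ | ⟨a', h1, h2, e⟩)
    · exact (Atom.edb_ne_idb _ _ e.symm).elim
    · exact (F.pred_ne_goal Θ' (congrArg Atom.rel (Atom.idb_injective e)).symm).elim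
    · have e' := Atom.idb_injective e
      obtain rfl : a = a' := eq_of_heq (Atom.mk.inj e').2
      exact ⟨h1, h2⟩
  · exact fun h => Or.inr (Or.inr ⟨a, h.1, h.2, rfl⟩)

theorem dom_expansion (B : Set (Atom σ W)) : dom (F.expansion B) = dom B := by
  apply Set.Subset.antisymm
  · rintro x ⟨γ, ⟨β, h, rfl⟩ | ⟨Θ, c, h, -, rfl⟩ | ⟨a, h, -, rfl⟩, hx⟩
    · exact ⟨β, h, hx⟩
    · exact h hx
    · exact h hx
  · rintro x ⟨β, h, hx⟩
    exact ⟨β.edb, edb_mem_expansion.2 h, hx⟩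

variable (F)

/-- The intensional predicates of the program. -/
def heads : Set IDB := insert F.goal (Set.range F.pred)

theorem heads_finite : F.heads.Finite := (Set.finite_range _).insert _

/-- The literals with variables less than `K` that may occur in rule bodies. -/
def literals (neq : Prop) (K : ℕ) : Set (Literal σ) :=
  (Literal.atom '' {α | α.rel ∈ Sum.inl '' F.S ∪ Sum.inr '' Set.range F.pred ∧
    ∀ x ∈ α.elems, x < K}) ∪
  {l | neq ∧ ∃ x < K, ∃ y < K, l = .neq x y}

theorem literals_finite (neq : Prop) (K : ℕ) : (F.literals neq K).Finite := by
  refine Set.Finite.union ?_ ?_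
  · exact (finite_atoms ((F.S_finite.image _).union ((Set.finite_range _).image _)) K).image _
  · refine (((Set.finite_lt_nat K).prod (Set.finite_lt_nat K)).image
      fun p : ℕ × ℕ => (Literal.neq p.1 p.2 : Literal σ)).subset ?_
    rintro l ⟨-, x, hx, y, hy, rfl⟩
    exact ⟨(x, y), ⟨hx, hy⟩, rfl⟩

/-- A rule is sound if it holds in the intended expansions of all models of the ontology. -/
def SoundRule (W : Type*) (ρ : Rule σ) : Prop :=
  ∀ B : Set (Atom σ W), (∀ s ∈ F.O, s.Holds B) → ∀ v : ℕ → W, (∀ x, v x ∈ dom B) →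
    (∀ l ∈ ρ.body, l.Sat (F.expansion B) v) → (ρ.head.map v).idb ∈ F.expansion B

/-- The sound rules over the symbols in `S`, the intensional predicates and the variables less than
`K`; repeated literals in bodies are excluded to make this a finite set. -/
def soundRules (W : Type*) (neq : Prop) (K : ℕ) : Set (Rule σ) :=
  {ρ | (ρ.head.rel ∈ F.heads ∧ ∀ x ∈ ρ.head.elems, x < K) ∧
    (ρ.body.Nodup ∧ ∀ l ∈ ρ.body, l ∈ F.literals neq K) ∧ F.SoundRule W ρ}

theorem soundRules_finite (W : Type*) (neq : Prop) (K : ℕ) : (F.soundRules W neq K).Finite := by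
  have h := (finite_atoms F.heads_finite K).prod
    (finite_nodup_lists (F.literals_finite neq K))
  refine Set.Finite.of_finite_image (f := fun ρ : Rule σ => (ρ.head, ρ.body)) (h.subset ?_) ?_
  · rintro _ ⟨ρ, hρ, rfl⟩
    exact ⟨hρ.1, hρ.2.1⟩
  · rintro ⟨h, b, _, _, _⟩ _ ⟨h', b', _, _, _⟩ _ e
    simp only [Prod.mk.injEq] at e
    obtain ⟨rfl, rfl⟩ := e
    rfl

/-- The program of all sound rules with at most `K` variables; inequalities are admitted in case
`neq`. -/
noncomputable def program (W : Type*) (neq : Prop) (K : ℕ) : Program σ where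
  rules := (F.soundRules_finite W neq K).toFinset
  goal := F.goal
  goal_not_body := by
    intro ρ hρ α hα e
    rw [Set.Finite.mem_toFinset] at hρ
    rcases hρ.2.1.2 _ hα with ⟨α', ⟨h, -⟩, e'⟩ | ⟨-, x, -, y, -, e'⟩
    · simp only [Literal.atom.injEq] at e'
      subst e'
      rw [e] at h
      rcases h with ⟨r, -, h⟩ | ⟨_, ⟨Θ, rfl⟩, h⟩
      · exact Sum.inl_ne_inr h
      · exact F.pred_ne_goal Θ (Sum.inr_injective h)
    · cases e'

theorem program_neqFree (W : Type*) (K : ℕ) : (F.program W False K).NeqFree := by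
  intro ρ hρ x y hxy
  rw [program, Set.Finite.mem_toFinset] at hρ
  rcases hρ.2.1.2 _ hxy with ⟨α', -, e'⟩ | ⟨h, -⟩
  · cases e'
  · exact h

theorem certain_of_derives {C N : Type*} {neq : Prop} {K : ℕ} {D : Set (Atom σ C)}
    {a : Fin F.q.arity → C}
    (h : (F.program (C ⊕ N) neq K).Derives N D (fun i => a (Fin.cast F.arity_eq.symm i))) :
    Certain N F.O D F.q a := by
  intro B hB hD hO
  have hmem := h (F.expansion B) ⟨?_, ?_⟩ ?_ ?_
  · exact (goalAtom_mem_expansion.1 hmem).2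
  · obtain ⟨β, hβ⟩ := hB.1
    exact ⟨_, edb_mem_expansion.2 hβ⟩
  · refine ((hB.2.image Sum.inl).union (F.heads_finite.image Sum.inr)).subset ?_
    rintro _ ⟨_, ⟨β, hβ, rfl⟩ | ⟨Θ, c, -, -, rfl⟩ | ⟨a, -, -, rfl⟩, rfl⟩
    · exact Or.inl ⟨β.rel, ⟨β, hβ, rfl⟩, rfl⟩
    · exact Or.inr ⟨_, Or.inr ⟨Θ, rfl⟩, rfl⟩
    · exact Or.inr ⟨_, Or.inl rfl, rfl⟩
  · rintro _ ⟨α, hα, rfl⟩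
    exact edb_mem_expansion.2 (hD ⟨α, hα, rfl⟩)
  · intro ρ hρ v hv hl
    rw [program, Set.Finite.mem_toFinset] at hρ
    rw [dom_expansion] at hv
    exact hρ.2.2 B hO v hv hl

/-! ### What a model of the program without the goal fact tells about the instance -/

variable {C N : Type*}

/-- The map `g` into `B` is compatible with the facts about tuples over `G` in `A`, a set of facts
that was derived by the program. -/
def Live (A : Set (Atom (σ ⊕ IDB) (C ⊕ N))) (B : Set (Atom σ W)) (g : C → W) (G : Set C) : Prop :=
  ∀ c : Fin (F.m + 1) → C, Set.range c ⊆ G → ∀ Θ,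
    (F.predAtom Θ fun i => (Sum.inl (c i) : C ⊕ N)).idb ∈ A → F.typeOf B (g ∘ c) ∈ Θ

/-- The map `g` represents the part of `D` over `G` in the model `B` of the ontology, in a way that
is compatible with the derived facts in `A`. -/
structure Realizes (neq : Prop) (D : Set (Atom σ C)) (A : Set (Atom (σ ⊕ IDB) (C ⊕ N)))
    (G : Set C) (B : Set (Atom σ W)) (g : C → W) : Prop where
  holds : ∀ s ∈ F.O, s.Holds B
  mem_dom : ∀ x ∈ G, g x ∈ dom B
  inj : neq → Set.InjOn g G
  facts : ∀ α ∈ D, α.elems ⊆ G → α.map g ∈ B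
  live : F.Live A B g G

/-- Agreement of `g` and `g'` on the truth of the formulas in `Φ` at tuples over `G`. -/
def Agree {W' : Type*} (B : Set (Atom σ W)) (g : C → W) (B' : Set (Atom σ W')) (g' : C → W')
    (G : Set C) : Prop :=
  ∀ φ ∈ F.Φ, ∀ v : ℕ → C, (∀ x ∈ φ.fv, v x ∈ G) → (φ.Sat B (g ∘ v) ↔ φ.Sat B' (g' ∘ v))

variable {F}

theorem Live.mono {A : Set (Atom (σ ⊕ IDB) (C ⊕ N))} {B : Set (Atom σ W)} {g : C → W}
    {G G' : Set C} (h : F.Live A B g G) (hG : G' ⊆ G) : F.Live A B g G' :=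
  fun c hc => h c (hc.trans hG)

theorem Realizes.mono {neq : Prop} {D : Set (Atom σ C)} {A : Set (Atom (σ ⊕ IDB) (C ⊕ N))}
    {G G' : Set C} {B : Set (Atom σ W)} {g : C → W} (h : F.Realizes neq D A G B g)
    (hG : G' ⊆ G) : F.Realizes neq D A G' B g :=
  ⟨h.holds, fun x hx => h.mem_dom x (hG hx), fun hn => (h.inj hn).mono hG,
    fun α hα hαG => h.facts α hα (hαG.trans hG), h.live.mono hG⟩

/-- A fact over a small set `G` of constants is derived as soon as it holds under all realizations
of `G`: the rule whose body consists of everything known about `G` is sound. -/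
theorem mem_of_realizes {neq : Prop} {K : ℕ} {D : Set (Atom σ C)} (hDS : sig D ⊆ F.S)
    {A : Set (Atom (σ ⊕ IDB) (C ⊕ N))} (hDA : (fun α => (Atom.map Sum.inl α).edb) '' D ⊆ A)
    (hA : (F.program (C ⊕ N) neq K).IsModel A) {G : Set C} (hfin : G.Finite) (hne : G.Nonempty)
    (hcard : G.ncard ≤ K)
    (hcov : ∀ x ∈ G, (∃ α ∈ D, x ∈ α.elems ∧ α.elems ⊆ G) ∨
      ∃ (c : Fin (F.m + 1) → C) (Θ : Set F.Ty),
        (F.predAtom Θ fun i => (Sum.inl (c i) : C ⊕ N)).idb ∈ A ∧ x ∈ Set.range c ∧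
          Set.range c ⊆ G)
    {h : Atom IDB C} (hrel : h.rel ∈ F.heads) (hG : h.elems ⊆ G)
    (hreal : ∀ (B : Set (Atom σ (C ⊕ N))) (g : C → C ⊕ N), F.Realizes neq D A G B g →
      (h.map g).idb ∈ F.expansion B) :
    (h.map (Sum.inl : C → C ⊕ N)).idb ∈ A := by
  classical
  obtain ⟨ι, hιK, hι⟩ : ∃ ι : C → ℕ, (∀ x ∈ G, ι x < K) ∧ Set.InjOn ι G := by
    have := hfin.to_subtype
    have : Fintype G := Fintype.ofFinite G
    have e := Fintype.equivFin G
    rw [← Nat.card_eq_fintype_card, Nat.card_coe_set_eq] at e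
    refine ⟨fun x => if hx : x ∈ G then e ⟨x, hx⟩ else 0, fun x hx => ?_, fun x hx y hy hxy => ?_⟩
    · simp only [hx, dif_pos]
      exact (e ⟨x, hx⟩).2.trans_le hcard
    · simp only [hx, hy, dif_pos] at hxy
      simpa using e.injective (Fin.ext hxy)
  obtain ⟨x₀, hx₀⟩ := hne
  obtain ⟨v, hv, hvG⟩ : ∃ v : ℕ → C ⊕ N, (∀ x ∈ G, v (ι x) = Sum.inl x) ∧
      ∀ n, ∃ x ∈ G, v n = Sum.inl x := by
    refine ⟨fun n => if hn : ∃ x ∈ G, ι x = n then Sum.inl hn.choose else Sum.inl x₀,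
      fun x hx => ?_, fun n => ?_⟩
    · have hn : ∃ y ∈ G, ι y = ι x := ⟨x, hx, rfl⟩
      simp only [dif_pos hn]
      rw [hι hn.choose_spec.1 hx hn.choose_spec.2]
    · by_cases hn : ∃ y ∈ G, ι y = n
      · exact ⟨_, hn.choose_spec.1, by simp only [dif_pos hn]⟩
      · exact ⟨x₀, hx₀, by simp only [dif_neg hn]⟩
  have hDmem : ∀ α ∈ D, α.elems ⊆ G → ((α.map ι).edb.map v : Atom (σ ⊕ IDB) (C ⊕ N)) ∈ A := by
    intro α hα hαG
    have : (α.map ι).map v = α.map Sum.inl := by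
      rw [Atom.map_map]; exact Atom.map_congr fun x hx => hv x (hαG hx)
    have h2 : (α.map ι).edb.map v = ((α.map ι).map v).edb := rfl
    rw [h2, this]
    exact hDA ⟨α, hα, rfl⟩
  have hPmem : ∀ (c : Fin (F.m + 1) → C) (Θ : Set F.Ty), Set.range c ⊆ G →
      (F.predAtom Θ fun i => (Sum.inl (c i) : C ⊕ N)).idb ∈ A →
      ((F.predAtom Θ (ι ∘ c)).idb.map v : Atom (σ ⊕ IDB) (C ⊕ N)) ∈ A := by
    intro c Θ hc hA
    have h2 : ((F.predAtom Θ (ι ∘ c)).idb.map v : Atom (σ ⊕ IDB) (C ⊕ N)) =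
      (F.predAtom Θ (v ∘ ι ∘ c)).idb := rfl
    rw [h2]
    have : v ∘ ι ∘ c = fun i => Sum.inl (c i) := funext fun i => hv _ (hc ⟨i, rfl⟩)
    rwa [this]
  -- the body: all admissible literals over `G` that are true in `A`
  let vars : Literal σ → Set ℕ := fun l => match l with
    | .atom α => α.elems
    | .neq x y => {x, y}
  let body : List (Literal σ) :=
    ((F.literals_finite neq K).toFinset.filter fun l => l.Sat A v ∧ vars l ⊆ ι '' G).toList
  have hbody : ∀ l, l ∈ body ↔ l ∈ F.literals neq K ∧ l.Sat A v ∧ vars l ⊆ ι '' G := by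
    intro l
    simp [body]
  have hDbody : ∀ α ∈ D, α.elems ⊆ G → Literal.atom (α.map ι).edb ∈ body := by
    intro α hα hαG
    refine (hbody _).2 ⟨Or.inl ⟨_, ⟨Or.inl ⟨α.rel, hDS ⟨α, hα, rfl⟩, rfl⟩, ?_⟩, rfl⟩,
      hDmem α hα hαG, ?_⟩
    · rintro _ ⟨i, rfl⟩
      exact hιK _ (hαG ⟨i, rfl⟩)
    · rintro _ ⟨i, rfl⟩
      exact ⟨_, hαG ⟨i, rfl⟩, rfl⟩
  have hPbody : ∀ (c : Fin (F.m + 1) → C) (Θ : Set F.Ty), Set.range c ⊆ G →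
      (F.predAtom Θ fun i => (Sum.inl (c i) : C ⊕ N)).idb ∈ A →
      Literal.atom (F.predAtom Θ (ι ∘ c)).idb ∈ body := by
    intro c Θ hc hcA
    refine (hbody _).2 ⟨Or.inl ⟨_, ⟨Or.inr ⟨_, ⟨Θ, rfl⟩, rfl⟩, ?_⟩, rfl⟩, hPmem c Θ hc hcA, ?_⟩
    · rintro _ ⟨i, rfl⟩
      exact hιK _ (hc ⟨i, rfl⟩)
    · rintro _ ⟨i, rfl⟩
      exact ⟨_, hc ⟨i, rfl⟩, rfl⟩
  have hcov' : ∀ x ∈ G, ∃ α, Literal.atom α ∈ body ∧ ι x ∈ α.vars := by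
    intro x hx
    rcases hcov x hx with ⟨α, hα, hxα, hαG⟩ | ⟨c, Θ, hcA, ⟨i, hi⟩, hcG⟩
    · refine ⟨_, hDbody α hα hαG, Atom.mem_vars.2 ?_⟩
      obtain ⟨i, rfl⟩ := hxα
      exact ⟨i, rfl⟩
    · refine ⟨_, hPbody c Θ hcG hcA, Atom.mem_vars.2 ?_⟩
      exact ⟨i, by rw [← hi]; rfl⟩
  let ρ : Rule σ :=
    { head := h.map ι
      body := body
      body_ne := by
        obtain ⟨α, hα, -⟩ := hcov' x₀ hx₀
        exact List.ne_nil_of_mem hα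
      safe_head := by
        intro x hx
        rw [Atom.mem_vars, Atom.elems_map] at hx
        obtain ⟨y, hy, rfl⟩ := hx
        exact hcov' y (hG hy)
      safe_neq := by
        intro x y hxy
        have hsub := ((hbody _).1 hxy).2.2
        obtain ⟨x', hx', rfl⟩ : x ∈ ι '' G := hsub (Set.mem_insert _ _)
        obtain ⟨y', hy', rfl⟩ : y ∈ ι '' G := hsub (Set.mem_insert_of_mem _ rfl)
        exact ⟨hcov' x' hx', hcov' y' hy'⟩ }
  have hsound : F.SoundRule (C ⊕ N) ρ := by
    intro B hB w hw hl
    have hreal' := hreal B (w ∘ ι) ⟨hB, fun x _ => hw _, ?_, ?_, ?_⟩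
    · exact hreal'
    · intro hn x hx y hy hxy
      by_contra hne
      have hmem : Literal.neq (ι x) (ι y) ∈ body := by
        refine (hbody _).2 ⟨Or.inr ⟨hn, _, hιK x hx, _, hιK y hy, rfl⟩, ?_, ?_⟩
        · change v (ι x) ≠ v (ι y)
          rw [hv x hx, hv y hy]
          exact fun e => hne (Sum.inl_injective e)
        · rintro _ (rfl | rfl)
          exacts [⟨x, hx, rfl⟩, ⟨y, hy, rfl⟩]
      exact hl _ hmem hxy
    · intro α hα hαG
      exact edb_mem_expansion.1 (hl _ (hDbody α hα hαG))
    · intro c hc Θ hcA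
      exact (predAtom_mem_expansion.1 (hl _ (hPbody c Θ hc hcA))).2
  have hρ : ρ ∈ (F.program (C ⊕ N) neq K).rules := by
    rw [program, Set.Finite.mem_toFinset]
    refine ⟨⟨hrel, ?_⟩, ⟨Finset.nodup_toList _, fun l hl => ((hbody l).1 hl).1⟩, hsound⟩
    intro x hx
    rw [Atom.elems_map] at hx
    obtain ⟨y, hy, rfl⟩ := hx
    exact hιK y (hG hy)
  have hdomG : ∀ x ∈ G, (Sum.inl x : C ⊕ N) ∈ dom A := by
    intro x hx
    obtain ⟨α, hα, hxα⟩ := hcov' x hx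
    refine ⟨α.map v, ((hbody _).1 hα).2.1, ?_⟩
    rw [Atom.elems_map]
    exact ⟨ι x, Atom.mem_vars.1 hxα, hv x hx⟩
  have := hA ρ hρ v (fun n => ?_) fun l hl => ((hbody l).1 hl).2.1
  · have e : (h.map ι).map v = h.map Sum.inl := by
      rw [Atom.map_map]; exact Atom.map_congr fun x hx => hv x (hG hx)
    rw [← e]
    exact this
  · obtain ⟨x, hx, e⟩ := hvG n
    rw [e]
    exact hdomG x hx

end Frame

end Program

/-! ### Realizations of types that the program does not exclude -/

section Completeness

variable {σ : Type*} [Vocab σ] {C N W : Type*}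

theorem exists_tuple {X : Type*} {G : Set X} (hG : G.Finite) (hne : G.Nonempty) {k : ℕ}
    (hk : G.ncard ≤ k + 1) : ∃ c : Fin (k + 1) → X, Set.range c = G := by
  have := hG.to_subtype
  have : Nonempty G := hne.to_subtype
  have : Fintype G := Fintype.ofFinite G
  obtain ⟨e⟩ : Nonempty (G ↪ Fin (k + 1)) := by
    apply Function.Embedding.nonempty_of_card_le
    rwa [Fintype.card_fin, ← Nat.card_eq_fintype_card, Nat.card_coe_set_eq]
  refine ⟨fun i => (Function.invFun e i : G), ?_⟩
  have hs := Function.invFun_surjective e.injective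
  ext x
  constructor
  · rintro ⟨i, rfl⟩
    exact Subtype.mem _
  · intro hx
    obtain ⟨i, hi⟩ := hs ⟨x, hx⟩
    exact ⟨i, by simp only [hi]⟩

theorem isGuarded_finite_setOf {D : Set (Atom σ C)} (hD : D.Finite) :
    {G | IsGuarded D G}.Finite := by
  have hdom : (dom D).Finite := by
    have : dom D = ⋃ α ∈ D, α.elems := by ext; simp [dom]
    rw [this]
    exact hD.biUnion fun α _ => α.elems_finite
  refine ((hdom.image fun a => {a}).union (hD.image Atom.elems)).subset ?_
  rintro G (⟨a, ha, rfl⟩ | ⟨α, hα, rfl⟩)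
  exacts [Or.inl ⟨a, ha, rfl⟩, Or.inr ⟨α, hα, rfl⟩]

theorem dom_finite {D : Set (Atom σ C)} (hD : D.Finite) : (dom D).Finite := by
  have : dom D = ⋃ α ∈ D, α.elems := by ext; simp [dom]
  rw [this]
  exact hD.biUnion fun α _ => α.elems_finite

theorem IsGuarded.exists_isMaxGuarded {D : Set (Atom σ C)} (hD : D.Finite) {G : Set C}
    (hG : IsGuarded D G) : ∃ G', G ⊆ G' ∧ IsMaxGuarded D G' :=
  (isGuarded_finite_setOf hD).exists_le_maximal hG

theorem IsMaxGuarded.exists_atom {D : Set (Atom σ C)} {G : Set C} (hG : IsMaxGuarded D G) :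
    ∃ α ∈ D, G = α.elems := by
  rcases hG.prop with ⟨a, ⟨α, hα, ha⟩, rfl⟩ | h
  · exact ⟨α, hα, hG.eq_of_le (Or.inr ⟨α, hα, rfl⟩) (Set.singleton_subset_iff.2 ha)⟩
  · exact h

theorem Atom.ncard_elems_le (α : Atom σ C) : α.elems.ncard ≤ Vocab.arity α.rel := by
  have := Set.ncard_image_le (f := α.args) (s := Set.univ) Set.finite_univ
  rwa [Set.image_univ, Set.ncard_univ, Nat.card_fin] at this

namespace Frame

variable {F : Frame σ}

/-- `A` is a model of the instance `D` and of the program of all sound rules with at most `K`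
variables, where `K` is large enough. -/
structure IsClosed (F : Frame σ) (neq : Prop) (K : ℕ) (D : Set (Atom σ C))
    (A : Set (Atom (σ ⊕ IDB) (C ⊕ N))) : Prop where
  sig_subset : sig D ⊆ F.S
  facts : (fun α => (Atom.map Sum.inl α).edb) '' D ⊆ A
  model : (F.program (C ⊕ N) neq K).IsModel A
  arity_le : ∀ r ∈ F.S, Vocab.arity r ≤ F.m + 1
  card_le : F.m + 1 + (F.n + 1) ≤ K

variable {neq : Prop} {K : ℕ} {D : Set (Atom σ C)} {A : Set (Atom (σ ⊕ IDB) (C ⊕ N))}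

namespace IsClosed

theorem ncard_le (h : F.IsClosed neq K D A) {G : Set C} (hG : IsMaxGuarded D G) :
    G.ncard ≤ F.m + 1 := by
  obtain ⟨α, hα, rfl⟩ := hG.exists_atom
  exact α.ncard_elems_le.trans (h.arity_le _ (h.sig_subset ⟨α, hα, rfl⟩))

theorem univ_mem (h : F.IsClosed neq K D A) {x : C} (hx : x ∈ dom D) :
    (F.predAtom Set.univ fun _ => (Sum.inl x : C ⊕ N)).idb ∈ A := by
  obtain ⟨α, hα, hx⟩ := hx
  have hcard : α.elems.ncard ≤ K := by
    have := α.ncard_elems_le.trans (h.arity_le _ (h.sig_subset ⟨α, hα, rfl⟩))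
    have := h.card_le
    omega
  refine mem_of_realizes h.sig_subset h.facts h.model α.elems_finite α.elems_nonempty hcard
    (fun y hy => Or.inl ⟨α, hα, hy, subset_rfl⟩) (h := F.predAtom Set.univ fun _ => x)
    (Or.inr ⟨_, rfl⟩) ?_ ?_
  · rintro _ ⟨_, rfl⟩
    exact hx
  · intro B g hB
    refine predAtom_mem_expansion.2 ⟨?_, trivial⟩
    rintro _ ⟨_, rfl⟩
    exact hB.mem_dom x hx

theorem mem_of_realizes (h : F.IsClosed neq K D A) {G : Set C} (hfin : G.Finite)
    (hne : G.Nonempty) (hcard : G.ncard ≤ K) (hD : G ⊆ dom D) {γ : Atom IDB C}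
    (hrel : γ.rel ∈ F.heads) (hG : γ.elems ⊆ G)
    (hreal : ∀ (B : Set (Atom σ (C ⊕ N))) (g : C → C ⊕ N), F.Realizes neq D A G B g →
      (γ.map g).idb ∈ F.expansion B) : (γ.map (Sum.inl : C → C ⊕ N)).idb ∈ A :=
  Frame.mem_of_realizes h.sig_subset h.facts h.model hfin hne hcard
    (fun x hx => Or.inr ⟨fun _ => x, Set.univ, h.univ_mem (hD hx), ⟨0, rfl⟩, by
      rintro _ ⟨_, rfl⟩; exact hx⟩) hrel hG hreal

/-- A type that is compatible with everything derived is realized, together with its surroundings in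
the instance, by a model of the ontology: otherwise it would have been excluded by a sound rule. -/
theorem exists_realizes (h : F.IsClosed neq K D A) {B : Set (Atom σ W)} {g : C → W}
    {G G' : Set C} (hlive : F.Live A B g G) (hne : G.Nonempty) (hcard : G.ncard ≤ F.m + 1)
    (hGG' : G ⊆ G') (hfin : G'.Finite) (hcard' : G'.ncard ≤ K) (hD : G' ⊆ dom D) :
    ∃ (B' : Set (Atom σ (C ⊕ N))) (g' : C → C ⊕ N),
      F.Realizes neq D A G' B' g' ∧ F.Agree B g B' g' G := by
  obtain ⟨c, hc⟩ := exists_tuple (hfin.subset hGG') hne hcard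
  by_contra hcon
  push Not at hcon
  have hmem := h.mem_of_realizes hfin (hne.mono hGG') hcard' hD
    (γ := F.predAtom {F.typeOf B (g ∘ c)}ᶜ c) (Or.inr ⟨_, rfl⟩)
    (by change Set.range c ⊆ G'; rwa [hc]) fun B' g' hB' => by
      refine predAtom_mem_expansion.2 ⟨?_, fun e => hcon B' g' hB' fun φ hφ v hv => ?_⟩
      · rintro _ ⟨i, rfl⟩
        exact hB'.mem_dom _ (hGG' (hc.subset ⟨i, rfl⟩))
      · have e' : F.typeOf B' (g' ∘ c) = F.typeOf B (g ∘ c) := e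
        exact agree_of_typeOf_eq e'.symm hφ fun x hx => hc ▸ hv x hx
  exact hlive c hc.subset _ hmem rfl

theorem exists_realizes_of_goal_notMem (h : F.IsClosed neq K D A) {a : Fin (F.n + 1) → C}
    (ha : (F.goalAtom fun i => (Sum.inl (a i) : C ⊕ N)).idb ∉ A) {G : Set C} (haG : Set.range a ⊆ G)
    (hfin : G.Finite) (hcard : G.ncard ≤ K) (hD : G ⊆ dom D) :
    ∃ (B : Set (Atom σ (C ⊕ N))) (g : C → C ⊕ N), F.Realizes neq D A G B g ∧
      ¬ F.q.Answer B (fun i => g (a (Fin.cast F.arity_eq i))) := by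
  by_contra hcon
  push Not at hcon
  refine ha (h.mem_of_realizes hfin ⟨_, haG ⟨0, rfl⟩⟩ hcard hD (γ := F.goalAtom a)
    (Or.inl rfl) haG fun B g hB => goalAtom_mem_expansion.2 ⟨?_, hcon B g hB⟩)
  rintro _ ⟨i, rfl⟩
  exact hB.mem_dom _ (haG ⟨i, rfl⟩)

end IsClosed

variable (F)

/-- The unravelling has a model in which the root bag for `G` looks like any prescribed realization
of `G`. -/
def HasModels (C N : Type*) (neq : Prop) (K : ℕ) (cond : Set C → Set C → Set C → Prop) : Prop :=
  ∀ (D : Set (Atom σ C)) (A : Set (Atom (σ ⊕ IDB) (C ⊕ N))), IsInstance D →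
    F.IsClosed neq K D A →
    (∀ G, IsMaxGuarded D G →
      ∃ (B : Set (Atom σ (C ⊕ N))) (g : C → C ⊕ N), F.Realizes neq D A G B g) →
    ∀ G, IsMaxGuarded D G → ∀ (B : Set (Atom σ (C ⊕ N))) (g : C → C ⊕ N),
      F.Realizes neq D A G B g →
      ∃ A' : Set (Atom σ (Copy C ⊕ N)), IsInterp A' ∧
        Atom.map Sum.inl '' unravelling cond D ⊆ A' ∧ (∀ s ∈ F.O, s.Holds A') ∧
        F.Agree B g A' (fun d => (Sum.inl (copyAt [G] d) : Copy C ⊕ N)) G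

/-- In a model of the instance, sets of constants that are not contained in a fact can be made to be
not contained in an atom over the symbols in `V`. -/
def HasUnguardedModels (C N : Type*) (V : Set σ) : Prop :=
  ∀ (D : Set (Atom σ C)), IsInstance D → sig D ⊆ V → ∀ G : Set C, G ⊆ dom D →
    (∀ α ∈ D, ¬ G ⊆ α.elems) → ∀ B : Set (Atom σ (C ⊕ N)), IsInterp B →
      Atom.map Sum.inl '' D ⊆ B → (∀ s ∈ F.O, s.Holds B) →
      ∃ B' : Set (Atom σ (C ⊕ N)), IsInterp B' ∧ Atom.map Sum.inl '' D ⊆ B' ∧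
        (∀ s ∈ F.O, s.Holds B') ∧ ∀ β ∈ B', β.rel ∈ V → ¬ Sum.inl '' G ⊆ β.elems

end Frame

end Completeness

/-! ### From models of unravellings to rewritings -/

section Rewriting

universe u v

variable {σ : Type w} [Vocab σ] {C : Type u} {N : Type v}

/-- If the models that are needed exist, the program of all sound rules is a rewriting. In case the
goal fact is not derived, a model of the unravelling without the query answer contradicts tolerance,
which applies after the query was extended to a maximal guarded set. Tuples that are not guarded are
answers over inconsistent instances only; then also the unravelling is inconsistent, as one sees
from a query with a symbol that does not occur elsewhere. -/
theorem Frame.rewrites (hσ : ∀ k : ℕ, 1 ≤ k → {r : σ | Vocab.arity r = k}.Infinite)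
    {F : Frame σ} {neq : Prop} {K : ℕ} {cond : Set C → Set C → Set C → Prop} {V : Set σ}
    (hV : ∀ r r' : σ, Vocab.arity r = Vocab.arity r' → r ∈ V → r' ∈ V)
    (hSV : F.S ⊆ V) (hqV : sig (F.q.body : Set (Atom σ ℕ)) ⊆ V) (hq : F.q.IsRAQ)
    (harity : ∀ r ∈ F.S, Vocab.arity r ≤ F.m + 1) (hK : F.m + 1 + (F.n + 1) ≤ K)
    {ψ : Formula σ} (hψ : ψ ∈ F.Φ) (hψfv : ∀ x ∈ ψ.fv, ∃ i, F.q.ans i = x)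
    (hψs : ∀ {U : Type max u v} (A : Set (Atom σ U)) v,
      ψ.Sat A v ↔ F.q.Answer A (fun i => v (F.q.ans i)))
    (htol : Tolerant C N cond V F.O) (hmodels : F.HasModels C N neq K cond)
    (hunguarded : F.HasUnguardedModels C N V) :
    (F.program (C ⊕ N) neq K).Rewrites C N F.S F.O F.q := by
  refine ⟨F.arity_eq.symm, fun D hD hDS a ha => ⟨fun hcert => ?_, fun h => ?_⟩⟩
  swap
  · exact F.certain_of_derives h
  intro A hA hDA hmodel
  by_contra hgoal
  have hcl : F.IsClosed neq K D A := ⟨hDS, hDA, hmodel, harity, hK⟩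
  set a' : Fin (F.n + 1) → C := fun i => a (Fin.cast F.arity_eq.symm i) with ha'
  have haa' : ∀ i, a' (Fin.cast F.arity_eq i) = a i := fun i => rfl
  have hra : Set.range a' = Set.range a := by
    ext x
    exact ⟨fun ⟨i, hi⟩ => ⟨_, hi⟩, fun ⟨i, hi⟩ => ⟨Fin.cast F.arity_eq i, hi⟩⟩
  have hacard : (Set.range a').ncard ≤ F.n + 1 := by
    rw [← Set.image_univ]
    refine (Set.ncard_image_le Set.finite_univ).trans ?_
    rw [Set.ncard_univ, Nat.card_fin]
  -- every maximal guarded set has a realization that avoids the answer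
  have hreal : ∀ G, IsMaxGuarded D G →
      ∃ (B : Set (Atom σ (C ⊕ N))) (g : C → C ⊕ N), F.Realizes neq D A G B g ∧
        ¬ F.q.Answer B (fun i => g (a i)) := by
    intro G hG
    have hcard : (G ∪ Set.range a').ncard ≤ K := by
      have h1 := Set.ncard_union_le G (Set.range a')
      have h2 := hcl.ncard_le hG
      omega
    have hdom : G ∪ Set.range a' ⊆ dom D := by
      refine Set.union_subset hG.prop.subset_dom ?_
      rintro _ ⟨i, rfl⟩
      exact ha _
    obtain ⟨B, g, h1, h2⟩ := hcl.exists_realizes_of_goal_notMem hgoal Set.subset_union_right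
      (hG.prop.finite.union (Set.finite_range _)) hcard hdom
    exact ⟨B, g, h1.mono Set.subset_union_left, h2⟩
  have hroots := fun G hG => (hreal G hG).imp fun B h => h.imp fun g h => h.1
  have hDV : sig D ⊆ V := hDS.trans hSV
  -- the instance is consistent
  obtain ⟨B₀, hB₀, hDB₀, hOB₀⟩ : ∃ B : Set (Atom σ (C ⊕ N)), IsInterp B ∧
      Atom.map Sum.inl '' D ⊆ B ∧ ∀ s ∈ F.O, s.Holds B := by
    by_contra hcon
    obtain ⟨α, hα⟩ := hD.1
    obtain ⟨G, -, hG⟩ := IsGuarded.exists_isMaxGuarded hD.2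
      (Or.inr ⟨α, hα, rfl⟩ : IsGuarded D α.elems)
    obtain ⟨α₀, hα₀, rfl⟩ := hG.exists_atom
    obtain ⟨B, g, hB, -⟩ := hreal _ hG
    obtain ⟨A', h1, h2, h3, -⟩ := hmodels D A hD hcl hroots _ hG B g hB
    obtain ⟨r, hr, hrA⟩ := (hσ (Vocab.arity α₀.rel) (Vocab.arity_pos _)).exists_notMem_finite h1.2
    have hr' : Vocab.arity r = Vocab.arity α₀.rel := hr
    let b : Fin (Vocab.arity r) → C := fun i => α₀.args (Fin.cast hr' i)
    have hb : Set.range b = α₀.elems := by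
      ext x
      exact ⟨fun ⟨i, hi⟩ => ⟨_, hi⟩, fun ⟨i, hi⟩ => ⟨Fin.cast hr'.symm i, hi⟩⟩
    have ht := (htol D hD hDV (CQ.ofSymbol r) (CQ.ofSymbol_isRAQ r) (by
      rw [CQ.ofSymbol_sig]
      exact Set.singleton_subset_iff.2 (hV _ _ hr'.symm (hDV ⟨α₀, hα₀, rfl⟩))) b
      (show IsMaxGuarded D (Set.range b) by rw [hb]; exact hG)).1
        fun B hB hDB hOB => (hcon ⟨B, hB, hDB, hOB⟩).elim
    exact hrA (ht A' h1 h2 h3).rel_mem_sig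
  have hker : ∀ i j, F.q.ans i = F.q.ans j → a i = a j := by
    intro i j hij
    obtain ⟨h, -, h2⟩ := hcert B₀ hB₀ hDB₀ hOB₀
    have := h2 i
    rw [hij, h2 j] at this
    exact (Sum.inl_injective this).symm
  -- the tuple is guarded
  obtain ⟨α₁, hα₁, haα₁⟩ : ∃ α ∈ D, Set.range a ⊆ α.elems := by
    by_contra hcon
    push Not at hcon
    obtain ⟨B, hB, hDB, hOB, hun⟩ := hunguarded D hD hDV (Set.range a)
      (by rintro _ ⟨i, rfl⟩; exact ha i) hcon B₀ hB₀ hDB₀ hOB₀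
    obtain ⟨h, h1, h2⟩ := hcert B hB hDB hOB
    obtain ⟨T, hT, E, bag, root, hdec, hroot⟩ := hq
    rcases hdec.guarded root with ⟨x, -, hx⟩ | ⟨α, hα, hx⟩
    · have hall : ∀ i, Sum.inl (a i) = h x := fun i => by
        have : F.q.ans i ∈ bag root := by rw [hroot]; exact ⟨i, rfl⟩
        rw [hx] at this
        exact (h2 i).symm.trans (congrArg h this)
      obtain ⟨β, hβ, hβa⟩ := ha (Fin.cast F.arity_eq.symm 0)
      refine hcon β hβ ?_
      rintro _ ⟨i, rfl⟩
      rwa [Sum.inl_injective ((hall i).trans (hall (Fin.cast F.arity_eq.symm 0)).symm)]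
    · refine hun _ (h1 α hα) (hqV ⟨α, hα, rfl⟩) ?_
      rintro _ ⟨_, ⟨i, rfl⟩, rfl⟩
      have : F.q.ans i ∈ bag root := by rw [hroot]; exact ⟨i, rfl⟩
      rw [hx] at this
      rw [Atom.elems_map]
      exact ⟨_, this, h2 i⟩
  obtain ⟨G, haG, hG⟩ := IsGuarded.exists_isMaxGuarded hD.2
    (Or.inr ⟨α₁, hα₁, rfl⟩ : IsGuarded D α₁.elems)
  obtain ⟨α₀, hα₀, rfl⟩ := hG.exists_atom
  have haα₀ := haα₁.trans haG
  obtain ⟨ans, body, hmem, hraq, hsig, hext⟩ := hq.exists_extension a hker α₀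
    fun i => haα₀ ⟨i, rfl⟩
  obtain ⟨B, g, hB, hBq⟩ := hreal _ hG
  obtain ⟨A', h1, h2, h3, h4⟩ := hmodels D A hD hcl hroots _ hG B g hB
  have ht := (htol D hD hDV _ hraq (hsig.trans (Set.insert_subset (hDV ⟨α₀, hα₀, rfl⟩) hqV))
    α₀.args hG).1 fun B hB hDB hOB =>
      (hext B Sum.inl).1 (hDB ⟨α₀, hα₀, rfl⟩) (hcert B hB hDB hOB)
  have hans := (hext A' (fun d => (Sum.inl (copyAt [α₀.elems] d) : Copy C ⊕ N))).2
    (ht A' h1 h2 h3)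
  apply hBq
  classical
  let v : ℕ → C := fun x => if hx : ∃ i, F.q.ans i = x then a hx.choose else a' 0
  have hv : ∀ i, v (F.q.ans i) = a i := by
    intro i
    have hx : ∃ j, F.q.ans j = F.q.ans i := ⟨i, rfl⟩
    simp only [v, dif_pos hx]
    exact hker _ _ hx.choose_spec
  have hagree := h4 ψ hψ v fun x hx => by
    obtain ⟨i, rfl⟩ := hψfv x hx
    rw [hv]
    exact haα₀ ⟨i, rfl⟩
  rw [hψs, hψs] at hagree
  simp only [Function.comp_apply, hv] at hagree
  exact hagree.2 hans

end Rewriting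

/-! ### Transport of models to the required sets of elements -/

section Transport

variable {σ : Type*} [Vocab σ] {U W X Y : Type*}

theorem holds_reduct {A : Set (Atom σ U)} {S : Set σ} {s : Sentence σ} (hs : s.body.Guarded)
    (hr : s.body.rels ⊆ S) (h : s.Holds A) : s.Holds {α ∈ A | α.rel ∈ S} := by
  intro v hd hg
  refine (Formula.sat_reduct hs hr v).2
    (h v (fun x hx => dom_mono (Set.sep_subset _ _) (hd x hx)) ?_)
  cases hs' : s.guard with
  | atom α => rw [hs'] at hg; exact hg.1
  | eqSelf y => exact rfl

theorem holds_map_image {A : Set (Atom σ U)} {j : U → W} (hj : Set.InjOn j (dom A))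
    {s : Sentence σ} (hs : s.body.Guarded) (hfv : s.body.fv ⊆ s.guard.vars) (h : s.Holds A) :
    s.Holds (Atom.map j '' A) := by
  intro v hd hg
  rw [dom_map_image] at hd
  obtain ⟨x₀, hx₀⟩ := hs.fv_nonempty.mono hfv
  have : Nonempty U := ⟨(hd x₀ hx₀).choose⟩
  choose! u hu using hd
  have hsat := h u (fun x hx => (hu x hx).1) (by
    cases hs' : s.guard with
    | atom α =>
      rw [hs'] at hg hu
      refine mem_of_map_mem_image hj ?_ (α := α.map u) ?_
      · rw [Atom.elems_map]
        rintro _ ⟨x, hx, rfl⟩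
        exact (hu x (Atom.mem_vars.2 hx)).1
      · rw [Atom.map_map, Atom.map_congr (f := j ∘ u) (g := v) fun x hx =>
          (hu x (Atom.mem_vars.2 hx)).2]
        exact hg
    | eqSelf y => exact rfl)
  rw [← Formula.sat_map_image hj hs fun x hx => (hu x (hfv hx)).1] at hsat
  exact (Formula.Sat.congr_fv fun x hx => (hu x (hfv hx)).2).1 hsat

/-- An injection on a subset can be extended if there is enough room outside its image. -/
theorem exists_injective_extension {Q : Set X} {f : X → Y} (hf : Set.InjOn f Q)
    (e : X ↪ ((f '' Q)ᶜ : Set Y)) :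
    ∃ j : X → Y, Function.Injective j ∧ ∀ x ∈ Q, j x = f x := by
  classical
  refine ⟨fun x => if x ∈ Q then f x else e x, fun x y hxy => ?_, fun x hx => by simp [hx]⟩
  by_cases hx : x ∈ Q <;> by_cases hy : y ∈ Q <;> simp only [hx, hy, if_true, if_false] at hxy
  · exact hf hx hy hxy
  · exact ((e y).2 ⟨x, hx, hxy⟩).elim
  · exact ((e x).2 ⟨y, hy, hxy.symm⟩).elim
  · exact e.injective (Subtype.ext hxy)

theorem exists_injective_extension_of_finite [Infinite Y] {Q : Set X} (hQ : Q.Finite) {f : X → Y}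
    (hf : Set.InjOn f Q) (e : X ↪ Y) :
    ∃ j : X → Y, Function.Injective j ∧ ∀ x ∈ Q, j x = f x := by
  have hfin := hQ.image f
  have h := Cardinal.mk_compl_of_infinite (f '' Q)
    ((Cardinal.lt_aleph0_iff_set_finite.2 hfin).trans_le (Cardinal.aleph0_le_mk Y))
  obtain ⟨e'⟩ := Cardinal.eq.1 h
  exact exists_injective_extension hf (e.trans e'.symm.toEmbedding)

theorem nonempty_prod_bool_embedding [Infinite Y] : Nonempty (Y × Bool ↪ Y) := by
  obtain ⟨e⟩ : Nonempty (Y × ULift Bool ≃ Y) := by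
    apply Cardinal.eq.1
    rw [← Cardinal.mul_def]
    exact Cardinal.mul_eq_left (Cardinal.aleph0_le_mk Y)
      ((Cardinal.lt_aleph0_of_finite _).le.trans (Cardinal.aleph0_le_mk Y)) (by simp)
  exact ⟨((Equiv.prodCongr (Equiv.refl Y) Equiv.ulift.symm).trans e).toEmbedding⟩

end Transport

/-! ### Sequences of maximal guarded sets and copies of constants -/

section Unravelling

variable {σ : Type*} [Vocab σ] {C N W : Type*} {cond : Set C → Set C → Set C → Prop}
  {D : Set (Atom σ C)}

theorem IsSeq.ne_nil {t : List (Set C)} (h : IsSeq cond D t) : t ≠ [] := by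
  cases h <;> simp

theorem IsSeq.isMaxGuarded {t : List (Set C)} (h : IsSeq cond D t) :
    ∀ G ∈ t, IsMaxGuarded D G := by
  induction h with
  | single G hG => simpa using hG
  | cons G' G t _ hG' _ _ _ ih =>
    intro F hF
    rcases List.mem_cons.1 hF with rfl | hF
    exacts [hG', ih F hF]

theorem IsSeq.of_cons {G : Set C} {t : List (Set C)} (h : IsSeq cond D (G :: t)) (ht : t ≠ []) :
    IsSeq cond D t := by
  cases h with
  | single _ _ => exact absurd rfl ht
  | cons _ _ _ h _ _ _ _ => exact h

theorem IsSeq.of_suffix {s t : List (Set C)} (h : IsSeq cond D t) (hs : s <:+ t) (hne : s ≠ []) :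
    IsSeq cond D s := by
  induction t with
  | nil => exact absurd (List.suffix_nil.1 hs) hne
  | cons G t ih =>
    rcases List.suffix_cons_iff.1 hs with rfl | hs
    · exact h
    · refine ih (h.of_cons ?_) hs
      rintro rfl
      exact hne (List.suffix_nil.1 hs)

theorem copyAt_cons_of_mem {G' G : Set C} {t : List (Set C)} {d : C} (h : d ∈ G) :
    copyAt (G' :: G :: t) d = copyAt (G :: t) d := by
  rw [copyAt, if_pos h]

theorem copyAt_cons_of_notMem {G' G : Set C} {t : List (Set C)} {d : C} (h : d ∉ G) :
    copyAt (G' :: G :: t) d = (G' :: G :: t, d) := by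
  rw [copyAt, if_neg h]

theorem copyAt_singleton (G : Set C) (d : C) : copyAt [G] d = ([G], d) := rfl

theorem copyAt_snd (t : List (Set C)) (d : C) : (copyAt t d).2 = d := by
  match t with
  | [] => rfl
  | [G] => rfl
  | G' :: G :: t =>
    by_cases h : d ∈ G
    · rw [copyAt_cons_of_mem h]; exact copyAt_snd (G :: t) d
    · rw [copyAt_cons_of_notMem h]

theorem copyAt_suffix (t : List (Set C)) (d : C) : (copyAt t d).1 <:+ t := by
  match t with
  | [] => exact List.suffix_refl _
  | [G] => exact List.suffix_refl _
  | G' :: G :: t =>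
    by_cases h : d ∈ G
    · rw [copyAt_cons_of_mem h]
      exact (copyAt_suffix (G :: t) d).trans (List.suffix_cons _ _)
    · rw [copyAt_cons_of_notMem h]

theorem copyAt_ne_nil {t : List (Set C)} (ht : t ≠ []) (d : C) : (copyAt t d).1 ≠ [] := by
  match t with
  | [] => exact absurd rfl ht
  | [G] => simp [copyAt]
  | G' :: G :: t =>
    by_cases h : d ∈ G
    · rw [copyAt_cons_of_mem h]
      exact copyAt_ne_nil (by simp) d
    · rw [copyAt_cons_of_notMem h]
      simp

theorem IsSeq.fst_copyAt {t : List (Set C)} (h : IsSeq cond D t) (d : C) :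
    IsSeq cond D (copyAt t d).1 :=
  h.of_suffix (copyAt_suffix t d) (copyAt_ne_nil h.ne_nil d)

theorem mem_dom_unravelling {p : Copy C} (hp : p ∈ dom (unravelling cond D)) :
    ∃ G t d, IsSeq cond D (G :: t) ∧ d ∈ G ∧ p = copyAt (G :: t) d := by
  obtain ⟨_, ⟨t, ht, G, hG, α, hα, hαG, rfl⟩, hp⟩ := hp
  rw [Atom.elems_map] at hp
  obtain ⟨d, hd, rfl⟩ := hp
  obtain ⟨G', t, rfl⟩ := List.exists_cons_of_ne_nil ht.ne_nil
  simp only [List.head?_cons, Option.mem_def, Option.some.injEq] at hG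
  subst hG
  exact ⟨G', t, d, ht, hαG hd, rfl⟩

theorem copyAt_mem_dom_unravelling {G : Set C} {t : List (Set C)} (ht : IsSeq cond D (G :: t))
    {d : C} (hd : d ∈ G) : copyAt (G :: t) d ∈ dom (unravelling cond D) := by
  obtain ⟨α, hα, rfl⟩ := (ht.isMaxGuarded G (by simp)).exists_atom
  refine ⟨α.map (copyAt (α.elems :: t)), ⟨_, ht, _, by simp, α, hα, subset_rfl, rfl⟩, ?_⟩
  rw [Atom.elems_map]
  exact ⟨d, hd, rfl⟩

theorem countable_isSeq (hD : D.Finite) : Countable {t : List (Set C) // IsSeq cond D t} := by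
  have hfin : {G | IsMaxGuarded D G}.Finite :=
    (isGuarded_finite_setOf hD).subset fun G hG => hG.prop
  have := hfin.to_subtype
  have hc : Countable (List {G | IsMaxGuarded D G}) := inferInstance
  refine Function.Injective.countable (β := List {G | IsMaxGuarded D G})
    (f := fun t => t.1.attach.map fun G => ⟨G.1, t.2.isMaxGuarded G.1 G.2⟩) ?_
  intro t t' h
  apply Subtype.ext
  have := congrArg (List.map Subtype.val) h
  simpa using this

/-- Room for countably many copies of `C ⊕ N` besides the copies of constants in the unravelling: a
constant is paired with a list of empty sets, which is not the index of a bag. -/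
theorem exists_embedding_copy [Infinite N] (cond : Set C → Set C → Set C → Prop)
    (D : Set (Atom σ C)) (ι : Type*) [Countable ι] :
    ∃ e : ι × (C ⊕ N) → Copy C ⊕ N, Function.Injective e ∧
      ∀ x p, IsSeq cond D p.1 → e x ≠ Sum.inl p := by
  obtain ⟨f, hf⟩ := exists_injective_nat ι
  obtain ⟨e'⟩ : Nonempty (ULift ℕ × N ≃ N) := by
    apply Cardinal.eq.1
    rw [← Cardinal.mul_def]
    exact Cardinal.mul_eq_right (Cardinal.aleph0_le_mk N)
      (by simp) (by simp [Cardinal.aleph0_ne_zero])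
  refine ⟨fun x => match x.2 with
    | .inl c => .inl (List.replicate (f x.1 + 1) ∅, c)
    | .inr n => .inr (e' (⟨f x.1⟩, n)), ?_, ?_⟩
  · rintro ⟨i, c | n⟩ ⟨i', c' | n'⟩ h
    · simp only [Sum.inl.injEq, Prod.mk.injEq] at h
      have := congrArg List.length h.1
      simp only [List.length_replicate, add_left_inj] at this
      rw [hf this, h.2]
    · simp at h
    · simp at h
    · simp only [Sum.inr.injEq, EmbeddingLike.apply_eq_iff_eq, Prod.mk.injEq,
        ULift.up.injEq] at h
      rw [hf h.1, h.2]
  · rintro ⟨i, c | n⟩ p hp h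
    · simp only [Sum.inl.injEq] at h
      rw [← h] at hp
      have := (hp.isMaxGuarded ∅ (by simp)).prop.nonempty
      simp at this
    · simp at h

end Unravelling

/-! ### Models on constants and nulls from models on other elements -/

namespace Frame

variable {σ : Type*} [Vocab σ] {C N : Type*}

/-- The set `Φ` consists of guarded formulas, is closed under subformulas and contains the bodies
and the guards of the sentences of the ontology. -/
structure IsAdmissible (F : Frame σ) : Prop where
  subClosed : SubClosed F.Φ
  guarded : ∀ φ ∈ F.Φ, φ.Guarded
  body_mem : ∀ s ∈ F.O, s.body ∈ F.Φ
  guard_mem : ∀ s ∈ F.O, ∀ α, s.guard = .atom α → Formula.atom α ∈ F.Φ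
  fv_subset : ∀ s ∈ F.O, s.body.fv ⊆ s.guard.vars

variable {F : Frame σ}

/-- A model over arbitrary elements that contains a copy of the unravelling yields one of the kind
that certain answers refer to: its reduct to the relevant symbols is moved along an injection. -/
theorem exists_model_of_embedding (hF : F.IsAdmissible) {X W : Type*}
    {cond : Set C → Set C → Set C → Prop} {D : Set (Atom σ C)}
    (hDS : sig D ⊆ F.S) {A : Set (Atom σ X)} (e : Copy C → X) {j : X → Copy C ⊕ N}
    (hj : Set.InjOn j (dom A)) (hje : ∀ p ∈ dom (unravelling cond D), j (e p) = Sum.inl p)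
    (he : Atom.map e '' unravelling cond D ⊆ A) (hO : ∀ s ∈ F.O, s.Holds A) {G : Set C}
    (hG : IsMaxGuarded D G) {B : Set (Atom σ W)} {g : C → W}
    (hagree : F.Agree B g A (fun d => e (copyAt [G] d)) G) :
    ∃ A' : Set (Atom σ (Copy C ⊕ N)), IsInterp A' ∧
      Atom.map Sum.inl '' unravelling cond D ⊆ A' ∧ (∀ s ∈ F.O, s.Holds A') ∧
      F.Agree B g A' (fun d => (Sum.inl (copyAt [G] d) : Copy C ⊕ N)) G := by
  set S' : Set σ := F.S ∪ ⋃ φ ∈ F.Φ, φ.rels with hS'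
  have hS'fin : S'.Finite := F.S_finite.union (F.Φ_finite.biUnion fun φ _ => φ.rels_finite)
  have hrels : ∀ φ ∈ F.Φ, φ.rels ⊆ S' := fun φ hφ =>
    (Set.subset_biUnion_of_mem (u := fun φ : Formula σ => φ.rels) hφ).trans Set.subset_union_right
  set A₁ : Set (Atom σ X) := {α ∈ A | α.rel ∈ S'} with hA₁
  have hj₁ : Set.InjOn j (dom A₁) := hj.mono (dom_mono (Set.sep_subset _ _))
  have heA₁ : Atom.map e '' unravelling cond D ⊆ A₁ := by
    rintro _ ⟨β, hβ, rfl⟩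
    refine ⟨he ⟨β, hβ, rfl⟩, ?_⟩
    obtain ⟨t, ht, G, hG, α, hα, hαG, rfl⟩ := hβ
    exact Or.inl (hDS ⟨α, hα, rfl⟩)
  have hDA : Atom.map Sum.inl '' unravelling cond D ⊆ Atom.map j '' A₁ := by
    rintro _ ⟨β, hβ, rfl⟩
    refine ⟨β.map e, heA₁ ⟨β, hβ, rfl⟩, ?_⟩
    rw [Atom.map_map]
    exact Atom.map_congr fun p hp => hje p ⟨β, hβ, hp⟩
  refine ⟨Atom.map j '' A₁, ⟨?_, ?_⟩, hDA, ?_, ?_⟩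
  · obtain ⟨α, hα, rfl⟩ := hG.exists_atom
    exact ⟨_, hDA ⟨α.map (copyAt [α.elems]), ⟨_, .single _ hG, _, by simp, α, hα, subset_rfl, rfl⟩,
      rfl⟩⟩
  · refine hS'fin.subset ?_
    rintro _ ⟨_, ⟨α, hα, rfl⟩, rfl⟩
    exact hα.2
  · intro s hs
    have hg := hF.guarded _ (hF.body_mem s hs)
    exact holds_map_image hj₁ hg (hF.fv_subset s hs)
      (holds_reduct hg (hrels _ (hF.body_mem s hs)) (hO s hs))
  · intro φ hφ v hv
    have hdom : ∀ d ∈ G, copyAt [G] d ∈ dom (unravelling cond D) := fun d hd =>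
      copyAt_mem_dom_unravelling (.single G hG) hd
    have h1 := Formula.sat_map_image hj₁ (hF.guarded φ hφ)
      (v := fun x => e (copyAt [G] (v x))) fun x hx => by
        rw [← Function.comp_apply (f := e)]
        have := dom_mono heA₁ (a := e (copyAt [G] (v x)))
        rw [dom_map_image] at this
        exact this ⟨_, hdom _ (hv x hx), rfl⟩
    rw [Formula.sat_reduct (hF.guarded φ hφ) (hrels φ hφ)] at h1
    refine (hagree φ hφ v hv).trans (h1.symm.trans (Formula.Sat.congr_fv fun x hx => ?_))
    exact hje _ (hdom _ (hv x hx))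

/-! ### Models in which tuples that are not guarded by the instance are not guarded -/

theorem exists_model_of_cover [Infinite C] (hF : F.IsAdmissible) {D : Set (Atom σ C)}
    (hD : IsInstance D) {B : Set (Atom σ (C ⊕ N))} (hB : IsInterp B)
    {A : Set (Atom σ ((C ⊕ N) × Bool))} (hAB : sig A ⊆ sig B)
    (hDA : Atom.map (fun c => (Sum.inl c, false)) '' D ⊆ A) (hA : ∀ s ∈ F.O, s.Holds A)
    {V : Set σ} {G : Set C} (hG : G ⊆ dom D)
    (hun : ∀ γ ∈ A, γ.rel ∈ V → ¬ (fun c => (Sum.inl c, false)) '' G ⊆ γ.elems) :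
    ∃ B' : Set (Atom σ (C ⊕ N)), IsInterp B' ∧ Atom.map Sum.inl '' D ⊆ B' ∧
        (∀ s ∈ F.O, s.Holds B') ∧ ∀ β ∈ B', β.rel ∈ V → ¬ Sum.inl '' G ⊆ β.elems := by
  obtain ⟨e⟩ := nonempty_prod_bool_embedding (Y := C ⊕ N)
  obtain ⟨j, hj, hj'⟩ := exists_injective_extension_of_finite
    (Q := (fun c => ((Sum.inl c : C ⊕ N), false)) '' dom D) (f := Prod.fst)
    ((dom_finite hD.2).image _) (by
      rintro _ ⟨c, -, rfl⟩ _ ⟨c', -, rfl⟩ h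
      exact Prod.ext h rfl) e
  have hjc : ∀ c ∈ dom D, j (Sum.inl c, false) = Sum.inl c := fun c hc => hj' _ ⟨c, hc, rfl⟩
  refine ⟨Atom.map j '' A, ⟨?_, ?_⟩, ?_, ?_, ?_⟩
  · obtain ⟨α, hα⟩ := hD.1
    exact ⟨_, _, hDA ⟨α, hα, rfl⟩, rfl⟩
  · refine hB.2.subset ?_
    rintro _ ⟨_, ⟨α, hα, rfl⟩, rfl⟩
    exact hAB ⟨α, hα, rfl⟩
  · rintro _ ⟨α, hα, rfl⟩
    refine ⟨_, hDA ⟨α, hα, rfl⟩, ?_⟩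
    rw [Atom.map_map]
    exact Atom.map_congr fun c hc => hjc c ⟨α, hα, hc⟩
  · intro s hs
    exact holds_map_image hj.injOn (hF.guarded _ (hF.body_mem s hs)) (hF.fv_subset s hs) (hA s hs)
  · rintro _ ⟨γ, hγ, rfl⟩ hV hsub
    refine hun γ hγ hV ?_
    rintro _ ⟨c, hc, rfl⟩
    have := hsub ⟨c, hc, rfl⟩
    rw [Atom.elems_map] at this
    obtain ⟨x, hx, hxc⟩ := this
    rw [← hjc c (hG hc)] at hxc
    have hxe := hj hxc
    subst hxe
    exact hx

/-- For uGF, two copies of each element are used, and the atoms are copied in all ways except that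
an atom may not contain the first copies of all elements of the given set. -/
theorem hasUnguardedModels_of_isOpenGF [Infinite C] (hF : F.IsAdmissible)
    (hGF : ∀ φ ∈ F.Φ, φ.IsOpenGF) (V : Set σ) : F.HasUnguardedModels C N V := by
  intro D hD _ G hG hun B hB hDB hO
  classical
  let P : {s : C ⊕ N → Bool // ∃ x ∈ G, s (Sum.inl x) = true} → Set ((C ⊕ N) × Bool) :=
    fun s => {x | x.2 = s.1 x.1}
  have hinj : ∀ s, Set.InjOn Prod.fst (P s) := by
    rintro s ⟨x, i⟩ (hx : i = s.1 x) ⟨y, i'⟩ (hy : i' = s.1 y) (hxy : x = y)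
    subst hxy
    rw [hx, hy]
  have hsat := fun φ (hφ : φ ∈ F.Φ) => sat_glue_iff (P := P) (π := fun _ => Prod.fst)
    (B := fun _ => B) hF.subClosed hGF (fun s w _ => ⟨(w, s.1 w), rfl, rfl⟩)
    (fun _ _ _ _ _ _ => Iff.rfl) (Or.inl hinj) hφ
  refine exists_model_of_cover hF hD hB (A := glue P (fun _ => Prod.fst) fun _ => B) ?_ ?_ ?_ hG ?_
  · rintro _ ⟨α, ⟨s, -, h⟩, rfl⟩
    exact ⟨_, h, rfl⟩
  · rintro _ ⟨α, hα, rfl⟩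
    obtain ⟨x, hx, hxα⟩ := Set.not_subset.1 (hun α hα)
    refine ⟨⟨fun w => if w ∈ Sum.inl '' α.elems then false else true, x, hx, ?_⟩, ?_,
      hDB ⟨α, hα, rfl⟩⟩
    · simpa using hxα
    · rw [Atom.elems_map]
      rintro _ ⟨c, hc, rfl⟩
      have : (Sum.inl c : C ⊕ N) ∈ Sum.inl '' α.elems := ⟨c, hc, rfl⟩
      simp only [P, Set.mem_ofPred_eq]
      rw [if_pos this]
  · intro s hs
    exact holds_glue hsat (hF.body_mem s hs) (hF.fv_subset s hs) fun _ => hO s hs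
  · rintro γ ⟨⟨s, x, hx, hsx⟩, h1, -⟩ - hsub
    have : false = s (Sum.inl x) := h1 (hsub ⟨x, hx, rfl⟩)
    rw [hsx] at this
    exact absurd this (by simp)

/-- For uGC₂, two copies of the model are used, with the edges at the given pair crossed. -/
theorem hasUnguardedModels_of_binary [Infinite C] (hF : F.IsAdmissible)
    (hbin : ∀ φ ∈ F.Φ, φ.rels ⊆ binarySymbols σ) : F.HasUnguardedModels C N (binarySymbols σ) := by
  intro D hD hDV G hG hun B hB hDB hO
  by_cases hcon : ∃ β ∈ B, β.rel ∈ binarySymbols σ ∧ Sum.inl '' G ⊆ β.elems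
  swap
  · push Not at hcon
    exact ⟨B, hB, hDB, hO, hcon⟩
  obtain ⟨β, -, hβ, hβG⟩ := hcon
  obtain ⟨α₀, hα₀⟩ := hD.1
  obtain ⟨d, hd, -⟩ := Set.not_subset.1 (hun α₀ hα₀)
  obtain ⟨α₁, hα₁, hdα₁⟩ := hG hd
  obtain ⟨d', hd', hd'α₁⟩ := Set.not_subset.1 (hun α₁ hα₁)
  have hdd' : d ≠ d' := fun h => hd'α₁ (h ▸ hdα₁)
  have hGdd' : ∀ c ∈ G, c = d ∨ c = d' := by
    obtain ⟨b, -, hb⟩ := Atom.exists_elems_subset_pair hβ (hβG ⟨d, hd, rfl⟩)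
    have hb' : Sum.inl d' = b :=
      (hb _ (hβG ⟨d', hd', rfl⟩)).resolve_left fun h => hdd' (Sum.inl_injective h).symm
    intro c hc
    rcases hb _ (hβG ⟨c, hc, rfl⟩) with h | h
    · exact Or.inl (Sum.inl_injective h)
    · exact Or.inr (Sum.inl_injective (h.trans hb'.symm))
  classical
  let cross : C ⊕ N → C ⊕ N → Prop := fun x y =>
    (x = Sum.inl d ∧ y = Sum.inl d') ∨ (x = Sum.inl d' ∧ y = Sum.inl d)
  have hcross : ∀ x y, cross x y ↔ cross y x := fun x y => by simp only [cross]; tauto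
  let s : (C ⊕ N) × Bool → C ⊕ N → (C ⊕ N) × Bool := fun z y =>
    (y, if cross z.1 y then !z.2 else z.2)
  have hs1 : ∀ z y, (s z y).1 = y := fun _ _ => rfl
  have hss : ∀ z y, s (s z y) z.1 = z := by
    rintro ⟨x, i⟩ y
    by_cases h : cross x y
    · simp [s, h, (hcross y x).2 h]
    · simp [s, h, mt (hcross y x).1 h]
  have hcov : IsLocalCover F.Φ (fun _ => B) Prod.fst s := by
    refine ⟨fun z => ?_, fun z y _ y' _ h => congrArg Prod.fst h, fun z y hy =>
      ⟨z.1, ?_, hss z y, fun φ _ w w' hw => Formula.Sat.congr_fv fun x hx => ?_⟩⟩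
    · have : ¬ cross z.1 z.1 := by
        rintro (⟨h1, h2⟩ | ⟨h1, h2⟩)
        · exact hdd' (Sum.inl_injective (h1.symm.trans h2))
        · exact hdd' (Sum.inl_injective (h2.symm.trans h1))
      simp [s, this]
    · obtain ⟨β, h1, h2, h3⟩ := hy
      exact ⟨β, h1, h3, h2⟩
    · rcases hw x hx with ⟨h1, h2⟩ | ⟨h1, h2⟩
      exacts [h1.trans h2.symm, h1.trans h2.symm]
  refine exists_model_of_cover hF hD hB (A := starUnion (fun _ => B) Prod.fst s) ?_ ?_ ?_ hG ?_
  · rintro _ ⟨_, ⟨z, β, hβ, -, rfl⟩, rfl⟩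
    exact ⟨β, hβ, rfl⟩
  · rintro _ ⟨α, hα, rfl⟩
    obtain ⟨c, hc⟩ := α.elems_nonempty
    refine ⟨(Sum.inl c, false), _, hDB ⟨α, hα, rfl⟩, ?_, ?_⟩
    · rw [Atom.elems_map]; exact ⟨c, hc, rfl⟩
    · rw [Atom.map_map]
      refine Atom.map_congr fun c' hc' => ?_
      have : ¬ cross (Sum.inl c) (Sum.inl c') := by
        intro h
        refine hun α hα fun x hx => ?_
        simp only [cross, Sum.inl.injEq] at h
        rcases h with ⟨rfl, rfl⟩ | ⟨rfl, rfl⟩ <;> rcases hGdd' x hx with rfl | rfl <;> assumption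
      simp [s, this]
  · intro t ht
    exact hcov.holds hF.subClosed hF.guarded hbin (hF.body_mem t ht) (hF.guard_mem t ht)
      (hF.fv_subset t ht) fun _ => hO t ht
  · intro γ hγ hγb hsub
    obtain ⟨y, -, hy⟩ := hcov.exists_nbhd_of_mem hγ hγb (hsub ⟨d, hd, rfl⟩)
    rcases hy _ (hsub ⟨d', hd', rfl⟩) with h | h
    · simp only [Prod.mk.injEq, and_true] at h
      exact hdd' (Sum.inl_injective h).symm
    · have h1 : Sum.inl d' = y := congrArg Prod.fst h
      subst h1
      simp [s, cross] at h

end Frame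

/-! ### Models of the uGF-unravelling -/

section Bags

variable {σ : Type*} [Vocab σ] {C : Type*} {cond : Set C → Set C → Set C → Prop}
  {D : Set (Atom σ C)}

/-- The domain of `bag(t)`. -/
def bagDom (t : List (Set C)) : Set (Copy C) := {p | p.2 ∈ t.headD ∅ ∧ copyAt t p.2 = p}

theorem copyAt_mem_bagDom {G : Set C} {t : List (Set C)} {d : C} (hd : d ∈ G) :
    copyAt (G :: t) d ∈ bagDom (G :: t) :=
  ⟨by rw [copyAt_snd]; exact hd, by rw [copyAt_snd]⟩

theorem suffix_of_mem_bagDom {t : List (Set C)} {p : Copy C} (hp : p ∈ bagDom t) : p.1 <:+ t := by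
  rw [← hp.2]
  exact copyAt_suffix t p.2

theorem fst_eq_of_mem_bagDom_singleton {G : Set C} {p : Copy C} (hp : p ∈ bagDom [G]) :
    p.1 = [G] := by
  rw [← hp.2]; rfl

theorem bagDom_cons {G' G : Set C} {t : List (Set C)} {p : Copy C}
    (hp : p ∈ bagDom (G' :: G :: t)) :
    p.1 = G' :: G :: t ∨ p.2 ∈ G ∩ G' ∧ p ∈ bagDom (G :: t) := by
  by_cases h : p.2 ∈ G
  · refine Or.inr ⟨⟨h, hp.1⟩, h, ?_⟩
    rw [← copyAt_cons_of_mem h]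
    exact hp.2
  · left
    rw [← hp.2, copyAt_cons_of_notMem h]

/-- Functions on nonempty lists that are determined by the values at singletons and the step from a
tail to the list. -/
theorem exists_list_recursion {X Y : Type*} [Nonempty Y] (r : X → Y) (f : X → X → Y → Y) :
    ∃ R : List X → Y, (∀ a, R [a] = r a) ∧ ∀ b a t, R (b :: a :: t) = f a b (R (a :: t)) := by
  refine ⟨fun t => t.rec (Classical.arbitrary Y) fun b t y =>
    match t with
    | [] => r b
    | a :: _ => f a b y, fun a => rfl, fun b a t => rfl⟩

end Bags

namespace Frame

variable {σ : Type*} [Vocab σ] {C N W : Type*} {F : Frame σ}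

theorem Agree.symm {W' : Type*} {B : Set (Atom σ W)} {g : C → W} {B' : Set (Atom σ W')}
    {g' : C → W'} {G : Set C} (h : F.Agree B g B' g' G) : F.Agree B' g' B g G :=
  fun φ hφ v hv => (h φ hφ v hv).symm

/-- A tuple of copies is traced back to the bag in which one of its elements is created. -/
theorem exists_fresh_bag {cond : Set C → Set C → Set C → Prop} {D : Set (Atom σ C)}
    {R : List (Set C) → Set (Atom σ W) × (C → W)}
    (hR : ∀ G' G t, IsSeq cond D (G' :: G :: t) →
      F.Agree (R (G :: t)).1 (R (G :: t)).2 (R (G' :: G :: t)).1 (R (G' :: G :: t)).2 (G ∩ G'))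
    {φ : Formula σ} (hφ : φ ∈ F.Φ) (hne : φ.fv.Nonempty) (u : ℕ → Copy C) (t : List (Set C))
    (ht : IsSeq cond D t) (hu : ∀ x ∈ φ.fv, u x ∈ bagDom t) :
    ∃ t₀, (∀ x ∈ φ.fv, u x ∈ bagDom t₀) ∧ (∃ x ∈ φ.fv, (u x).1 = t₀) ∧
      (φ.Sat (R t).1 ((R t).2 ∘ fun x => (u x).2) ↔
        φ.Sat (R t₀).1 ((R t₀).2 ∘ fun x => (u x).2)) := by
  induction ht with
  | single G hG =>
    obtain ⟨x, hx⟩ := hne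
    exact ⟨[G], hu, ⟨x, hx, fst_eq_of_mem_bagDom_singleton (hu x hx)⟩, Iff.rfl⟩
  | cons G' G t h hG' h1 h2 h3 ih =>
    by_cases hf : ∃ x ∈ φ.fv, (u x).1 = G' :: G :: t
    · exact ⟨_, hu, hf, Iff.rfl⟩
    · push Not at hf
      have hu' := fun x hx => (bagDom_cons (hu x hx)).resolve_left (hf x hx)
      obtain ⟨t₀, h4, h5, h6⟩ := ih fun x hx => (hu' x hx).2
      exact ⟨t₀, h4, h5, (hR G' G t (.cons G' G t h hG' h1 h2 h3) φ hφ _ fun x hx =>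
        (hu' x hx).1).symm.trans h6⟩

theorem sat_iff_of_mem_bagDom {cond : Set C → Set C → Set C → Prop} {D : Set (Atom σ C)}
    {R : List (Set C) → Set (Atom σ W) × (C → W)}
    (hR : ∀ G' G t, IsSeq cond D (G' :: G :: t) →
      F.Agree (R (G :: t)).1 (R (G :: t)).2 (R (G' :: G :: t)).1 (R (G' :: G :: t)).2 (G ∩ G'))
    {φ : Formula σ} (hφ : φ ∈ F.Φ) (hne : φ.fv.Nonempty) {u : ℕ → Copy C} {s t : List (Set C)}
    (hs : IsSeq cond D s) (ht : IsSeq cond D t)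
    (hu : ∀ x ∈ φ.fv, u x ∈ bagDom s ∧ u x ∈ bagDom t) :
    φ.Sat (R s).1 ((R s).2 ∘ fun x => (u x).2) ↔ φ.Sat (R t).1 ((R t).2 ∘ fun x => (u x).2) := by
  obtain ⟨s₀, h1, ⟨x, hx, hxs⟩, h2⟩ := exists_fresh_bag hR hφ hne u s hs fun x hx => (hu x hx).1
  obtain ⟨t₀, h3, ⟨y, hy, hyt⟩, h4⟩ := exists_fresh_bag hR hφ hne u t ht fun x hx => (hu x hx).2
  have h5 := suffix_of_mem_bagDom (h3 x hx)
  have h6 := suffix_of_mem_bagDom (h1 y hy)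
  rw [hxs] at h5
  rw [hyt] at h6
  obtain rfl : s₀ = t₀ := h5.eq_of_length (le_antisymm h5.length_le h6.length_le)
  exact h2.trans h4.symm

/-- For each bag a realization of the underlying guarded set is chosen, so that neighbouring bags
agree on their intersection. The disjoint union of the models in which these live, glued along the
bags, is a model of the unravelling. -/
theorem hasModels_of_isOpenGF [Infinite N] (hF : F.IsAdmissible) (hGF : ∀ φ ∈ F.Φ, φ.IsOpenGF)
    {neq : Prop} (hneq : neq ∨ ∀ φ ∈ F.Φ, φ.EqFree) (K : ℕ)
    (cond : Set C → Set C → Set C → Prop) : F.HasModels C N neq K cond := by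
  intro D A hD hcl hroots G₀ hG₀ B₀ g₀ hB₀
  have hne : Nonempty (Set (Atom σ (C ⊕ N)) × (C → C ⊕ N)) := ⟨(B₀, g₀)⟩
  obtain ⟨R, hR0, hR1, hR2⟩ : ∃ R : List (Set C) → Set (Atom σ (C ⊕ N)) × (C → C ⊕ N),
      R [G₀] = (B₀, g₀) ∧
      (∀ t, IsSeq cond D t → F.Realizes neq D A (t.headD ∅) (R t).1 (R t).2) ∧
      ∀ G' G t, IsSeq cond D (G' :: G :: t) →
        F.Agree (R (G :: t)).1 (R (G :: t)).2 (R (G' :: G :: t)).1 (R (G' :: G :: t)).2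
          (G ∩ G') := by
    have hr : ∀ G, ∃ p : Set (Atom σ (C ⊕ N)) × (C → C ⊕ N), (G = G₀ → p = (B₀, g₀)) ∧
        (IsMaxGuarded D G → F.Realizes neq D A G p.1 p.2) := by
      intro G
      by_cases h : G = G₀
      · exact ⟨_, fun _ => rfl, fun _ => h ▸ hB₀⟩
      · by_cases hG : IsMaxGuarded D G
        · obtain ⟨B, g, hB⟩ := hroots G hG
          exact ⟨(B, g), fun e => (h e).elim, fun _ => hB⟩
        · exact ⟨_, fun _ => rfl, fun e => (hG e).elim⟩
    choose r hr1 hr2 using hr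
    have hf : ∀ (G G' : Set C) (p : Set (Atom σ (C ⊕ N)) × (C → C ⊕ N)),
        ∃ p' : Set (Atom σ (C ⊕ N)) × (C → C ⊕ N),
          IsMaxGuarded D G' → (G ∩ G').Nonempty → F.Realizes neq D A G p.1 p.2 →
          F.Realizes neq D A G' p'.1 p'.2 ∧ F.Agree p.1 p.2 p'.1 p'.2 (G ∩ G') := by
      intro G G' p
      by_cases h : IsMaxGuarded D G' ∧ (G ∩ G').Nonempty ∧ F.Realizes neq D A G p.1 p.2
      · obtain ⟨h1, h2, h3⟩ := h
        have hcard := hcl.ncard_le h1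
        have hK := hcl.card_le
        obtain ⟨B', g', h4⟩ := hcl.exists_realizes (h3.live.mono Set.inter_subset_left) h2
          ((Set.ncard_le_ncard Set.inter_subset_right h1.prop.finite).trans hcard)
          Set.inter_subset_right h1.prop.finite (by omega) h1.prop.subset_dom
        exact ⟨(B', g'), fun _ _ _ => h4⟩
      · exact ⟨p, fun h1 h2 h3 => (h ⟨h1, h2, h3⟩).elim⟩
    choose f hf using hf
    obtain ⟨R, hRr, hRf⟩ := exists_list_recursion r f
    have hR1 : ∀ t, IsSeq cond D t → F.Realizes neq D A (t.headD ∅) (R t).1 (R t).2 := by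
      intro t ht
      induction ht with
      | single G hG => rw [hRr]; exact hr2 G hG
      | cons G' G t _ hG' _ h2 _ ih => rw [hRf]; exact (hf G G' _ hG' h2 ih).1
    refine ⟨R, (hRr G₀).trans (hr1 G₀ rfl), hR1, fun G' G t ht => ?_⟩
    cases ht with
    | cons _ _ _ h hG' _ h2 _ => rw [hRf]; exact (hf G G' _ hG' h2 (hR1 _ h)).2
  -- the piece for `t` consists of the copies in `bag(t)`, which represent the values of the
  -- realization, and of the remaining elements of its model
  let I := {t : List (Set C) // IsSeq cond D t}
  let P : I → Set (Copy C ⊕ (I × (C ⊕ N))) := fun t =>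
    {x | Sum.elim (fun p => p ∈ bagDom t.1)
      (fun y => y.1 = t ∧ y.2 ∉ (R t.1).2 '' t.1.headD ∅) x}
  let π : I → Copy C ⊕ (I × (C ⊕ N)) → C ⊕ N := fun t =>
    Sum.elim (fun p => (R t.1).2 p.2) Prod.snd
  let B : I → Set (Atom σ (C ⊕ N)) := fun t => (R t.1).1
  have hsurj : ∀ i, ∀ w ∈ dom (B i), ∃ x ∈ P i, π i x = w := by
    rintro ⟨t, ht⟩ w -
    by_cases hw : w ∈ (R t).2 '' t.headD ∅
    · obtain ⟨d, hd, rfl⟩ := hw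
      obtain ⟨G, t, rfl⟩ := List.exists_cons_of_ne_nil ht.ne_nil
      refine ⟨Sum.inl (copyAt (G :: t) d), copyAt_mem_bagDom hd, ?_⟩
      simp only [π, Sum.elim_inl, copyAt_snd]
    · exact ⟨Sum.inr (⟨t, ht⟩, w), ⟨rfl, hw⟩, rfl⟩
  have hagree : ∀ i j, ∀ φ ∈ F.Φ, ∀ v : ℕ → Copy C ⊕ (I × (C ⊕ N)),
      (∀ x ∈ φ.fv, v x ∈ P i ∧ v x ∈ P j) →
      (φ.Sat (B i) (π i ∘ v) ↔ φ.Sat (B j) (π j ∘ v)) := by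
    intro i j φ hφ v hv
    by_cases hinl : ∀ x ∈ φ.fv, ∃ p, v x = Sum.inl p
    · have : Nonempty (Copy C) := ⟨(i.1, (hG₀.prop.nonempty).some)⟩
      choose! u hu using hinl
      have h := sat_iff_of_mem_bagDom hR2 hφ (hF.guarded φ hφ).fv_nonempty (u := u) i.2 j.2
        fun x hx => by have := hv x hx; rw [hu x hx] at this; exact this
      have hπ : ∀ i : I, ∀ x ∈ φ.fv, (π i ∘ v) x = ((R i.1).2 ∘ fun x => (u x).2) x := by
        intro i x hx
        simp [π, hu x hx]
      exact (Formula.Sat.congr_fv (hπ i)).trans (h.trans (Formula.Sat.congr_fv (hπ j)).symm)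
    · push Not at hinl
      obtain ⟨x, hx, hxp⟩ := hinl
      obtain ⟨h1, h2⟩ := hv x hx
      cases hvx : v x with
      | inl p => exact (hxp p hvx).elim
      | inr y =>
        rw [hvx] at h1 h2
        obtain rfl : i = j := h1.1.symm.trans h2.1
        exact Iff.rfl
  have hinj : (∀ i, Set.InjOn (π i) (P i)) ∨ ∀ φ ∈ F.Φ, φ.EqFree := by
    refine hneq.imp_left fun hn i => ?_
    have hi := (hR1 i.1 i.2).inj hn
    rintro (p | ⟨i₁, x⟩) hp (p' | ⟨i₂, x'⟩) hp' h
    · rw [← hp.2, ← hp'.2, hi hp.1 hp'.1 h]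
    · exact (hp'.2 ⟨_, hp.1, h⟩).elim
    · exact (hp.2 ⟨_, hp'.1, h.symm⟩).elim
    · obtain rfl := hp.1
      obtain rfl := hp'.1
      obtain rfl : x = x' := h
      rfl
  have hsat := fun φ (hφ : φ ∈ F.Φ) => sat_glue_iff hF.subClosed hGF hsurj hagree hinj hφ
  have := countable_isSeq (cond := cond) hD.2
  obtain ⟨e, he, he'⟩ := exists_embedding_copy (N := N) cond D I
  have hinst : ∀ p ∈ dom (unravelling cond D), Sum.elim Sum.inl e (Sum.inl p) = Sum.inl p :=
    fun p _ => rfl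
  refine exists_model_of_embedding hF hcl.sig_subset (A := glue P π B) Sum.inl
    (j := Sum.elim Sum.inl e) ?_ hinst ?_
    (fun s hs => holds_glue hsat (hF.body_mem s hs) (hF.fv_subset s hs) fun i =>
      (hR1 i.1 i.2).holds s hs) hG₀ ?_
  · have hseq : ∀ p, Sum.inl p ∈ dom (glue P π B) → IsSeq cond D p.1 := by
      rintro p ⟨α, ⟨i, h1, -⟩, hp⟩
      have hp : p ∈ bagDom i.1 := h1 hp
      rw [← hp.2]
      exact i.2.fst_copyAt p.2
    rintro (p | x) hp (p' | x') hp' h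
    · exact congrArg Sum.inl (Sum.inl_injective h)
    · exact (he' x' p (hseq p hp) h.symm).elim
    · exact (he' x p' (hseq p' hp') h).elim
    · exact congrArg Sum.inr (he h)
  · rintro _ ⟨_, ⟨t, ht, G, hG, α, hα, hαG, rfl⟩, rfl⟩
    obtain ⟨G', t, rfl⟩ := List.exists_cons_of_ne_nil ht.ne_nil
    simp only [List.head?_cons, Option.mem_def, Option.some.injEq] at hG
    subst hG
    refine ⟨⟨_, ht⟩, ?_, ?_⟩
    · rw [Atom.map_map, Atom.elems_map]
      rintro _ ⟨d, hd, rfl⟩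
      exact copyAt_mem_bagDom (hαG hd)
    · rw [Atom.map_map, Atom.map_map, Atom.map_congr (f := (π ⟨_, ht⟩ ∘ Sum.inl) ∘ copyAt (G' :: t))
        (g := (R (G' :: t)).2) fun d _ => by simp [π, copyAt_snd]]
      exact (hR1 _ ht).facts α hα hαG
  · intro φ hφ v hv
    have h := hsat φ hφ ⟨[G₀], .single _ hG₀⟩ (fun x => Sum.inl (copyAt [G₀] (v x))) fun x hx =>
      copyAt_mem_bagDom (hv x hx)
    refine Iff.trans ?_ h.symm
    simp only [B, hR0]
    refine Formula.Sat.congr_fv fun x hx => ?_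
    simp [π, hR0, copyAt_snd]

end Frame

/-! ### Instances over symbols of arity at most two -/

section Binary

variable {σ : Type*} [Vocab σ] {C : Type*} {D : Set (Atom σ C)}

/-- The closed neighbourhood of `d` in `D`. -/
def closedNbhd (D : Set (Atom σ C)) (d : C) : Set C :=
  {c | ∃ α ∈ D, d ∈ α.elems ∧ c ∈ α.elems}

theorem self_mem_closedNbhd {c d : C} (h : c ∈ closedNbhd D d) : d ∈ closedNbhd D d := by
  obtain ⟨α, hα, h, -⟩ := h
  exact ⟨α, hα, h, h⟩

theorem mem_closedNbhd_symm {c d : C} (h : c ∈ closedNbhd D d) : d ∈ closedNbhd D c := by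
  obtain ⟨α, hα, h1, h2⟩ := h
  exact ⟨α, hα, h2, h1⟩

theorem closedNbhd_subset_dom (D : Set (Atom σ C)) (d : C) : closedNbhd D d ⊆ dom D :=
  fun _ ⟨α, hα, _, h⟩ => ⟨α, hα, h⟩

theorem IsMaxGuarded.mem_closedNbhd {G : Set C} (hG : IsMaxGuarded D G) {c d : C} (hd : d ∈ G)
    (hc : c ∈ G) : c ∈ closedNbhd D d := by
  obtain ⟨α, hα, rfl⟩ := hG.exists_atom
  exact ⟨α, hα, hd, hc⟩

theorem IsMaxGuarded.exists_eq_pair (hbin : ∀ α ∈ D, Vocab.arity α.rel ≤ 2) {G : Set C}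
    (hG : IsMaxGuarded D G) {d : C} (hd : d ∈ G) :
    ∃ c, G = {d, c} := by
  obtain ⟨α, hα, rfl⟩ := hG.exists_atom
  obtain ⟨c, hc, h⟩ := Atom.exists_elems_subset_pair (hbin α hα) hd
  refine ⟨c, Set.Subset.antisymm h ?_⟩
  rintro x (rfl | rfl) <;> assumption

theorem IsMaxGuarded.eq_pair (hbin : ∀ α ∈ D, Vocab.arity α.rel ≤ 2) {G : Set C}
    (hG : IsMaxGuarded D G) {d c : C} (hd : d ∈ G) (hc : c ∈ G) (hne : c ≠ d) : G = {d, c} := by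
  obtain ⟨b, rfl⟩ := hG.exists_eq_pair hbin hd
  rcases hc with rfl | rfl
  exacts [(hne rfl).elim, rfl]

theorem IsMaxGuarded.eq_of_mem_inter (hbin : ∀ α ∈ D, Vocab.arity α.rel ≤ 2) {G G' : Set C}
    (hG : IsMaxGuarded D G) (hG' : IsMaxGuarded D G') (hne : G ≠ G') {d c : C}
    (hd : d ∈ G ∩ G') (hc : c ∈ G ∩ G') :
    c = d := by
  by_contra h
  exact hne ((hG.eq_pair hbin hd.1 hc.1 h).trans (hG'.eq_pair hbin hd.2 hc.2 h).symm)

theorem isMaxGuarded_pair (hbin : ∀ α ∈ D, Vocab.arity α.rel ≤ 2) (hD : D.Finite) {d c : C}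
    (hc : c ∈ closedNbhd D d) (hne : c ≠ d) :
    IsMaxGuarded D {d, c} := by
  obtain ⟨α, hα, h1, h2⟩ := hc
  obtain ⟨G, hαG, hG⟩ := IsGuarded.exists_isMaxGuarded hD
    (Or.inr ⟨α, hα, rfl⟩ : IsGuarded D α.elems)
  rwa [← hG.eq_pair hbin (hαG h1) (hαG h2) hne]

end Binary

/-! ### Stars -/

/-- By Dickson's lemma, every vector in a set of vectors lies above a vector of bounded size in the
set. -/
theorem exists_bound_of_subset_pi {κ : Type*} [Finite κ] (S : Set (κ → ℕ)) :
    ∃ K, ∀ ν ∈ S, ∃ ν' ≤ ν, ν' ∈ S ∧ Nat.card (Σ k, Fin (ν' k)) ≤ K := by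
  have hfin : {ν | Minimal (· ∈ S) ν}.Finite :=
    WellQuasiOrderedLE.finite_of_isAntichain (setOfPred_minimal_antichain _)
  obtain ⟨K, hK⟩ := (hfin.image fun ν => Nat.card (Σ k, Fin (ν k))).bddAbove
  refine ⟨K, fun ν hν => ?_⟩
  obtain ⟨ν', h1, h2⟩ := exists_minimal_le_of_wellFoundedLT (· ∈ S) ν hν
  exact ⟨ν', h1, h2.prop, hK ⟨ν', h2, rfl⟩⟩

namespace Frame

variable {σ : Type*} [Vocab σ] (F : Frame σ) {C N W : Type*}

/-- The tuple of length `m + 1` with entries `d` and `c`. -/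
def pairTuple {X : Type*} (d c : X) : Fin (F.m + 1) → X := fun i => if i = 0 then d else c

variable {F}

theorem comp_pairTuple {X Y : Type*} (g : X → Y) (d c : X) :
    g ∘ F.pairTuple d c = F.pairTuple (g d) (g c) := by
  funext i
  simp only [pairTuple, Function.comp_apply]
  split <;> rfl

theorem range_pairTuple (hm : 1 ≤ F.m) {X : Type*} (d c : X) :
    Set.range (F.pairTuple d c) = {d, c} := by
  ext x
  constructor
  · rintro ⟨i, rfl⟩
    by_cases hi : i = 0 <;> simp [pairTuple, hi]
  · rintro (rfl | rfl)
    · exact ⟨0, by simp [pairTuple]⟩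
    · refine ⟨Fin.last _, ?_⟩
      have : Fin.last F.m ≠ 0 := by
        rw [Ne, Fin.ext_iff]
        simp only [Fin.val_last, Fin.val_zero]
        omega
      simp [pairTuple, this]

variable (F) in
/-- A star with `ν k` neighbours whose types belong to `k`, for each set `k` of types, in a model of
the ontology. -/
def HasStar (W : Type*) (ν : Set F.Ty → ℕ) : Prop :=
  ∃ (B : Set (Atom σ W)) (b : W) (y : (Σ k, Fin (ν k)) → W), (∀ s ∈ F.O, s.Holds B) ∧ b ∈ dom B ∧
    (∀ z, y z ∈ dom B ∧ y z ≠ b ∧ F.typeOf B (F.pairTuple b (y z)) ∈ z.1) ∧ Function.Injective y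

theorem exists_starBound (F : Frame σ) (W : Type*) : ∃ K, ∀ ν : Set F.Ty → ℕ,
    (∀ ν' ≤ ν, Nat.card (Σ k, Fin (ν' k)) ≤ K → F.HasStar W ν') → F.HasStar W ν := by
  obtain ⟨K, hK⟩ := exists_bound_of_subset_pi {ν | ¬ F.HasStar W ν}
  refine ⟨K, fun ν h => ?_⟩
  by_contra hν
  obtain ⟨ν', h1, h2, h3⟩ := hK ν hν
  exact h2 (h ν' h1 h3)

/-- `g` represents the closed neighbourhood of `d` in `B` so that each edge at `d` is realized. -/
structure IsStar (F : Frame σ) (D : Set (Atom σ C)) (A : Set (Atom (σ ⊕ IDB) (C ⊕ N))) (d : C)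
    (p : Set (Atom σ W) × (C → W)) : Prop where
  inj : Set.InjOn p.2 (closedNbhd D d)
  realizes : ∀ c ∈ closedNbhd D d, F.Realizes True D A {d, c} p.1 p.2

theorem Realizes.of_agree {D : Set (Atom σ C)} {A : Set (Atom (σ ⊕ IDB) (C ⊕ N))}
    {G : Set C} {W' : Type*} {B : Set (Atom σ W)} {g : C → W} {B' : Set (Atom σ W')} {g' : C → W'}
    (h : F.Realizes True D A G B g) (hagree : F.Agree B g B' g' G)
    (hfacts : ∀ α ∈ D, α.elems ⊆ G → ∃ (f : C → ℕ) (v : ℕ → C), Formula.atom (α.map f) ∈ F.Φ ∧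
      ∀ x ∈ α.elems, v (f x) = x)
    (hO : ∀ s ∈ F.O, s.Holds B') (hdom : ∀ x ∈ G, g' x ∈ dom B') (hinj : Set.InjOn g' G) :
    F.Realizes True D A G B' g' := by
  refine ⟨hO, hdom, fun _ => hinj, fun α hα hαG => ?_, fun c hc Θ hΘ => ?_⟩
  · obtain ⟨f, v, h1, h2⟩ := hfacts α hα hαG
    have h3 := hagree _ h1 v fun x hx => by
      rw [Formula.fv, Atom.mem_vars, Atom.elems_map] at hx
      obtain ⟨y, hy, rfl⟩ := hx
      rw [h2 y hy]
      exact hαG hy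
    simp only [Formula.Sat, Atom.map_map] at h3
    rw [Atom.map_congr (f := (g ∘ v) ∘ f) (g := g) fun x hx => by simp [h2 x hx],
      Atom.map_congr (f := (g' ∘ v) ∘ f) (g := g') fun x hx => by simp [h2 x hx]] at h3
    exact h3.1 (h.facts α hα hαG)
  · rw [← typeOf_eq_of_agree fun φ hφ v hv => hagree φ hφ v fun x hx => hc (hv x hx)]
    exact h.live c hc Θ hΘ

/-- A realization of an edge at `d` extends to the star at `d`. A star could fail to exist only due
to a set of neighbours of bounded size, and small sets can be realized. -/
theorem IsClosed.exists_isStar {K K₀ : ℕ} {D : Set (Atom σ C)} (hD : IsInstance D)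
    {A : Set (Atom (σ ⊕ IDB) (C ⊕ N))} (hcl : F.IsClosed True K D A) (hm : 1 ≤ F.m)
    (hatoms : ∀ r ∈ F.S, ∀ f : Fin (Vocab.arity r) → ℕ, (∀ i, f i < 2) →
      Formula.atom ⟨r, f⟩ ∈ F.Φ)
    (hK₀ : ∀ ν : Set F.Ty → ℕ, (∀ ν' ≤ ν, Nat.card (Σ k, Fin (ν' k)) ≤ K₀ →
      F.HasStar (C ⊕ N) ν') → F.HasStar (C ⊕ N) ν) (hK : K₀ + 2 ≤ K) {d c₀ : C}
    (hmax : IsMaxGuarded D {d, c₀}) {B₀ : Set (Atom σ (C ⊕ N))} {g₀ : C → C ⊕ N}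
    (hB₀ : F.Realizes True D A {d, c₀} B₀ g₀) :
    ∃ p : Set (Atom σ (C ⊕ N)) × (C → C ⊕ N), F.IsStar D A d p ∧
      F.Agree B₀ g₀ p.1 p.2 {d, c₀} := by
  classical
  have hfacts : ∀ c, ∀ α ∈ D, α.elems ⊆ {d, c} → ∃ (f : C → ℕ) (v : ℕ → C),
      Formula.atom (α.map f) ∈ F.Φ ∧ ∀ x ∈ α.elems, v (f x) = x := by
    intro c α hα hαG
    refine ⟨fun x => if x = d then 0 else 1, fun n => if n = 0 then d else c,
      hatoms _ (hcl.sig_subset ⟨α, hα, rfl⟩) _ fun i => ?_, fun x hx => ?_⟩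
    · simp only [Function.comp_apply]
      split <;> omega
    · by_cases hxd : x = d
      · simp [hxd]
      · rcases hαG hx with h | h
        · exact (hxd h).elim
        · simp [hxd, h.symm]
  -- a singleton that is maximal guarded is the whole star
  by_cases hcd : c₀ = d
  · subst hcd
    have hsub : closedNbhd D c₀ ⊆ {c₀} := by
      rintro c ⟨α, hα, h1, h2⟩
      have := hmax.eq_of_le (Or.inr ⟨α, hα, rfl⟩) (by simpa using h1)
      rw [← this] at h2
      simpa using h2
    refine ⟨(B₀, g₀), ⟨Set.subsingleton_singleton.anti hsub |>.injOn _, fun c hc => ?_⟩,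
      fun _ _ _ _ => Iff.rfl⟩
    rw [hsub hc]
    exact hB₀
  -- the colour of a neighbour is the set of its possible types; for `c₀` it is prescribed
  set T₀ : F.Ty := F.typeOf B₀ (F.pairTuple (g₀ d) (g₀ c₀)) with hT₀
  let L : C → Set F.Ty := fun c => {T | ∃ (B : Set (Atom σ (C ⊕ N))) (g : C → C ⊕ N),
    F.Realizes True D A {d, c} B g ∧ F.typeOf B (F.pairTuple (g d) (g c)) = T ∧ (c = c₀ → T = T₀)}
  let M := closedNbhd D d \ {d}
  have hMfin : M.Finite := ((dom_finite hD.2).subset (closedNbhd_subset_dom D d)).sdiff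
  have hc₀M : c₀ ∈ M := ⟨hmax.mem_closedNbhd (by simp) (by simp), hcd⟩
  have := hMfin.to_subtype
  let ν : Set F.Ty → ℕ := fun k => Nat.card {c : M // L c = k}
  let E : M ≃ Σ k, Fin (ν k) := (Equiv.sigmaFiberEquiv fun c : M => L c).symm.trans
    (Equiv.sigmaCongrRight fun k => Finite.equivFin _)
  have hE : ∀ c, (E c).1 = L c := fun c => rfl
  have hE' : ∀ z, L (E.symm z) = z.1 := fun z => by rw [← hE, E.apply_symm_apply]
  obtain ⟨B, b, y, hO, hb, hy, hyinj⟩ := hK₀ ν fun ν' hν' hcard => by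
    let ι : (Σ k, Fin (ν' k)) → C := fun z => E.symm ⟨z.1, Fin.castLE (hν' z.1) z.2⟩
    have hιinj : Function.Injective ι := by
      rintro ⟨k, i⟩ ⟨k', i'⟩ h
      have h := E.symm.injective (Subtype.ext h)
      simp only [Sigma.mk.injEq] at h
      obtain ⟨rfl, h⟩ := h
      rw [Fin.castLE_injective _ (eq_of_heq h)]
    have hιM : ∀ z, ι z ∈ M := fun z => Subtype.mem _
    have hιL : ∀ z, L (ι z) = z.1 := fun z => hE' _
    -- a realization of this small set of neighbours that extends the given edge
    set G' : Set C := {d, c₀} ∪ Set.range ι with hG'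
    have hGK : G'.ncard ≤ K := by
      have h1 : G'.ncard ≤ _ := Set.ncard_union_le {d, c₀} (Set.range ι)
      have h2 : ({d, c₀} : Set C).ncard ≤ 2 := Set.ncard_insert_le _ _ |>.trans (by simp)
      have h3 : (Set.range ι).ncard = Nat.card (Σ k, Fin (ν' k)) := by
        rw [← Set.image_univ, Set.ncard_image_of_injective _ hιinj, Set.ncard_univ]
      omega
    have hGD : G' ⊆ dom D := Set.union_subset hmax.prop.subset_dom
      (by rintro _ ⟨z, rfl⟩; exact closedNbhd_subset_dom D d (hιM z).1)
    obtain ⟨B', g', h1, h2⟩ := hcl.exists_realizes hB₀.live ⟨d, by simp⟩ (hcl.ncard_le hmax)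
      Set.subset_union_left ((dom_finite hD.2).subset hGD) hGK hGD
    have hιG : ∀ z, ι z ∈ G' := fun z => Or.inr ⟨z, rfl⟩
    have hdG : d ∈ G' := Or.inl (by simp)
    refine ⟨B', g' d, g' ∘ ι, h1.holds, h1.mem_dom d hdG, fun z => ⟨h1.mem_dom _ (hιG z), ?_, ?_⟩,
      fun z z' h => hιinj (h1.inj trivial (hιG z) (hιG z') h)⟩
    · exact fun h => (hιM z).2 (h1.inj trivial (hιG z) hdG h)
    · rw [← hιL z]
      refine ⟨B', g', h1.mono ?_, rfl, fun h => ?_⟩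
      · rintro x (rfl | rfl)
        exacts [hdG, hιG z]
      · have h3 : F.typeOf B₀ (g₀ ∘ F.pairTuple d c₀) = F.typeOf B' (g' ∘ F.pairTuple d c₀) := by
          refine typeOf_eq_of_agree ?_
          rw [range_pairTuple hm]
          exact h2
        rw [comp_pairTuple, comp_pairTuple] at h3
        rw [hT₀, h3, Function.comp_apply, h]
  let g : C → C ⊕ N := fun c => if h : c ∈ M then y (E ⟨c, h⟩) else b
  have hgd : g d = b := dif_neg fun h => h.2 rfl
  have hgM : ∀ c (h : c ∈ M), g c = y (E ⟨c, h⟩) := fun c h => dif_pos h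
  have hginj : Set.InjOn g (closedNbhd D d) := by
    intro c hc c' hc' h
    by_cases e : c = d <;> by_cases e' : c' = d
    · rw [e, e']
    · rw [e, hgd, hgM c' ⟨hc', e'⟩] at h
      exact ((hy _).2.1 h.symm).elim
    · rw [e', hgd, hgM c ⟨hc, e⟩] at h
      exact ((hy _).2.1 h).elim
    · rw [hgM c ⟨hc, e⟩, hgM c' ⟨hc', e'⟩] at h
      exact congrArg Subtype.val (E.injective (hyinj h))
  have agree_of_eq : ∀ {c : C} {B₁ : Set (Atom σ (C ⊕ N))} {g₁ : C → C ⊕ N},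
      F.typeOf B₁ (F.pairTuple (g₁ d) (g₁ c)) = F.typeOf B (F.pairTuple (g d) (g c)) →
      F.Agree B₁ g₁ B g {d, c} := by
    intro c B₁ g₁ h φ hφ v hv
    rw [← comp_pairTuple, ← comp_pairTuple] at h
    exact agree_of_typeOf_eq h hφ fun x hx => by rw [range_pairTuple hm]; exact hv x hx
  have hstar : ∀ c ∈ M, F.Realizes True D A {d, c} B g ∧
      (c = c₀ → F.typeOf B (F.pairTuple (g d) (g c)) = T₀) := by
    intro c hc
    have h := (hy (E ⟨c, hc⟩)).2.2
    rw [hE, ← hgM c hc, ← hgd] at h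
    obtain ⟨B₁, g₁, h1, h2, h3⟩ := h
    refine ⟨h1.of_agree (agree_of_eq h2) (hfacts c) hO ?_ (hginj.mono ?_), h3⟩
    · rintro x (rfl | rfl)
      · rw [hgd]; exact hb
      · rw [hgM _ hc]; exact (hy _).1
    · rintro x (rfl | rfl)
      exacts [self_mem_closedNbhd hc.1, hc.1]
  refine ⟨(B, g), ⟨hginj, fun c hc => ?_⟩, agree_of_eq ((hstar c₀ hc₀M).2 rfl).symm⟩
  by_cases hne : c = d
  · rw [hne]
    exact (hstar c₀ hc₀M).1.mono (by simp)
  · exact (hstar c ⟨hc, hne⟩).1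

end Frame

/-! ### Stars at the copies of constants -/

section Neighbours

variable {σ : Type*} [Vocab σ] {C : Type*} {D : Set (Atom σ C)}

/-- The copies that are created in the uGC₂-unravelling. -/
def IsCopy (D : Set (Atom σ C)) (p : Copy C) : Prop :=
  IsSeq condUGC2 D p.1 ∧ p ∈ bagDom p.1

theorem copyAt_mem_bagDom_fst {G : Set C} {t : List (Set C)} {d : C} (hd : d ∈ G) :
    copyAt (G :: t) d ∈ bagDom (copyAt (G :: t) d).1 := by
  induction t generalizing G with
  | nil => exact copyAt_mem_bagDom hd
  | cons G₁ t ih =>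
    by_cases h : d ∈ G₁
    · rw [copyAt_cons_of_mem h]
      exact ih h
    · have := copyAt_mem_bagDom (t := G₁ :: t) hd
      rwa [copyAt_cons_of_notMem h] at this ⊢

theorem IsSeq.isCopy {t : List (Set C)} (ht : IsSeq condUGC2 D t) {d : C} (hd : d ∈ t.headD ∅) :
    IsCopy D (copyAt t d) := by
  refine ⟨ht.fst_copyAt d, ?_⟩
  obtain ⟨G, t, rfl⟩ := List.exists_cons_of_ne_nil ht.ne_nil
  exact copyAt_mem_bagDom_fst hd

open Classical in
/-- A sequence whose last bag contains the copy `p` and a copy of `c`, for neighbours `c` of the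
constant of which `p` is a copy. -/
noncomputable def edgeSeq (p : Copy C) (c : C) : List (Set C) :=
  if c ∈ p.1.headD ∅ then p.1 else {p.2, c} :: p.1

/-- The copy of `c` that is adjacent to the copy `p`. -/
noncomputable def nbrCopy (p : Copy C) (c : C) : Copy C := copyAt (edgeSeq p c) c

theorem edgeSeq_of_mem {p : Copy C} {c : C} (h : c ∈ p.1.headD ∅) : edgeSeq p c = p.1 :=
  if_pos h

theorem edgeSeq_of_notMem {p : Copy C} {c : C} (h : c ∉ p.1.headD ∅) :
    edgeSeq p c = {p.2, c} :: p.1 :=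
  if_neg h

theorem IsCopy.edgeSeq_spec (hbin : ∀ α ∈ D, Vocab.arity α.rel ≤ 2) (hD : D.Finite) {p : Copy C}
    (hp : IsCopy D p) {c : C} (hc : c ∈ closedNbhd D p.2) (hne : c ≠ p.2) :
    IsSeq condUGC2 D (edgeSeq p c) ∧ (edgeSeq p c).headD ∅ = {p.2, c} ∧
      copyAt (edgeSeq p c) p.2 = p := by
  obtain ⟨t, d⟩ := p
  obtain ⟨ht, hd, hcopy⟩ := hp
  simp only at ht hd hc hne hcopy ⊢
  obtain ⟨G, t, rfl⟩ := List.exists_cons_of_ne_nil ht.ne_nil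
  have hd : d ∈ G := hd
  have hG := ht.isMaxGuarded G (by simp)
  by_cases h : c ∈ G
  · rw [edgeSeq_of_mem (p := (G :: t, d)) h]
    exact ⟨ht, hG.eq_pair hbin hd h hne, hcopy⟩
  · rw [edgeSeq_of_notMem (p := (G :: t, d)) h]
    refine ⟨.cons _ G t ht (isMaxGuarded_pair hbin hD hc hne) ?_ ⟨d, hd, by simp⟩ ?_, rfl, ?_⟩
    · exact fun e => h (by rw [e]; simp)
    · intro F hF
      obtain ⟨t, rfl⟩ : ∃ t', t = F :: t' := by
        cases t with
        | nil => simp at hF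
        | cons F' t =>
          simp only [List.head?_cons, Option.mem_def, Option.some.injEq] at hF
          exact ⟨t, by rw [hF]⟩
      have hdF : d ∉ F := by
        intro hdF
        rw [copyAt_cons_of_mem hdF] at hcopy
        have h1 := (copyAt_suffix (F :: t) d).length_le
        rw [hcopy] at h1
        simp at h1
      intro e
      exact hdF (e.symm.subset ⟨hd, by simp⟩ : d ∈ G ∩ F).2
    · rw [copyAt_cons_of_mem hd]
      exact hcopy

/-- The edges of the last bag lead to the adjacent copies. If `d` is kept from the preceding bag,
then its copy was created there: this is what the condition on sequences of the uGC₂-unravelling says. -/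
theorem nbrCopy_copyAt (hbin : ∀ α ∈ D, Vocab.arity α.rel ≤ 2) {t : List (Set C)}
    (ht : IsSeq condUGC2 D t) {d c : C} (hd : d ∈ t.headD ∅) (hc : c ∈ t.headD ∅) (hne : c ≠ d) :
    nbrCopy (copyAt t d) c = copyAt t c := by
  cases ht with
  | single G hG => rw [nbrCopy, copyAt_singleton, edgeSeq_of_mem (p := ([G], d)) hc]
  | cons G' G t h hG' hGG' hne' hcond =>
    have hG := h.isMaxGuarded G (by simp)
    by_cases hdG : d ∈ G
    · have hcG : c ∉ G := fun hcG => hne (hG.eq_of_mem_inter hbin hG' hGG' ⟨hdG, hd⟩ ⟨hcG, hc⟩)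
      have hcopy : copyAt (G' :: G :: t) d = (G :: t, d) := by
        rw [copyAt_cons_of_mem hdG]
        cases h with
        | single _ _ => rfl
        | cons _ G₂ t h _ hGG₂ _ _ =>
          refine copyAt_cons_of_notMem fun hdG₂ => hcond G₂ (by simp) ?_
          have hG₂ := h.isMaxGuarded G₂ (by simp)
          ext x
          constructor
          · rintro hx
            rw [hG.eq_of_mem_inter hbin hG₂ hGG₂.symm ⟨hdG, hdG₂⟩ hx]
            exact ⟨hdG, hd⟩
          · rintro hx
            rw [hG.eq_of_mem_inter hbin hG' hGG' ⟨hdG, hd⟩ hx]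
            exact ⟨hdG, hdG₂⟩
      rw [nbrCopy, hcopy, edgeSeq_of_notMem (p := (G :: t, d)) hcG, hG'.eq_pair hbin hd hc hne]
    · rw [nbrCopy, copyAt_cons_of_notMem hdG, edgeSeq_of_mem (p := (G' :: G :: t, d)) hc]

theorem IsCopy.nbrCopy_spec (hbin : ∀ α ∈ D, Vocab.arity α.rel ≤ 2) (hD : D.Finite) {p : Copy C}
    (hp : IsCopy D p) {c : C} (hc : c ∈ closedNbhd D p.2) (hne : c ≠ p.2) :
    IsCopy D (nbrCopy p c) ∧ (nbrCopy p c).2 = c ∧ nbrCopy (nbrCopy p c) p.2 = p := by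
  obtain ⟨h1, h2, h3⟩ := hp.edgeSeq_spec hbin hD hc hne
  refine ⟨h1.isCopy (by rw [h2]; simp), copyAt_snd _ _, ?_⟩
  have := nbrCopy_copyAt hbin h1 (d := c) (c := p.2) (by rw [h2]; exact Or.inr rfl)
    (by rw [h2]; exact Or.inl rfl) hne.symm
  rw [h3] at this
  exact this

end Neighbours

namespace Frame

variable {σ : Type*} [Vocab σ] {C N W : Type*} {F : Frame σ}

/-- A choice of stars at all copies of constants, so that stars at adjacent copies agree on the edge
between them. -/
theorem exists_stars {D : Set (Atom σ C)} (hD : IsInstance D)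
    {A : Set (Atom (σ ⊕ IDB) (C ⊕ N))} (hbin : ∀ α ∈ D, Vocab.arity α.rel ≤ 2)
    (hstar : ∀ (d c₀ : C), IsMaxGuarded D {d, c₀} → ∀ (B₀ : Set (Atom σ (C ⊕ N)))
      (g₀ : C → C ⊕ N), F.Realizes True D A {d, c₀} B₀ g₀ →
      ∃ p : Set (Atom σ (C ⊕ N)) × (C → C ⊕ N), F.IsStar D A d p ∧
        F.Agree B₀ g₀ p.1 p.2 {d, c₀})
    (hroots : ∀ G, IsMaxGuarded D G →
      ∃ (B : Set (Atom σ (C ⊕ N))) (g : C → C ⊕ N), F.Realizes True D A G B g)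
    {G₀ : Set C} {B₀ : Set (Atom σ (C ⊕ N))} {g₀ : C → C ⊕ N}
    (hB₀ : F.Realizes True D A G₀ B₀ g₀) :
    ∃ S : Copy C → Set (Atom σ (C ⊕ N)) × (C → C ⊕ N),
      (∀ p, IsCopy D p → F.IsStar D A p.2 (S p)) ∧
      (∀ p, IsCopy D p → ∀ c ∈ closedNbhd D p.2, c ≠ p.2 →
        F.Agree (S p).1 (S p).2 (S (nbrCopy p c)).1 (S (nbrCopy p c)).2 {p.2, c}) ∧
      (IsMaxGuarded D G₀ → ∀ d ∈ G₀,
        F.Agree B₀ g₀ (S (copyAt [G₀] d)).1 (S (copyAt [G₀] d)).2 G₀) := by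
  have hne : Nonempty (Set (Atom σ (C ⊕ N)) × (C → C ⊕ N)) := ⟨(B₀, g₀)⟩
  have hroot : ∀ G, ∃ r : Set (Atom σ (C ⊕ N)) × (C → C ⊕ N), (G = G₀ → r = (B₀, g₀)) ∧
      (IsMaxGuarded D G → F.Realizes True D A G r.1 r.2) := by
    intro G
    by_cases h : G = G₀
    · exact ⟨_, fun _ => rfl, fun _ => h ▸ hB₀⟩
    · by_cases hG : IsMaxGuarded D G
      · obtain ⟨B, g, hB⟩ := hroots G hG
        exact ⟨(B, g), fun e => (h e).elim, fun _ => hB⟩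
      · exact ⟨_, fun _ => rfl, fun e => (hG e).elim⟩
  choose base hbase₀ hbase using hroot
  have hr : ∀ G d, ∃ p : Set (Atom σ (C ⊕ N)) × (C → C ⊕ N), IsMaxGuarded D G → d ∈ G →
      F.IsStar D A d p ∧ F.Agree (base G).1 (base G).2 p.1 p.2 G := by
    intro G d
    by_cases h : IsMaxGuarded D G ∧ d ∈ G
    · obtain ⟨hG, hd⟩ := h
      have hB := hbase G hG
      obtain ⟨c, rfl⟩ := hG.exists_eq_pair hbin hd
      obtain ⟨p, hp⟩ := hstar d c hG _ _ hB
      exact ⟨p, fun _ _ => hp⟩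
    · exact ⟨base G, fun h1 h2 => (h ⟨h1, h2⟩).elim⟩
  choose r hr using hr
  have hf : ∀ (G G' : Set C) (S : C → Set (Atom σ (C ⊕ N)) × (C → C ⊕ N)) (d : C),
      ∃ p : Set (Atom σ (C ⊕ N)) × (C → C ⊕ N), (d ∈ G → p = S d) ∧
        (d ∉ G → d ∈ G' → IsMaxGuarded D G' → ∀ d' ∈ G ∩ G', F.IsStar D A d' (S d') →
          F.IsStar D A d p ∧ F.Agree (S d').1 (S d').2 p.1 p.2 G') := by
    intro G G' S d
    by_cases hd : d ∈ G
    · exact ⟨_, fun _ => rfl, fun h => (h hd).elim⟩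
    by_cases h : d ∈ G' ∧ IsMaxGuarded D G' ∧ ∃ d' ∈ G ∩ G', F.IsStar D A d' (S d')
    · obtain ⟨hd', hG', d', ⟨h1, h2⟩, h3⟩ := h
      have hne : d' ≠ d := fun e => hd (e ▸ h1)
      have hpair := hG'.eq_pair hbin hd' h2 hne
      obtain ⟨p, hp⟩ := hstar d d' (hpair ▸ hG') (S d').1 (S d').2 (by
        rw [Set.pair_comm]
        exact h3.realizes d (hG'.mem_closedNbhd h2 hd'))
      refine ⟨p, fun e => (hd e).elim, fun _ _ _ d'' ⟨h4, h5⟩ _ => ?_⟩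
      obtain rfl : d'' = d' := by
        rw [hpair] at h5
        exact h5.resolve_left fun e => hd (e ▸ h4)
      rw [← hpair] at hp
      exact hp
    · exact ⟨S d, fun e => rfl, fun _ h1 h2 d' h3 h4 => (h ⟨h1, h2, d', h3, h4⟩).elim⟩
  choose f hf₁ hf₂ using hf
  obtain ⟨St, hSt₁, hSt₂⟩ := exists_list_recursion r f
  have hSt : ∀ t, IsSeq condUGC2 D t → ∀ d ∈ t.headD ∅, F.IsStar D A d (St t d) := by
    intro t ht
    induction ht with
    | single G hG => rw [hSt₁]; exact fun d hd => (hr G d hG hd).1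
    | cons G' G t _ hG' _ h2 _ ih =>
      intro d hd
      rw [hSt₂]
      by_cases hdG : d ∈ G
      · rw [hf₁ _ _ _ _ hdG]; exact ih d hdG
      · obtain ⟨d', hd'⟩ := h2
        exact (hf₂ _ _ _ _ hdG hd hG' d' hd' (ih d' hd'.1)).1
  have hcopy : ∀ t, IsSeq condUGC2 D t → ∀ d ∈ t.headD ∅,
      St (copyAt t d).1 (copyAt t d).2 = St t d := by
    intro t ht
    induction ht with
    | single G hG => intro d _; rfl
    | cons G' G t _ hG' _ h2 _ ih =>
      intro d hd
      by_cases hdG : d ∈ G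
      · rw [copyAt_cons_of_mem hdG, hSt₂, hf₁ _ _ _ _ hdG]; exact ih d hdG
      · rw [copyAt_cons_of_notMem hdG]
  have hedge : ∀ t, IsSeq condUGC2 D t → ∀ d ∈ t.headD ∅, ∀ c ∈ t.headD ∅,
      F.Agree (St t d).1 (St t d).2 (St t c).1 (St t c).2 (t.headD ∅) := by
    intro t ht
    cases ht with
    | single G hG =>
      intro d hd c hc φ hφ v hv
      rw [hSt₁]
      exact ((hr G d hG hd).2 φ hφ v hv).symm.trans ((hr G c hG hc).2 φ hφ v hv)
    | cons G' G t h hG' h1 h2 _ =>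
      have key : ∀ d ∈ G', ∀ c ∈ G', d ∈ G → c ∉ G → F.Agree (St (G' :: G :: t) d).1
          (St (G' :: G :: t) d).2 (St (G' :: G :: t) c).1 (St (G' :: G :: t) c).2 G' := by
        intro d hd c hc hdG hcG
        rw [hSt₂, hf₁ _ _ _ _ hdG]
        exact (hf₂ _ _ _ _ hcG hc hG' d ⟨hdG, hd⟩ (hSt _ h d hdG)).2
      intro d hd c hc
      have hG := h.isMaxGuarded G (by simp)
      by_cases hdG : d ∈ G <;> by_cases hcG : c ∈ G
      · rw [hG.eq_of_mem_inter hbin hG' h1 ⟨hcG, hc⟩ ⟨hdG, hd⟩]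
        exact fun _ _ _ _ => Iff.rfl
      · exact key d hd c hc hdG hcG
      · exact (key c hc d hd hcG hdG).symm
      · obtain ⟨d', hd'G, hd'⟩ := h2
        have h3 : d' ≠ d := fun e => hdG (e ▸ hd'G)
        obtain rfl : c = d := by
          have hc : c ∈ G' := hc
          rw [hG'.eq_pair hbin hd hd' h3] at hc
          exact hc.resolve_right fun e => hcG (e ▸ hd'G)
        exact fun _ _ _ _ => Iff.rfl
  refine ⟨fun p => St p.1 p.2, fun p hp => hSt _ hp.1 _ hp.2.1, fun p hp c hc hne => ?_,
    fun hG₀ d hd => ?_⟩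
  · obtain ⟨h1, h2, h3⟩ := hp.edgeSeq_spec hbin hD.2 hc hne
    have h4 := hedge _ h1 p.2 (by rw [h2]; simp) c (by rw [h2]; simp)
    rw [← hcopy _ h1 p.2 (by rw [h2]; simp), ← hcopy _ h1 c (by rw [h2]; simp), h2, h3] at h4
    exact h4
  · have := (hr G₀ d hG₀ hd).2
    rw [hbase₀ G₀ rfl] at this
    simp only [copyAt_singleton, hSt₁]
    exact this

end Frame

/-! ### Models of the uGC₂-unravelling -/

section Sheets

variable {σ : Type*} [Vocab σ] {C W P : Type*}

/-- Stars at the elements of `P`: the star of `p` is centred at `g p (lab p)` in `B p`, and its edge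
to `g p c`, for `c ∈ nb p`, is shared with the star of `nbr p c`. -/
structure IsStarSystem (Φ : Set (Formula σ)) (B : P → Set (Atom σ W)) (g : P → C → W) (lab : P → C)
    (nb : P → Set C) (nbr : P → C → P) : Prop where
  inj : ∀ p, Set.InjOn (g p) (insert (lab p) (nb p))
  lab_notMem : ∀ p, lab p ∉ nb p
  lab_nbr : ∀ p, ∀ c ∈ nb p, lab (nbr p c) = c
  lab_mem : ∀ p, ∀ c ∈ nb p, lab p ∈ nb (nbr p c)
  nbr_nbr : ∀ p, ∀ c ∈ nb p, nbr (nbr p c) (lab p) = p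
  edge : ∀ p, ∀ c ∈ nb p, ∃ β ∈ B p, g p (lab p) ∈ β.elems ∧ g p c ∈ β.elems
  agree : ∀ p, ∀ c ∈ nb p, ∀ φ ∈ Φ, ∀ v : ℕ → C, (∀ x ∈ φ.fv, v x = lab p ∨ v x = c) →
    (φ.Sat (B p) (g p ∘ v) ↔ φ.Sat (B (nbr p c)) (g (nbr p c) ∘ v))

open Classical in
/-- The model for a system of stars has elements `(p, i, x)`, where `x` is an element of `B p` and
`i` is the number of a copy of `B p`. The edges from the centre of copy `0` to the distinguished
neighbours are replaced by edges to the centres of the stars at these neighbours; the distinguished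
neighbours in copy `i` are instead linked to the centre of copy `i + 1`. -/
noncomputable def sheetMap (g : P → C → W) (lab : P → C) (nb : P → Set C) (nbr : P → C → P)
    (z : P × ℕ × W) (y : W) : P × ℕ × W :=
  if h : z.2.2 = g z.1 (lab z.1) ∧ ∃ c ∈ nb z.1, g z.1 c = y then
    match z.2.1 with
    | 0 => (nbr z.1 h.2.choose, 0, g (nbr z.1 h.2.choose) (lab (nbr z.1 h.2.choose)))
    | i + 1 => (z.1, i, y)
  else if y = g z.1 (lab z.1) ∧ ∃ c ∈ nb z.1, g z.1 c = z.2.2 then (z.1, z.2.1 + 1, y)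
  else (z.1, z.2.1, y)

variable {Φ : Set (Formula σ)} {B : P → Set (Atom σ W)} {g : P → C → W} {lab : P → C}
  {nb : P → Set C} {nbr : P → C → P}

namespace IsStarSystem

theorem ne_center (h : IsStarSystem Φ B g lab nb nbr) {p : P} {c : C} (hc : c ∈ nb p) :
    g p c ≠ g p (lab p) := fun e =>
  h.lab_notMem p (h.inj p (Or.inr hc) (Or.inl rfl) e ▸ hc)

theorem sheetMap_zero (h : IsStarSystem Φ B g lab nb nbr) {p : P} {c : C} (hc : c ∈ nb p) :
    sheetMap g lab nb nbr (p, 0, g p (lab p)) (g p c) =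
      (nbr p c, 0, g (nbr p c) (lab (nbr p c))) := by
  have hex : ∃ c' ∈ nb p, g p c' = g p c := ⟨c, hc, rfl⟩
  have e : hex.choose = c := h.inj p (Or.inr hex.choose_spec.1) (Or.inr hc) hex.choose_spec.2
  simp only [sheetMap]
  rw [dif_pos ⟨rfl, hex⟩, e]

theorem sheetMap_succ {p : P} {i : ℕ} {c : C} (hc : c ∈ nb p) :
    sheetMap g lab nb nbr (p, i + 1, g p (lab p)) (g p c) = (p, i, g p c) := by
  simp only [sheetMap]
  rw [dif_pos ⟨rfl, c, hc, rfl⟩]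

theorem sheetMap_center (h : IsStarSystem Φ B g lab nb nbr) {p : P} {i : ℕ} {c : C}
    (hc : c ∈ nb p) :
    sheetMap g lab nb nbr (p, i, g p c) (g p (lab p)) = (p, i + 1, g p (lab p)) := by
  simp only [sheetMap]
  rw [dif_neg fun e => h.ne_center hc e.1, if_pos ⟨rfl, c, hc, rfl⟩]

theorem sheetMap_of_not {p : P} {i : ℕ} {x y : W}
    (h1 : ¬ (x = g p (lab p) ∧ ∃ c ∈ nb p, g p c = y))
    (h2 : ¬ (y = g p (lab p) ∧ ∃ c ∈ nb p, g p c = x)) :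
    sheetMap g lab nb nbr (p, i, x) y = (p, i, y) := by
  simp only [sheetMap]
  rw [dif_neg h1, if_neg h2]

theorem sheetMap_cases (h : IsStarSystem Φ B g lab nb nbr) (p : P) (i : ℕ) (x y : W) :
    (x = g p (lab p) ∧ i = 0 ∧ ∃ c ∈ nb p, y = g p c ∧
      sheetMap g lab nb nbr (p, i, x) y = (nbr p c, 0, g (nbr p c) (lab (nbr p c)))) ∨
    ∃ j, sheetMap g lab nb nbr (p, i, x) y = (p, j, y) ∧
      sheetMap g lab nb nbr (p, j, y) x = (p, i, x) := by
  by_cases h1 : x = g p (lab p) ∧ ∃ c ∈ nb p, g p c = y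
  · obtain ⟨rfl, c, hc, rfl⟩ := h1
    cases i with
    | zero => exact Or.inl ⟨rfl, rfl, c, hc, rfl, h.sheetMap_zero hc⟩
    | succ i => exact Or.inr ⟨i, sheetMap_succ hc, h.sheetMap_center hc⟩
  by_cases h2 : y = g p (lab p) ∧ ∃ c ∈ nb p, g p c = x
  · obtain ⟨rfl, c, hc, rfl⟩ := h2
    exact Or.inr ⟨i + 1, h.sheetMap_center hc, sheetMap_succ hc⟩
  · exact Or.inr ⟨i, sheetMap_of_not h1 h2, sheetMap_of_not h2 h1⟩

theorem isLocalCover (h : IsStarSystem Φ B g lab nb nbr) :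
    IsLocalCover Φ (fun z : P × ℕ × W => B z.1) (fun z => z.2.2) (sheetMap g lab nb nbr) := by
  refine ⟨?_, ?_, ?_⟩
  · rintro ⟨p, i, x⟩
    have : ¬ (x = g p (lab p) ∧ ∃ c ∈ nb p, g p c = x) := by
      rintro ⟨rfl, c, hc, e⟩
      exact h.ne_center hc e
    exact sheetMap_of_not this this
  · rintro ⟨p, i, x⟩ y - y' - e
    rcases h.sheetMap_cases p i x y with ⟨hx, hi, c, hc, rfl, h1⟩ | ⟨j, h1, -⟩ <;>
    rcases h.sheetMap_cases p i x y' with ⟨hx', hi', c', hc', rfl, h1'⟩ | ⟨j', h1', -⟩ <;>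
    rw [h1, h1'] at e <;> simp only [Prod.mk.injEq] at e
    · rw [← h.lab_nbr p c hc, e.1, h.lab_nbr p c' hc']
    · have e' := congrArg lab e.1
      rw [h.lab_nbr p c hc] at e'
      exact (h.lab_notMem p (e' ▸ hc)).elim
    · have e' := congrArg lab e.1
      rw [h.lab_nbr p c' hc'] at e'
      exact (h.lab_notMem p (e' ▸ hc')).elim
    · exact e.2.2
  · rintro ⟨p, i, x⟩ y hy
    rcases h.sheetMap_cases p i x y with ⟨rfl, rfl, c, hc, rfl, h1⟩ | ⟨j, h1, h2⟩
    · have hq := h.lab_mem p c hc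
      refine ⟨g (nbr p c) (lab p), ?_, ?_, fun φ hφ w w' hw => ?_⟩
      · rw [h1]
        exact h.edge _ _ hq
      · rw [h1, h.sheetMap_zero hq, h.nbr_nbr p c hc]
      · rw [h1] at hw ⊢
        simp only at hw ⊢
        rw [h.lab_nbr p c hc] at hw
        classical
        have h3 := h.agree p c hc φ hφ (fun x => if w x = g p c then c else lab p) fun x _ => by
          by_cases e : w x = g p c <;> simp [e]
        have hne := h.ne_center hc
        refine (Formula.Sat.congr_fv fun x hx => ?_).trans
          (h3.trans (Formula.Sat.congr_fv fun x hx => ?_))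
        · rcases hw x hx with ⟨e, -⟩ | ⟨e, -⟩ <;> simp [e, hne.symm]
        · rcases hw x hx with ⟨e, e'⟩ | ⟨e, e'⟩ <;> simp [e, e', hne.symm]
    · rw [h1]
      refine ⟨x, ?_, h2, fun φ _ w w' hw => Formula.Sat.congr_fv fun x hx => ?_⟩
      · obtain ⟨β, h3, h4, h5⟩ := hy
        exact ⟨β, h3, h5, h4⟩
      · rcases hw x hx with ⟨e, e'⟩ | ⟨e, e'⟩ <;> exact e.trans e'.symm

end IsStarSystem

end Sheets

namespace Frame

variable {σ : Type*} [Vocab σ] {C N : Type*} {F : Frame σ}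

theorem countable_isCopy {D : Set (Atom σ C)} (hD : D.Finite) :
    Countable {p : Copy C // IsCopy D p} := by
  have := countable_isSeq (cond := condUGC2) hD
  have := (dom_finite hD).to_subtype
  have hdom : ∀ p : {p : Copy C // IsCopy D p}, p.1.2 ∈ dom D := by
    rintro ⟨p, hp1, hp2, -⟩
    obtain ⟨G, t, e⟩ := List.exists_cons_of_ne_nil hp1.ne_nil
    rw [e] at hp1 hp2
    exact (hp1.isMaxGuarded G (by simp)).prop.subset_dom hp2
  refine Function.Injective.countable
    (β := {t : List (Set C) // IsSeq condUGC2 D t} × dom D)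
    (f := fun p => (⟨p.1.1, p.2.1⟩, ⟨p.1.2, hdom p⟩)) ?_
  intro p p' e
  simp only [Prod.mk.injEq, Subtype.mk.injEq] at e
  exact Subtype.ext (Prod.ext e.1 e.2)

/-- For every copy of a constant a star is chosen, so that adjacent copies agree. The stars are
assembled to a model of the unravelling. -/
theorem hasModels_of_binary [Infinite N] (hF : F.IsAdmissible)
    (hbinΦ : ∀ φ ∈ F.Φ, φ.rels ⊆ binarySymbols σ) (hbinS : F.S ⊆ binarySymbols σ) (hm : 1 ≤ F.m)
    (hatoms : ∀ r ∈ F.S, ∀ f : Fin (Vocab.arity r) → ℕ, (∀ i, f i < 2) →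
      Formula.atom ⟨r, f⟩ ∈ F.Φ)
    {K₀ K : ℕ} (hK₀ : ∀ ν : Set F.Ty → ℕ, (∀ ν' ≤ ν, Nat.card (Σ k, Fin (ν' k)) ≤ K₀ →
      F.HasStar (C ⊕ N) ν') → F.HasStar (C ⊕ N) ν) (hK : K₀ + 2 ≤ K) :
    F.HasModels C N True K condUGC2 := by
  intro D A hD hcl hroots G₀ hG₀ B₀ g₀ hB₀
  have hbin : ∀ α ∈ D, Vocab.arity α.rel ≤ 2 := fun α hα => hbinS (hcl.sig_subset ⟨α, hα, rfl⟩)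
  obtain ⟨S, hS, hedge, hroot⟩ := exists_stars hD hbin
    (fun d c₀ hmax B₀ g₀ hB₀ => hcl.exists_isStar hD hm hatoms hK₀ hK hmax hB₀) hroots hB₀
  let P := {p : Copy C // IsCopy D p}
  let nb : P → Set C := fun p => closedNbhd D p.1.2 \ {p.1.2}
  have hnbr : ∀ (p : P) c, ∃ q : P, c ∈ nb p → q.1 = nbrCopy p.1 c := by
    intro p c
    by_cases hc : c ∈ nb p
    · exact ⟨⟨_, (p.2.nbrCopy_spec hbin hD.2 hc.1 hc.2).1⟩, fun _ => rfl⟩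
    · exact ⟨p, fun h => (hc h).elim⟩
  choose nbr hnbr using hnbr
  let B : P → Set (Atom σ (C ⊕ N)) := fun p => (S p.1).1
  let g : P → C → C ⊕ N := fun p => (S p.1).2
  let lab : P → C := fun p => p.1.2
  have hlab : ∀ (p : P), ∀ c ∈ nb p, lab (nbr p c) = c := by
    intro p c hc
    simp only [lab]
    rw [hnbr p c hc]
    exact (p.2.nbrCopy_spec hbin hD.2 hc.1 hc.2).2.1
  have hmem : ∀ (p : P), ∀ c ∈ nb p, lab p ∈ nb (nbr p c) := by
    intro p c hc
    have e : (nbr p c).1.2 = c := hlab p c hc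
    simp only [nb, e]
    exact ⟨mem_closedNbhd_symm hc.1, fun e => hc.2 e.symm⟩
  have hself : ∀ p : P, lab p ∈ closedNbhd D (lab p) := by
    rintro ⟨p, hp1, hp2, -⟩
    obtain ⟨G, t, e⟩ := List.exists_cons_of_ne_nil hp1.ne_nil
    rw [e] at hp1 hp2
    exact (hp1.isMaxGuarded G (by simp)).mem_closedNbhd hp2 hp2
  have hsys : IsStarSystem F.Φ B g lab nb nbr := by
    refine ⟨fun p => (hS p.1 p.2).inj.mono ?_, fun p hp => hp.2 rfl, hlab, hmem, ?_, ?_, ?_⟩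
    · rintro x (rfl | hx)
      exacts [hself p, hx.1]
    · intro p c hc
      apply Subtype.ext
      rw [hnbr _ _ (hmem p c hc), hnbr p c hc]
      exact (p.2.nbrCopy_spec hbin hD.2 hc.1 hc.2).2.2
    · intro p c hc
      obtain ⟨α, hα, h1, h2⟩ := (isMaxGuarded_pair hbin hD.2 hc.1 hc.2).mem_closedNbhd
        (d := lab p) (c := c) (Or.inl rfl) (Or.inr rfl)
      refine ⟨α.map (g p), ((hS p.1 p.2).realizes c hc.1).facts α hα ?_, ?_, ?_⟩
      · obtain ⟨b, hb, hαb⟩ := Atom.exists_elems_subset_pair (hbin α hα) h1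
        obtain rfl : c = b := (hαb c h2).resolve_left hc.2
        exact hαb
      all_goals rw [Atom.elems_map]
      exacts [⟨_, h1, rfl⟩, ⟨_, h2, rfl⟩]
    · intro p c hc φ hφ v hv
      have := hedge p.1 p.2 c hc.1 hc.2 φ hφ v hv
      rwa [← hnbr p c hc] at this
  have hcov := hsys.isLocalCover
  let X := P × ℕ × (C ⊕ N)
  let s : X → C ⊕ N → X := sheetMap g lab nb nbr
  let center : P → X := fun p => (p, 0, g p (lab p))
  obtain ⟨d₀, hd₀⟩ := hG₀.prop.nonempty
  have hcopy₀ : ∀ d ∈ G₀, IsCopy D (copyAt [G₀] d) := fun d hd =>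
    IsSeq.isCopy (.single G₀ hG₀) hd
  obtain ⟨e, he⟩ : ∃ e : Copy C → X, ∀ p : P, e p.1 = center p := by
    classical
    refine ⟨fun p => if h : IsCopy D p then center ⟨p, h⟩ else center ⟨_, hcopy₀ d₀ hd₀⟩,
      fun p => dif_pos p.2⟩
  -- the star at a copy covers the copies of the maximal guarded sets
  have hbag : ∀ t, IsSeq condUGC2 D t → ∀ d ∈ t.headD ∅, ∀ (h : IsCopy D (copyAt t d)),
      ∀ x ∈ t.headD ∅, s (center ⟨_, h⟩) (g ⟨_, h⟩ x) = e (copyAt t x) := by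
    intro t ht d hd h x hx
    by_cases hxd : x = d
    · subst hxd
      rw [he ⟨_, h⟩]
      have := hcov.center (center ⟨_, h⟩)
      simp only [center, lab, copyAt_snd] at this ⊢
      exact this
    · have hmax : IsMaxGuarded D (t.headD ∅) := by
        obtain ⟨G, t, rfl⟩ := List.exists_cons_of_ne_nil ht.ne_nil
        exact ht.isMaxGuarded G (by simp)
      have hxn : x ∈ nb ⟨_, h⟩ := by
        simp only [nb, copyAt_snd]
        exact ⟨hmax.mem_closedNbhd hd hx, hxd⟩
      have h1 := hsys.sheetMap_zero hxn
      have h2 := hnbr _ _ hxn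
      rw [nbrCopy_copyAt hbin ht hd hx hxd] at h2
      rw [← h2, he]
      exact h1
  have hfacts : ∀ t, IsSeq condUGC2 D t → ∀ d ∈ t.headD ∅, ∀ h : IsCopy D (copyAt t d),
      ∀ α ∈ D, α.elems ⊆ t.headD ∅ → α.map (g ⟨_, h⟩) ∈ B ⟨_, h⟩ := by
    intro t ht d hd h α hα hαt
    have hmax : IsMaxGuarded D (t.headD ∅) := by
      obtain ⟨G, t, rfl⟩ := List.exists_cons_of_ne_nil ht.ne_nil
      exact ht.isMaxGuarded G (by simp)
    obtain ⟨c, hc⟩ := hmax.exists_eq_pair hbin hd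
    have hst := hS _ h
    rw [copyAt_snd] at hst
    refine (hst.realizes c (hmax.mem_closedNbhd hd ?_)).facts α hα (hc ▸ hαt)
    rw [hc]
    exact Or.inr rfl
  have := countable_isCopy hD.2
  obtain ⟨e', he', he'_ne⟩ := exists_embedding_copy (N := N) condUGC2 D (P × ℕ)
  classical
  -- the centres of the copies number `0` become the copies of constants
  let j : X → Copy C ⊕ N := fun z =>
    if z = center z.1 then Sum.inl z.1.1 else e' ((z.1, z.2.1), z.2.2)
  have hj : Function.Injective j := by
    rintro ⟨p, i, x⟩ ⟨p', i', x'⟩ h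
    simp only [j] at h
    split at h <;> split at h
    · rename_i h1 h2
      rw [h1, h2]
      simp only [Sum.inl.injEq] at h
      rw [Subtype.ext h]
    · exact (he'_ne _ _ p.2.1 h.symm).elim
    · exact (he'_ne _ _ p'.2.1 h).elim
    · have := he' h
      simp only [Prod.mk.injEq] at this
      obtain ⟨⟨rfl, rfl⟩, rfl⟩ := this
      rfl
  refine exists_model_of_embedding hF hcl.sig_subset
    (A := starUnion (fun z : X => B z.1) (fun z => z.2.2) s) e (j := j) hj.injOn ?_ ?_ ?_ hG₀ ?_
  · intro p hp
    obtain ⟨G, t, d, ht, hd, rfl⟩ := mem_dom_unravelling hp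
    have h := ht.isCopy (d := d) hd
    rw [he ⟨_, h⟩]
    exact if_pos rfl
  · rintro _ ⟨_, ⟨t, ht, G, hG, α, hα, hαG, rfl⟩, rfl⟩
    obtain ⟨G', t, rfl⟩ := List.exists_cons_of_ne_nil ht.ne_nil
    simp only [List.head?_cons, Option.mem_def, Option.some.injEq] at hG
    subst hG
    obtain ⟨d, hd⟩ := α.elems_nonempty
    have h := ht.isCopy (d := d) (hαG hd)
    refine ⟨center ⟨_, h⟩, _, hfacts _ ht d (hαG hd) h α hα hαG, ?_, ?_⟩
    · rw [Atom.elems_map]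
      refine ⟨d, hd, ?_⟩
      simp only [center, lab, copyAt_snd]
    · rw [Atom.map_map, Atom.map_map]
      exact Atom.map_congr fun x hx => (hbag _ ht d (hαG hd) h x (hαG hx)).symm
  · exact fun t ht => hcov.holds hF.subClosed hF.guarded hbinΦ (hF.body_mem t ht)
      (hF.guard_mem t ht) (hF.fv_subset t ht) fun z =>
        ((hS z.1.1 z.1.2).realizes _ (hself z.1)).holds t ht
  · intro φ hφ v hv
    have h := hcopy₀ d₀ hd₀
    obtain ⟨c, hc⟩ := hG₀.exists_eq_pair hbin hd₀
    obtain ⟨α, hα, hG₀α⟩ := hG₀.exists_atom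
    have hm := hfacts [G₀] (.single G₀ hG₀) d₀ hd₀ h α hα hG₀α.symm.subset
    have hmem : ∀ x ∈ G₀, g ⟨_, h⟩ x ∈ (α.map (g ⟨_, h⟩)).elems := fun x hx => by
      rw [Atom.elems_map]; exact ⟨x, hG₀α ▸ hx, rfl⟩
    have h1 := hcov.sat_iff hF.subClosed hF.guarded hbinΦ hφ (z := center ⟨_, h⟩)
      (y := g ⟨_, h⟩ c) ⟨_, hm, hmem d₀ hd₀, hmem c (by rw [hc]; exact Or.inr rfl)⟩
      (w := g ⟨_, h⟩ ∘ v) fun x hx => by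
        have := hv x hx
        rw [hc] at this
        exact this.imp (congrArg _) (congrArg _)
    refine (hroot hG₀ d₀ hd₀ φ hφ v hv).trans (h1.symm.trans (Formula.Sat.congr_fv fun x hx => ?_))
    exact hbag [G₀] (.single G₀ hG₀) d₀ hd₀ h _ (hv x hx)

end Frame

/-! ### The frames of ontologies and queries -/

section Frames

variable {σ : Type*} [Vocab σ]

/-- The guard of a sentence as a formula, if it is an atom, and the body otherwise. -/
def Sentence.guardFormula (s : Sentence σ) : Formula σ :=
  match s.guard with
  | .atom α => .atom α
  | .eqSelf _ => s.body

/-- Types refer to the formulas in `Ψ`, the bodies and the guards of the sentences of the ontology,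
and the subformulas of these. -/
theorem exists_frame (O : Ontology σ) {Ψ : Set (Formula σ)} (hΨ : Ψ.Finite) (m : ℕ) {S : Set σ}
    (hS : S.Finite) {q : CQ σ} (hq : q.IsRAQ) :
    ∃ F : Frame σ, F.O = O ∧ F.m = m ∧ F.S = S ∧ F.q = q ∧
      F.Φ = ⋃ φ ∈ Ψ ∪ (Sentence.body '' O ∪ Sentence.guardFormula '' O), φ.sub := by
  have hfin : (⋃ φ ∈ Ψ ∪ (Sentence.body '' O ∪ Sentence.guardFormula '' O), φ.sub).Finite :=
    (hΨ.union ((O.finite_toSet.image _).union (O.finite_toSet.image _))).biUnion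
      fun φ _ => φ.sub_finite
  obtain ⟨M, hM⟩ := (hfin.biUnion fun φ _ => φ.fv.finite_toSet).bddAbove
  obtain ⟨n, hn⟩ := Nat.exists_eq_succ_of_ne_zero hq.arity_pos.ne'
  exact ⟨⟨O, _, hfin, M + 1, fun φ hφ x hx => Nat.lt_succ_of_le
    (hM (Set.mem_biUnion (t := fun φ : Formula σ => (φ.fv : Set ℕ)) hφ hx)), m, S, hS, q, n, hn⟩,
    rfl, rfl, rfl, rfl, rfl⟩

namespace Frame

variable {F : Frame σ} {Ψ : Set (Formula σ)}

theorem subset_of_eq_biUnion_sub (hΦ : F.Φ =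
    ⋃ φ ∈ Ψ ∪ (Sentence.body '' F.O ∪ Sentence.guardFormula '' F.O), φ.sub) : Ψ ⊆ F.Φ := by
  rw [hΦ]
  exact fun φ hφ => Set.mem_biUnion (t := Formula.sub) (Or.inl hφ) φ.mem_sub_self

theorem forall_of_eq_biUnion_sub (hΦ : F.Φ =
    ⋃ φ ∈ Ψ ∪ (Sentence.body '' F.O ∪ Sentence.guardFormula '' F.O), φ.sub)
    {p : Formula σ → Prop} (hp : ∀ φ, p φ → ∀ ψ ∈ φ.sub, p ψ) (hΨ : ∀ φ ∈ Ψ, p φ)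
    (hbody : ∀ s ∈ F.O, p s.body) (hguard : ∀ s ∈ F.O, ∀ α, s.guard = .atom α → p (.atom α)) :
    ∀ φ ∈ F.Φ, p φ := by
  intro ψ hψ
  rw [hΦ] at hψ
  simp only [Set.mem_iUnion, exists_prop] at hψ
  obtain ⟨φ, hφ | ⟨s, hs, rfl⟩ | ⟨s, hs, rfl⟩, hψ⟩ := hψ
  · exact hp _ (hΨ φ hφ) ψ hψ
  · exact hp _ (hbody s hs) ψ hψ
  · refine hp _ ?_ ψ hψ
    cases h : s.guard with
    | atom α => simp only [Sentence.guardFormula, h]; exact hguard s hs α h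
    | eqSelf y => simp only [Sentence.guardFormula, h]; exact hbody s hs

theorem isAdmissible_of_eq_biUnion_sub (hΦ : F.Φ =
    ⋃ φ ∈ Ψ ∪ (Sentence.body '' F.O ∪ Sentence.guardFormula '' F.O), φ.sub)
    (hΨ : ∀ φ ∈ Ψ, φ.Guarded) (hbody : ∀ s ∈ F.O, s.body.Guarded)
    (hfv : ∀ s ∈ F.O, s.body.fv ⊆ s.guard.vars) : F.IsAdmissible where
  subClosed := by
    intro ψ hψ χ hχ
    rw [hΦ] at hψ ⊢
    simp only [Set.mem_iUnion, exists_prop] at hψ ⊢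
    obtain ⟨φ, hφ, hψ⟩ := hψ
    exact ⟨φ, hφ, Formula.sub_trans ψ hψ hχ⟩
  guarded := forall_of_eq_biUnion_sub hΦ (fun _ h => Formula.Guarded.of_mem_sub h) hΨ
    hbody fun _ _ _ _ => trivial
  body_mem := by
    intro s hs
    rw [hΦ]
    exact Set.mem_biUnion (t := Formula.sub) (Or.inr (Or.inl ⟨s, hs, rfl⟩)) s.body.mem_sub_self
  guard_mem := by
    intro s hs α hα
    rw [hΦ]
    refine Set.mem_biUnion (t := Formula.sub) (Or.inr (Or.inr ⟨s, hs, rfl⟩)) ?_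
    simp only [Sentence.guardFormula, hα]
    exact Formula.mem_sub_self _
  fv_subset := hfv

end Frame

end Frames

/-! ### Rewritability -/

section Rewritability

variable {σ ΔD ΔN : Type*} [Vocab σ] [Infinite ΔD] [Infinite ΔN]


/-- For uGF(=) ontologies the program of sound rules is a rewriting; without equality, the models of
the unravelling can be built from realizations that are not injective, and no inequalities are
needed. -/
theorem exists_rewriting_of_isUGFEq
    (hσ : ∀ k : ℕ, 1 ≤ k → {r : σ | Vocab.arity r = k}.Infinite) {O : Ontology σ}
    (hO : ∀ s ∈ O, s.IsUGFEq) (htol : UGFTolerant ΔD ΔN O) (neq : Prop)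
    (hneq : neq ∨ ∀ s ∈ O, s.IsUGF) {q : CQ σ} (hq : q.IsRAQ) {S : Set σ} (hS : S.Finite) :
    ∃ (F : Frame σ) (K : ℕ), (F.program (ΔD ⊕ ΔN) neq K).Rewrites ΔD ΔN S O q := by
  obtain ⟨ψ, ⟨hψ1, hψ2, hψ3, -⟩, hψ⟩ := hq.exists_formula
  obtain ⟨m, hm⟩ := (hS.image Vocab.arity).bddAbove
  obtain ⟨F, rfl, rfl, rfl, rfl, hΦ⟩ := exists_frame O (Set.finite_singleton ψ) m hS hq
  have hF : F.IsAdmissible := Frame.isAdmissible_of_eq_biUnion_sub hΦ (by simpa using hψ1.guarded)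
    (fun s hs => (hO s hs).2.guarded) fun s hs => (hO s hs).1
  have hGF : ∀ φ ∈ F.Φ, φ.IsOpenGF := Frame.forall_of_eq_biUnion_sub hΦ
    (fun _ h => Formula.IsOpenGF.of_mem_sub h) (by simpa using hψ1) (fun s hs => (hO s hs).2)
    fun _ _ _ _ => trivial
  have hEq : neq ∨ ∀ φ ∈ F.Φ, φ.EqFree := hneq.imp_right fun h =>
    Frame.forall_of_eq_biUnion_sub hΦ (fun _ h => Formula.EqFree.of_mem_sub h) (by simpa using hψ2)
      (fun s hs => (h s hs).2) fun _ _ _ _ => trivial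
  refine ⟨F, F.m + 1 + (F.n + 1), Frame.rewrites hσ (V := Set.univ) (fun _ _ _ _ => trivial)
    (Set.subset_univ _) (Set.subset_univ _) hq (fun r hr => (hm ⟨r, hr, rfl⟩).trans (by omega))
    le_rfl (Frame.subset_of_eq_biUnion_sub hΦ rfl) hψ3 hψ htol
    (Frame.hasModels_of_isOpenGF hF hGF hEq _ _)
    (Frame.hasUnguardedModels_of_isOpenGF hF hGF _)⟩

/-- For uGC₂(=) ontologies the program of sound rules is a rewriting if the rules have enough
variables, depending on the bound for stars. -/
theorem exists_rewriting_of_isUGC2Eq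
    (hσ : ∀ k : ℕ, 1 ≤ k → {r : σ | Vocab.arity r = k}.Infinite) {O : Ontology σ}
    (hO : ∀ s ∈ O, s.IsUGC2Eq) (htol : UGC2Tolerant ΔD ΔN O) {q : CQ σ} (hq : q.IsRAQ)
    (hqV : sig (q.body : Set (Atom σ ℕ)) ⊆ binarySymbols σ) {S : Set σ} (hS : S.Finite)
    (hSV : S ⊆ binarySymbols σ) :
    ∃ (F : Frame σ) (K : ℕ), (F.program (ΔD ⊕ ΔN) True K).Rewrites ΔD ΔN S O q := by
  obtain ⟨ψ, ⟨hψ1, -, hψ3, hψ4⟩, hψ⟩ := hq.exists_formula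
  -- the facts of instances are recorded in the types of pairs
  set At : Set (Formula σ) := Formula.atom '' {α | α.rel ∈ S ∧ ∀ x ∈ α.elems, x < 2} with hAt
  have hAtfin : At.Finite := (finite_atoms hS 2).image _
  obtain ⟨F, rfl, hm, rfl, rfl, hΦ⟩ := exists_frame O (hAtfin.insert ψ) 1 hS hq
  have hF : F.IsAdmissible := Frame.isAdmissible_of_eq_biUnion_sub hΦ (by
      rintro φ (rfl | ⟨α, -, rfl⟩)
      exacts [hψ1.guarded, trivial])
    (fun s hs => (hO s hs).2.2.guarded) fun s hs => (hO s hs).2.1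
  have hbin : ∀ φ ∈ F.Φ, φ.rels ⊆ binarySymbols σ := by
    refine Frame.forall_of_eq_biUnion_sub hΦ (p := fun φ => φ.rels ⊆ binarySymbols σ)
      (fun φ h ψ hψ => (Formula.rels_of_mem_sub ψ hψ).trans h) ?_
      (fun s hs => (hO s hs).2.2.rels_subset) fun s hs α hα => ?_
    · rintro φ (rfl | ⟨α, hα, rfl⟩)
      · exact hψ4.trans hqV
      · rintro _ rfl
        exact hSV hα.1
    · have h := (hO s hs).1
      rw [hα] at h
      rintro _ rfl
      exact h.1
  obtain ⟨K₀, hK₀⟩ := F.exists_starBound (ΔD ⊕ ΔN)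
  refine ⟨F, F.m + 1 + (F.n + 1) + (K₀ + 2), Frame.rewrites hσ (V := binarySymbols σ)
    (fun r r' e h => e.symm.trans_le h) hSV hqV hq (fun r hr => ?_) (by omega)
    (Frame.subset_of_eq_biUnion_sub hΦ (Or.inl rfl)) hψ3 hψ htol
    (Frame.hasModels_of_binary hF hbin hSV hm.ge (fun r hr f hf => ?_) hK₀ (by omega))
    (Frame.hasUnguardedModels_of_binary hF hbin)⟩
  · rw [hm]
    exact hSV hr
  · refine Frame.subset_of_eq_biUnion_sub hΦ (Or.inr ⟨_, ⟨hr, ?_⟩, rfl⟩)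
    rintro _ ⟨i, rfl⟩
    exact hf i

end Rewritability

end OMQ

theorem theorem4p2 {σ ΔD ΔN : Type*} [Vocab σ] [Infinite ΔD] [Infinite ΔN]
    (hσ : ∀ k : ℕ, 1 ≤ k → {r : σ | Vocab.arity r = k}.Infinite) (O : Ontology σ) :
    ((∀ s ∈ O, s.IsUGFEq) → UGFTolerant ΔD ΔN O →
        RAQDatalogNeqRewritable ΔD ΔN Set.univ O ∧
        ((∀ s ∈ O, s.IsUGF) → RAQDatalogRewritable ΔD ΔN Set.univ O)) ∧
    ((∀ s ∈ O, s.IsUGC2Eq) → UGC2Tolerant ΔD ΔN O →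
        RAQDatalogNeqRewritable ΔD ΔN (binarySymbols σ) O) := by
  refine ⟨fun hO htol => ⟨fun q hq _ S hS _ => ?_, fun hO' q hq _ S hS _ => ?_⟩,
    fun hO htol q hq hqV S hS hSV => ?_⟩
  · obtain ⟨F, K, h⟩ := exists_rewriting_of_isUGFEq hσ hO htol True (Or.inl trivial) hq hS
    exact ⟨_, h⟩
  · obtain ⟨F, K, h⟩ := exists_rewriting_of_isUGFEq hσ hO htol False (Or.inr hO') hq hS
    exact ⟨_, F.program_neqFree _ K, h⟩
  · obtain ⟨F, K, h⟩ := exists_rewriting_of_isUGC2Eq hσ hO htol hq hqV hS hSV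
    exact ⟨_, h⟩
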